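/- Let $k$ be an algebraically closed field and let $G\subseteq \mathrm{SL}_2(k)$ be a nontrivial finite subgroup that is, as an abstract group, a Klein group: a cyclic group, a binary dihedral group of order $4n$ ($n\ge 1$), or the binary tetrahedral, octahedral or icosahedral group (of order $24$, $48$, $120$). Assume that the characteristic of $k$ does not divide $|G|$. Let $G$ act on $S=k[[u,v]]$ by linear changes of variables, where $u,v$ is regarded as the standard basis of the fundamental representation $V_1=k^2$ of $G\subseteq\mathrm{SL}_2(k)$, and let $R=S^G$ be the corresponding two-dimensional Kleinian singularity, a local ring with maximal ideal $\mathfrak m$ and residue field $\kappa=R/\mathfrak m$ $(\cong k)$. A canonical module of $R$ is a finitely generated $R$-module $K$ such that $\mathrm{Ext}^2_R(\kappa,K)\cong\kappa$ and $\mathrm{Ext}^i_R(\kappa,K)=0$ for all $i\ne 2$. A fundamental (or Auslander) module of $R$ is a finitely generated reflexive $R$-module $E$ that is the middle term of a non-split short exact sequence $0\to K\to E\to\mathfrak m\to 0$ with $K$ a canonical module of $R$. The second syzygy $\mathrm{Syz}^2_R(\kappa)$ is the second syzygy module in a minimal free resolution of $\kappa$ over $R$. Then $R$ has a fundamental module,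 $\mathrm{Syz}^2_R(\kappa)$ exists, and for every second syzygy module $\mathrm{Syz}^2_R(\kappa)$ (formed with any minimal free resolution) and every fundamental module $E$ of $R$ there are isomorphisms of $R$-modules $$\mathrm{Syz}^2_R(\kappa)\;\cong\;E\qquad\text{and}\qquad \mathrm{Syz}^2_R(\kappa)\;\cong\;(S\otimes_k V_1)^G,$$ where $G$ acts diagonally on $S\otimes_k V_1$. -/

import Mathlib

open scoped TensorProduct MatrixGroups

universe u

namespace Kleinian

/-! ### Klein groups -/

/-- The relators of the binary polyhedral group `⟨p, q, r⟩`, written as words in the free group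
on three letters `x, y, z`: they express `x ^ p = y ^ q = z ^ r = x * y * z`. -/
def binaryPolyhedralRels (p q r : ℕ) : Set (FreeGroup (Fin 3)) :=
  let x := FreeGroup.of (0 : Fin 3)
  let y := FreeGroup.of (1 : Fin 3)
  let z := FreeGroup.of (2 : Fin 3)
  {x ^ p * (x * y * z)⁻¹, y ^ q * (x * y * z)⁻¹, z ^ r * (x * y * z)⁻¹}

/-- The binary polyhedral group `⟨x, y, z ∣ x ^ p = y ^ q = z ^ r = x * y * z⟩`. For
`(p, q, r) = (2, 3, 3)`, `(2, 3, 4)`, `(2, 3, 5)` it is the binary tetrahedral group (of order 24),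
the binary octahedral group (of order 48), the binary icosahedral group (of order 120). -/
abbrev BinaryPolyhedralGroup (p q r : ℕ) : Type :=
  PresentedGroup (binaryPolyhedralRels p q r)

/-- A Klein group: a group isomorphic to a finite cyclic group, to a binary dihedral group of order
`4 * n`, or to the binary tetrahedral, octahedral or icosahedral group. -/
def IsKleinGroup (Γ : Type*) [Group Γ] : Prop :=
  (Finite Γ ∧ IsCyclic Γ) ∨
  (∃ n : ℕ, 1 ≤ n ∧ Nonempty (Γ ≃* QuaternionGroup n)) ∨
  Nonempty (Γ ≃* BinaryPolyhedralGroup 2 3 3) ∨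
  Nonempty (Γ ≃* BinaryPolyhedralGroup 2 3 4) ∨
  Nonempty (Γ ≃* BinaryPolyhedralGroup 2 3 5)

/-! ### Linear actions on the power series ring in two variables, invariants -/

section Action

variable {k : Type u} [Field k]

/-- The image of the variable `x_j` under the matrix `A`, that is, the linear form
`∑ i, A i j * x_i`. With `x_0, x_1` as the standard basis of `k²`, this is `A e_j`. -/
noncomputable def linForm (A : Matrix (Fin 2) (Fin 2) k) (j : Fin 2) :
    MvPowerSeries (Fin 2) k :=
  ∑ i, A i j • MvPowerSeries.X i

lemma hasSubst_linForm (A : Matrix (Fin 2) (Fin 2) k) :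
    MvPowerSeries.HasSubst (linForm A) := by
  refine MvPowerSeries.hasSubst_of_constantCoeff_zero fun j => ?_
  simp [linForm, MvPowerSeries.smul_eq_C_mul]

/-- The linear action of `SL(2, k)` on `k⟦x_0, x_1⟧`: the element `g` acts by the `k`-algebra
endomorphism that substitutes `∑ i, g i j * x_i` for `x_j`. -/
noncomputable def linSubst (g : SL(2, k)) :
    MvPowerSeries (Fin 2) k →ₐ[k] MvPowerSeries (Fin 2) k :=
  MvPowerSeries.substAlgHom (hasSubst_linForm g.val)

/-- The ring of invariants `k⟦x_0, x_1⟧ ^ G` of a subgroup `G` of `SL(2, k)`. -/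
noncomputable def invariantRing (G : Subgroup SL(2, k)) :
    Subalgebra k (MvPowerSeries (Fin 2) k) where
  carrier := {f | ∀ g ∈ G, linSubst g f = f}
  mul_mem' ha hb g hg := by rw [map_mul, ha g hg, hb g hg]
  add_mem' ha hb g hg := by rw [map_add, ha g hg, hb g hg]
  algebraMap_mem' r g _ := AlgHom.commutes _ r

lemma isLocalHom_subtype_invariantRing (G : Subgroup SL(2, k)) :
    IsLocalHom (invariantRing G).val.toRingHom := by
  refine ⟨fun a ha => ?_⟩
  obtain ⟨b, hb⟩ := ha.exists_right_inv
  have hb' : (a : MvPowerSeries (Fin 2) k) * b = 1 := hb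
  have hmem : b ∈ invariantRing G := by
    intro g hg
    have h1 := congrArg (linSubst g) hb'
    rw [map_mul, map_one, a.2 g hg] at h1
    have hne : (a : MvPowerSeries (Fin 2) k) ≠ 0 := left_ne_zero_of_mul_eq_one hb'
    exact mul_left_cancel₀ hne (h1.trans hb'.symm)
  exact IsUnit.of_mul_eq_one ⟨b, hmem⟩ (Subtype.ext hb')

noncomputable instance isLocalRing_invariantRing (G : Subgroup SL(2, k)) :
    IsLocalRing (invariantRing G) :=
  haveI := isLocalHom_subtype_invariantRing G
  RingHom.domain_isLocalRing (invariantRing G).val.toRingHom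

/-! ### The Auslander functor on objects -/

/-- The module `(S ⊗[k] V) ^ G` over the ring of invariants `R = S ^ G`, where `S = k⟦x_0, x_1⟧`,
where `V` is a representation of `G`, and where `G` acts diagonally on `S ⊗[k] V`. -/
noncomputable def auslanderModule (G : Subgroup SL(2, k)) {V : Type u} [AddCommGroup V]
    [Module k V] (ρ : Representation k G V) :
    Submodule (invariantRing G) (MvPowerSeries (Fin 2) k ⊗[k] V) where
  carrier := {t | ∀ g : G,
    TensorProduct.map (linSubst (g : SL(2, k))).toLinearMap (ρ g) t
      = t}
  add_mem' ha hb g := by rw [map_add, ha g, hb g]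
  zero_mem' g := map_zero _
  smul_mem' c t ht g := by
    have key : ∀ s : MvPowerSeries (Fin 2) k ⊗[k] V,
        TensorProduct.map (linSubst (g : SL(2, k))).toLinearMap (ρ g)
          (c • s) = c • TensorProduct.map
            (linSubst (g : SL(2, k))).toLinearMap (ρ g) s := by
      intro s
      induction s with
      | zero => simp
      | add x y hx hy => rw [smul_add, map_add, map_add, smul_add, hx, hy]
      | tmul f v =>
        have hc := c.2 g g.2
        have h1 : linSubst (g : SL(2, k)) ((c : MvPowerSeries (Fin 2) k) * f) =
            (c : MvPowerSeries (Fin 2) k) * linSubst (g : SL(2, k)) f := by rw [map_mul, hc]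
        change linSubst (g : SL(2, k)) ((c : MvPowerSeries (Fin 2) k) * f) ⊗ₜ[k] ρ g v =
          ((c : MvPowerSeries (Fin 2) k) * linSubst (g : SL(2, k)) f) ⊗ₜ[k] ρ g v
        rw [h1]
    rw [key, ht g]

/-- The fundamental representation of a subgroup `G` of `SL(2, k)`: the group `G` acts on `k²` by
matrix multiplication. -/
noncomputable def fundamentalRep (G : Subgroup SL(2, k)) : Representation k G (Fin 2 → k) where
  toFun g := Matrix.toLin' (g : SL(2, k)).val
  map_one' := by simp [Module.End.one_eq_id]
  map_mul' g h := by simp [Matrix.toLin'_mul, Module.End.mul_eq_comp]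

end Action

/-! ### Syzygies and the fundamental module of a local ring -/

section Local

variable (R : Type u) [CommRing R] [IsLocalRing R]

/-- `IsSyzygy R n M N` says that `N` is (isomorphic to) the `n`-th syzygy of `M` in a minimal free
resolution of `M`: it is obtained from `M` by iterating `n` times the passage to the kernel of a
surjection `f` from a free module of finite rank whose kernel lies in `𝔪` times that module. -/
def IsSyzygy (n : ℕ) (M : Type u) [AddCommGroup M] [Module R M]
    (N : Type u) [AddCommGroup N] [Module R N] : Prop :=
  match n with
  | 0 => Nonempty (N ≃ₗ[R] M)
  | n + 1 => ∃ (r : ℕ) (f : (Fin r → R) →ₗ[R] M), Function.Surjective f ∧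
      LinearMap.ker f ≤ IsLocalRing.maximalIdeal R • (⊤ : Submodule R (Fin r → R)) ∧
      IsSyzygy n (LinearMap.ker f) N

/-- `K` is a canonical module of the `d`-dimensional (Cohen-Macaulay) local ring `R`: it is finitely
generated, and `Ext^i(κ, K)` is `κ` for `i = d` and zero for `i ≠ d`, where `κ` is the residue
field. -/
def IsCanonicalModule (d : ℕ) (K : Type u) [AddCommGroup K] [Module R K] : Prop :=
  Module.Finite R K ∧
  Nonempty (CategoryTheory.Abelian.Ext (ModuleCat.of R (IsLocalRing.ResidueField R))
    (ModuleCat.of R K) d ≃ₗ[R] IsLocalRing.ResidueField R) ∧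
  ∀ i : ℕ, i ≠ d → Subsingleton (CategoryTheory.Abelian.Ext
    (ModuleCat.of R (IsLocalRing.ResidueField R)) (ModuleCat.of R K) i)

/-- `E` is a fundamental (or Auslander) module of the two-dimensional local ring `R`: a finitely
generated reflexive module that is the middle term of a non-split short exact sequence
`0 → K → E → 𝔪 → 0`, where `K` is a canonical module of `R`. -/
def IsFundamentalModule (E : Type u) [AddCommGroup E] [Module R E] : Prop :=
  Module.Finite R E ∧ Module.IsReflexive R E ∧
  ∃ (K : Type u) (_ : AddCommGroup K) (_ : Module R K)
    (f : K →ₗ[R] E) (g : E →ₗ[R] IsLocalRing.maximalIdeal R),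
    IsCanonicalModule R 2 K ∧
    Function.Injective f ∧ Function.Exact f g ∧ Function.Surjective g ∧
    ¬ ∃ s : IsLocalRing.maximalIdeal R →ₗ[R] E, g ∘ₗ s = LinearMap.id

end Local

end Kleinian

set_option linter.unusedSectionVars false

/-! Write V = k², m for the maximal ideal of R, 1 for the trivial representation. The Koszul complex
0 → S → S ⊗ V → S of u, v is equivariant because det g = 1. Since |G| is invertible, taking
invariants is exact and gives 0 → R → (S ⊗ V)^G → m → 0; a section would put 1 into (u, v), so this
does not split. Two things remain: every fundamental module is isomorphic to the middle term of this
extension, and so is every second syzygy of κ.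

Fundamental modules. R is Gorenstein: for invariant parameters a, b the socle of S/(a, b) is
generated by the determinant of invariant lifts of a and b along the Koszul map. This determinant is
itself invariant, so an averaged functional makes R/(a^n, b^n) self-injective
(`exists_nondegenerate_functional`). The local cohomology H²_m(R), built as an iterated Čech
quotient, is then injective with socle κ. Dimension shifting shows that R is a canonical module, and
comparing H²_m(K) with H²_m(R) shows that every canonical K is isomorphic to R
(`IsGorensteinSystem.nonempty_equiv_of_isCanonicalModule`). As Ext¹(m, R) ≅ Ext²(κ, R) ≅ κ, all
non-split extensions of m by R have isomorphic middle terms (`nonempty_equiv_of_nonsplit`).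

Syzygies. Let a_1, …, a_e be minimal generators of m, let Rel be the module of their relations with
coefficients in S, and put B = S/mS and U = Rel/(u, v)Rel. The second syzygy consists of the
invariant elements of Rel. Since Rel is free over S with top U, an isomorphism U ≅ V lifts to an
equivariant Rel ≅ S ⊗ V, and taking invariants finishes the proof.

To find U, the Koszul homology of B gives V ⊗ B + U + 1 = 2B + e·1 in the representation ring
(`IsMinGen.mult_relation`). Tensoring with V has a symmetric matrix whose positive eigenvector, the
dimension vector, has eigenvalue 2 (McKay); hence dim Hom_G(X, V ⊗ X) ≤ 2 dim Hom_G(X, X), with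
equality only if V ⊗ X ≅ 2X (`homRank_twist_le`). Moreover dim Hom_G(U, B) ≤ e + 1: equivariant
forms on Rel restrict to R-linear forms on the syzygy, and modulo those coming from R^e these embed
into the one-dimensional Ext¹(m, R) (`IsMinGen.homRank_relTop_fiber_le`). For X = B ⊕ 1 this yields
e ≤ 3, and U ≅ V when e = 3 (`le_three_of_relation`). Smaller e cannot occur: U is nonzero of
dimension e − 1, and for e = 2 the relation (a_2, −a_1) would be a non-unit multiple of the
generator of Rel. -/

namespace Kleinian

open CategoryTheory CategoryTheory.Abelian

/-! ### The quotient of a localization by the module -/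

section CechQuotient

variable {R : Type u} [CommRing R] (x : R) (K : Type u) [AddCommGroup K] [Module R K]

/-- The localization of a module away from an element. -/
abbrev LocAway : Type u := LocalizedModule (Submonoid.powers x) K

/-- The quotient `K_x / K`. -/
abbrev CechQuot : Type u :=
  LocAway x K ⧸ LinearMap.range (LocalizedModule.mkLinearMap (Submonoid.powers x) K)

lemma locAway_smul_bijective :
    Function.Bijective fun l : LocAway x K => x • l := by
  have := IsLocalizedModule.map_units (S := Submonoid.powers x)
    (LocalizedModule.mkLinearMap (Submonoid.powers x) K) ⟨x, Submonoid.mem_powers x⟩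
  exact (Module.End.isUnit_iff _).1 this

/-- The class of `k / x ^ n` in `K_x / K`. -/
noncomputable def frac (n : ℕ) : K →ₗ[R] CechQuot x K :=
  (Submodule.mkQ _) ∘ₗ
    (LocalizedModule.divBy (⟨x ^ n, Submonoid.pow_mem _ (Submonoid.mem_powers x) n⟩ : Submonoid.powers x)) ∘ₗ
      LocalizedModule.mkLinearMap (Submonoid.powers x) K

variable {x K}

lemma frac_apply (n : ℕ) (k : K) :
    frac x K n k = Submodule.Quotient.mk (LocalizedModule.mk k ⟨x ^ n, Submonoid.pow_mem _ (Submonoid.mem_powers x) n⟩) := by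
  simp only [frac, LinearMap.comp_apply, LocalizedModule.mkLinearMap_apply,
    LocalizedModule.divBy_apply, Submodule.mkQ_apply]
  congr 1
  rw [LocalizedModule.liftOn_mk]
  change LocalizedModule.mk k (1 * _) = _
  rw [one_mul]

lemma exists_frac (q : CechQuot x K) : ∃ n k, q = frac x K n k := by
  obtain ⟨l, rfl⟩ := Submodule.Quotient.mk_surjective _ q
  induction l using LocalizedModule.induction_on with
  | _ k s =>
    obtain ⟨_, n, rfl⟩ := s
    exact ⟨n, k, (frac_apply n k).symm⟩

lemma frac_add_pow_smul (n t : ℕ) (k : K) : frac x K (n + t) (x ^ t • k) = frac x K n k := by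
  rw [frac_apply, frac_apply]
  congr 1
  rw [LocalizedModule.mk_eq]
  refine ⟨1, ?_⟩
  simp only [one_smul, Submonoid.mk_smul, smul_smul]
  congr 1
  simp [pow_add]

lemma frac_zero (k : K) : frac x K 0 k = 0 := by
  rw [frac_apply, Submodule.Quotient.mk_eq_zero]
  refine ⟨k, ?_⟩
  rw [LocalizedModule.mkLinearMap_apply]
  congr 1
  ext; simp

lemma pow_smul_frac (n t : ℕ) (k : K) : x ^ t • frac x K (n + t) k = frac x K n k := by
  rw [← map_smul, frac_add_pow_smul]

lemma pow_smul_frac_self (n : ℕ) (k : K) : x ^ n • frac x K n k = 0 := by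
  have := pow_smul_frac (x := x) (K := K) 0 n k
  rwa [zero_add, frac_zero] at this

lemma exists_frac_ge (q : CechQuot x K) (n : ℕ) : ∃ t k, q = frac x K (n + t) k := by
  obtain ⟨m, k, rfl⟩ := exists_frac q
  exact ⟨m, x ^ n • k, by rw [add_comm, frac_add_pow_smul]⟩

lemma cechQuot_exists_pow_smul (q : CechQuot x K) : ∃ n, x ^ n • q = 0 := by
  obtain ⟨n, k, rfl⟩ := exists_frac q
  exact ⟨n, pow_smul_frac_self n k⟩

lemma cechQuot_divisible (q : CechQuot x K) (t : ℕ) : ∃ q', q = x ^ t • q' := by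
  obtain ⟨n, k, rfl⟩ := exists_frac q
  exact ⟨_, (pow_smul_frac n t k).symm⟩

lemma pow_smul_injective (hx : ∀ k : K, x • k = 0 → k = 0) (n : ℕ) {k : K}
    (h : x ^ n • k = 0) : k = 0 := by
  induction n generalizing k with
  | zero => simpa using h
  | succ n ih =>
    rw [pow_succ, mul_smul] at h
    exact hx _ (ih h)

lemma mkLinearMap_injective (hx : ∀ k : K, x • k = 0 → k = 0) :
    Function.Injective (LocalizedModule.mkLinearMap (Submonoid.powers x) K) := by
  rw [injective_iff_map_eq_zero]
  intro k hk
  rw [LocalizedModule.mkLinearMap_apply, ← LocalizedModule.zero_mk 1, LocalizedModule.mk_eq] at hk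
  obtain ⟨⟨_, n, rfl⟩, h⟩ := hk
  refine pow_smul_injective hx n ?_
  simpa [Submonoid.smul_def] using h

lemma frac_eq_zero (hx : ∀ k : K, x • k = 0 → k = 0) {n : ℕ} {k : K} :
    frac x K n k = 0 ↔ ∃ k', k = x ^ n • k' := by
  constructor
  · intro h
    rw [frac_apply, Submodule.Quotient.mk_eq_zero] at h
    obtain ⟨k', hk'⟩ := h
    rw [LocalizedModule.mkLinearMap_apply, LocalizedModule.mk_eq] at hk'
    obtain ⟨⟨_, t, rfl⟩, hk'⟩ := hk'
    refine ⟨k', ?_⟩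
    simp only [one_smul, Submonoid.smul_def] at hk'
    rw [← sub_eq_zero] at hk' ⊢
    refine pow_smul_injective hx t (neg_injective ?_)
    simpa [smul_sub] using hk'
  · rintro ⟨k', rfl⟩
    rw [map_smul, pow_smul_frac_self]

lemma exists_frac_of_pow_smul_eq_zero (hx : ∀ k : K, x • k = 0 → k = 0) {n : ℕ}
    {q : CechQuot x K} (h : x ^ n • q = 0) : ∃ k, q = frac x K n k := by
  obtain ⟨t, k, rfl⟩ := exists_frac_ge q n
  rw [add_comm, pow_smul_frac, frac_eq_zero hx] at h
  obtain ⟨k', rfl⟩ := h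
  exact ⟨k', by rw [frac_add_pow_smul]⟩

end CechQuotient

/-! ### The second Čech quotient -/

section CechQuotientTwo

variable {R : Type u} [CommRing R] (a b : R) (K : Type u) [AddCommGroup K] [Module R K]

/-- The quotient of the twofold localization `K_{ab}` by `K_a + K_b`. -/
abbrev CechTop : Type u := CechQuot b (CechQuot a K)

/-- The class of `k / (a ^ n * b ^ n)`. -/
noncomputable def topFrac (n : ℕ) : K →ₗ[R] CechTop a b K :=
  frac b (CechQuot a K) n ∘ₗ frac a K n

/-- `a` is regular on `K`, and `b` is regular on `K_a / K`. -/
structure CechRegular : Prop where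
  left : ∀ k : K, a • k = 0 → k = 0
  right : ∀ q : CechQuot a K, b • q = 0 → q = 0

variable {a b K}

lemma exists_topFrac (h : CechTop a b K) : ∃ n k, h = topFrac a b K n k := by
  obtain ⟨n, q, rfl⟩ := exists_frac h
  obtain ⟨t, k, rfl⟩ := exists_frac_ge q n
  refine ⟨n + t, b ^ t • k, ?_⟩
  rw [topFrac, LinearMap.comp_apply, map_smul, frac_add_pow_smul]

lemma pow_smul_topFrac_left (n : ℕ) (k : K) : a ^ n • topFrac a b K n k = 0 := by
  rw [topFrac, LinearMap.comp_apply, ← map_smul, pow_smul_frac_self, map_zero]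

lemma pow_smul_topFrac_right (n : ℕ) (k : K) : b ^ n • topFrac a b K n k = 0 := by
  rw [topFrac, LinearMap.comp_apply, pow_smul_frac_self]

/-- Embeds K/(a^n, b^n) into the top Čech quotient; this is where regularity of the sequence a, b
enters. -/
lemma topFrac_eq_zero (H : CechRegular a b K) {n : ℕ} {k : K} :
    topFrac a b K n k = 0 ↔ ∃ y z, k = a ^ n • y + b ^ n • z := by
  constructor
  · intro h
    rw [topFrac, LinearMap.comp_apply, frac_eq_zero H.right] at h
    obtain ⟨q, hq⟩ := h
    obtain ⟨t, y, rfl⟩ := exists_frac_ge q n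
    rw [← frac_add_pow_smul n t, ← map_smul, ← sub_eq_zero, ← map_sub,
      frac_eq_zero H.left] at hq
    obtain ⟨z, hz⟩ := hq
    -- From a^t k = b^n y + a^(n+t) z the element b^n y is divisible by a^t. Regularity of b on
    -- K_a/K makes y itself divisible by a^t, and then a^t cancels.
    have h1 : b ^ n • frac a K t y = 0 := by
      rw [← map_smul, frac_eq_zero H.left]
      refine ⟨k - a ^ n • z, ?_⟩
      rw [smul_sub, smul_smul, ← pow_add, add_comm t n, ← hz]
      abel
    have h2 := pow_smul_injective H.right n h1
    rw [frac_eq_zero H.left] at h2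
    obtain ⟨y', rfl⟩ := h2
    refine ⟨z, y', ?_⟩
    rw [← sub_eq_zero]
    refine pow_smul_injective H.left t ?_
    rw [smul_sub, smul_add, smul_smul, ← pow_add, add_comm t n, ← hz, smul_comm (a ^ t) (b ^ n)]
    abel
  · rintro ⟨y, z, rfl⟩
    rw [map_add, map_smul, map_smul, pow_smul_topFrac_left, pow_smul_topFrac_right, add_zero]

/-- Complements `topFrac_eq_zero`: the part of the top Čech quotient killed by a^n and b^n is
exactly the copy of K/(a^n, b^n). -/
lemma exists_topFrac_of_smul_eq_zero (H : CechRegular a b K) {n : ℕ} {h : CechTop a b K}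
    (ha : a ^ n • h = 0) (hb : b ^ n • h = 0) : ∃ k, h = topFrac a b K n k := by
  obtain ⟨q, rfl⟩ := exists_frac_of_pow_smul_eq_zero H.right hb
  rw [← map_smul, frac_eq_zero H.right] at ha
  obtain ⟨q', hq'⟩ := ha
  -- Changing q by b^n q'' does not affect q / b^n. Divisibility of K_a/K by a allows a choice of
  -- q'' after which the numerator is killed by a^n.
  obtain ⟨q'', rfl⟩ := cechQuot_divisible q' n
  have h1 : a ^ n • (q - b ^ n • q'') = 0 := by
    rw [smul_sub, hq', smul_comm, sub_self]
  obtain ⟨k, hk⟩ := exists_frac_of_pow_smul_eq_zero H.left h1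
  refine ⟨k, ?_⟩
  rw [topFrac, LinearMap.comp_apply, ← hk, map_sub, map_smul, pow_smul_frac_self, sub_zero]

lemma cechTop_exists_pow_smul (h : CechTop a b K) :
    ∃ n, a ^ n • h = 0 ∧ b ^ n • h = 0 := by
  obtain ⟨n, k, rfl⟩ := exists_topFrac h
  exact ⟨n, pow_smul_topFrac_left n k, pow_smul_topFrac_right n k⟩

lemma smul_eq_zero_of_pow_le {M : Type*} [AddCommGroup M] [Module R M] {x : R} {m n : ℕ}
    (hmn : m ≤ n) {h : M} (hm : x ^ m • h = 0) : x ^ n • h = 0 := by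
  obtain ⟨t, rfl⟩ := Nat.exists_eq_add_of_le hmn
  rw [add_comm, pow_add, mul_smul, hm, smul_zero]

end CechQuotientTwo

/-! ### Vanishing and shifting of `Ext` -/

section ExtShift

variable {R : Type u} [CommRing R]

/-- The element x acts on the Ext group as zero through M and invertibly through L. -/
lemma ext_subsingleton_of_smul_bijective {M L : Type u} [AddCommGroup M] [Module R M]
    [AddCommGroup L] [Module R L] (x : R) (hM : ∀ m : M, x • m = 0)
    (hL : Function.Bijective fun l : L => x • l) (n : ℕ) :
    Subsingleton (Ext (ModuleCat.of R M) (ModuleCat.of R L) n) := by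
  refine subsingleton_of_forall_eq 0 fun α => ?_
  have h0 : x • α = 0 := by
    rw [← Ext.mk₀_id_comp α, ← Ext.smul_comp, ← Ext.mk₀_smul]
    have : x • 𝟙 (ModuleCat.of R M) = 0 := by
      ext m
      exact hM m
    rw [this, Ext.mk₀_zero, Ext.zero_comp]
  let e : L ≃ₗ[R] L := LinearEquiv.ofBijective (LinearMap.lsmul R L x) hL
  have h1 : (x • 𝟙 (ModuleCat.of R L)) ≫ ModuleCat.ofHom e.symm.toLinearMap
      = 𝟙 (ModuleCat.of R L) := by
    ext l
    exact e.symm_apply_apply l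
  calc α = α.comp (Ext.mk₀ (𝟙 _)) (add_zero n) := (Ext.comp_mk₀_id α).symm
    _ = 0 := by
      rw [← h1, ← Ext.mk₀_comp_mk₀, ← Ext.comp_assoc (a₁₂ := n) _ _ _ (by lia) (by lia) (by lia),
        Ext.mk₀_smul, Ext.comp_smul, Ext.comp_mk₀_id, h0, Ext.zero_comp]

/-- The connecting isomorphism when the middle term has no extensions by `X`. -/
noncomputable def extShift {S : ShortComplex (ModuleCat.{u} R)} (hS : S.ShortExact)
    (X : ModuleCat.{u} R) (h : ∀ n, Subsingleton (Ext X S.X₂ n)) (n : ℕ) :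
    Ext X S.X₃ n ≃ₗ[R] Ext X S.X₁ (n + 1) :=
  LinearEquiv.ofBijective (hS.extClass.postcompOfLinear R X rfl) <| by
    constructor
    · rw [injective_iff_map_eq_zero]
      intro x hx
      obtain ⟨y, rfl⟩ := Ext.covariant_sequence_exact₃ X hS x rfl hx
      rw [(h n).elim y 0, Ext.zero_comp]
    · intro x
      exact Ext.covariant_sequence_exact₁ X hS x ((h (n + 1)).elim _ _) rfl

lemma shortExact_mk {A B C : Type u} [AddCommGroup A] [AddCommGroup B] [AddCommGroup C]
    [Module R A] [Module R B] [Module R C] (f : A →ₗ[R] B) (g : B →ₗ[R] C)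
    (hf : Function.Injective f) (hfg : Function.Exact f g) (hg : Function.Surjective g) :
    (ShortComplex.mk (ModuleCat.ofHom f) (ModuleCat.ofHom g)
      (by rw [← ModuleCat.ofHom_comp, hfg.linearMap_comp_eq_zero]; rfl)).ShortExact where
  exact := by
    rw [ShortComplex.ShortExact.moduleCat_exact_iff_function_exact]
    exact hfg
  mono_f := (ModuleCat.mono_iff_injective _).2 hf
  epi_g := (ModuleCat.epi_iff_surjective _).2 hg

/-- `Ext` in degree zero is the module of linear maps. -/
noncomputable def extZeroEquiv (M L : Type u) [AddCommGroup M] [Module R M] [AddCommGroup L]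
    [Module R L] : Ext (ModuleCat.of R M) (ModuleCat.of R L) 0 ≃ₗ[R] (M →ₗ[R] L) :=
  (Ext.linearEquiv₀ (R := R)).trans ModuleCat.homLinearEquiv

/-- If `M` has no extensions by `A`, every linear map from `M` to `C` lifts along
`0 → A → B → C → 0`. -/
lemma exists_comp_eq_of_subsingleton_ext {M A B C : Type u} [AddCommGroup M] [Module R M]
    [AddCommGroup A] [AddCommGroup B] [AddCommGroup C] [Module R A] [Module R B] [Module R C]
    (f : A →ₗ[R] B) (g : B →ₗ[R] C) (hf : Function.Injective f) (hfg : Function.Exact f g)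
    (hg : Function.Surjective g)
    (h : Subsingleton (Ext (ModuleCat.of R M) (ModuleCat.of R A) 1)) (α : M →ₗ[R] C) :
    ∃ β : M →ₗ[R] B, g ∘ₗ β = α := by
  obtain ⟨β, hβ⟩ := Ext.covariant_sequence_exact₃ (ModuleCat.of R M) (shortExact_mk f g hf hfg hg)
    (Ext.mk₀ (ModuleCat.ofHom α)) (zero_add 1) (h.elim _ _)
  obtain ⟨β, rfl⟩ := (Ext.mk₀_bijective _ _).2 β
  rw [Ext.mk₀_comp_mk₀] at hβ
  exact ⟨β.hom, congrArg ModuleCat.Hom.hom ((Ext.mk₀_bijective _ _).1 hβ)⟩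

variable {M : Type u} [AddCommGroup M] [Module R M] {K : Type u} [AddCommGroup K] [Module R K]
  {x : R}

/-- Dimension shifting along `0 → K → K_x → K_x / K → 0`. -/
noncomputable def extCechQuot (hM : ∀ m : M, x • m = 0) (hx : ∀ k : K, x • k = 0 → k = 0)
    (n : ℕ) : Ext (ModuleCat.of R M) (ModuleCat.of R (CechQuot x K)) n ≃ₗ[R]
      Ext (ModuleCat.of R M) (ModuleCat.of R K) (n + 1) :=
  extShift (shortExact_mk (LocalizedModule.mkLinearMap (Submonoid.powers x) K)
    (Submodule.mkQ _) (mkLinearMap_injective hx)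
    (LinearMap.exact_map_mkQ_range _) (Submodule.mkQ_surjective _)) _
    (ext_subsingleton_of_smul_bijective x hM (locAway_smul_bijective x K)) n

end ExtShift

end Kleinian

namespace Kleinian

open CategoryTheory CategoryTheory.Abelian IsLocalRing

/-! ### Socles and depth over a local ring -/

section LocalRing

variable {R : Type u} [CommRing R] [IsLocalRing R]

/-- Produces socle elements: if I does not kill h, some t in I gives t h ≠ 0 killed by one power of
I fewer, and the induction goes on from there. -/
lemma exists_smul_ne_zero_of_pow_smul_eq_zero {M : Type*} [AddCommGroup M] [Module R M]
    (I : Ideal R) (n : ℕ) {h : M} (hh : h ≠ 0) (hn : ∀ r ∈ I ^ n, r • h = 0) :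
    ∃ r : R, r • h ≠ 0 ∧ ∀ s ∈ I, s • r • h = 0 := by
  induction n generalizing h with
  | zero => exact absurd (by simpa using hn 1 (by simp)) hh
  | succ n ih =>
    by_cases hI : ∀ r ∈ I, r • h = 0
    · exact ⟨1, by simpa using hh, by simpa using hI⟩
    · push Not at hI
      obtain ⟨t, ht, hth⟩ := hI
      obtain ⟨r, hr, hs⟩ := ih hth fun r hr => by
        rw [smul_smul]
        exact hn _ (by rw [pow_succ]; exact Ideal.mul_mem_mul hr ht)
      refine ⟨r * t, by rwa [mul_smul], fun s hs' => ?_⟩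
      rw [mul_smul]
      exact hs s hs'

/-- The map out of the residue field determined by an element killed by the maximal ideal. -/
noncomputable def ofSocle {M : Type*} [AddCommGroup M] [Module R M] (h : M)
    (hh : ∀ r ∈ maximalIdeal R, r • h = 0) : ResidueField R →ₗ[R] M :=
  Submodule.liftQ (maximalIdeal R) (LinearMap.toSpanSingleton R M h) fun r hr => hh r hr

lemma ofSocle_residue {M : Type*} [AddCommGroup M] [Module R M] (h : M)
    (hh : ∀ r ∈ maximalIdeal R, r • h = 0) (r : R) :
    ofSocle h hh (residue R r) = r • h := rfl

lemma residue_smul_eq_zero {r : R} (hr : r ∈ maximalIdeal R) (t : ResidueField R) :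
    r • t = 0 := by
  obtain ⟨s, rfl⟩ := residue_surjective t
  change residue R (r * s) = 0
  rw [residue_eq_zero_iff]
  exact Ideal.mul_mem_right _ _ hr

lemma residue_eq_smul_one (r : R) : residue R r = r • (1 : ResidueField R) := by
  rw [Algebra.smul_def, mul_one]; rfl

/-- A module whose submodule killed by the maximal ideal vanishes has no torsion for powers of it.
-/
lemma eq_zero_of_hom_subsingleton {M : Type u} [AddCommGroup M] [Module R M]
    (hM : Subsingleton (ResidueField R →ₗ[R] M)) {n : ℕ} {h : M}
    (hn : ∀ r ∈ maximalIdeal R ^ n, r • h = 0) : h = 0 := by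
  by_contra hh
  obtain ⟨r, hr, hs⟩ := exists_smul_ne_zero_of_pow_smul_eq_zero _ n hh hn
  apply hr
  have := DFunLike.congr_fun (hM.elim (ofSocle (r • h) hs) 0) (residue R 1)
  rwa [ofSocle_residue, one_smul] at this

lemma subsingleton_hom_of_ext {M : Type u} [AddCommGroup M] [Module R M]
    (h : Subsingleton (Ext (ModuleCat.of R (ResidueField R)) (ModuleCat.of R M) 0)) :
    Subsingleton (ResidueField R →ₗ[R] M) :=
  (extZeroEquiv (R := R) (ResidueField R) M).symm.toEquiv.subsingleton

lemma subsingleton_ext_zero_of_regular {M : Type u} [AddCommGroup M] [Module R M] {x : R}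
    (hx : x ∈ maximalIdeal R) (h : ∀ m : M, x • m = 0 → m = 0) :
    Subsingleton (Ext (ModuleCat.of R (ResidueField R)) (ModuleCat.of R M) 0) := by
  have : Subsingleton (ResidueField R →ₗ[R] M) := by
    refine subsingleton_of_forall_eq 0 fun f => ?_
    ext t
    refine h _ ?_
    rw [← map_smul, residue_smul_eq_zero hx, map_zero]
  exact (extZeroEquiv (R := R) (ResidueField R) M).toEquiv.subsingleton

variable {a b : R}

/-- Holds because (a, b)^(2n) ⊆ (a^n, b^n). -/
lemma span_pair_pow_le {M : Type*} [AddCommGroup M] [Module R M] {n : ℕ} {h : M}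
    (ha : a ^ n • h = 0) (hb : b ^ n • h = 0) :
    ∀ r ∈ Ideal.span {a, b} ^ (n + n), r • h = 0 := by
  intro r hr
  rw [Ideal.span_insert] at hr
  have hr' := Ideal.sup_pow_add_le_pow_sup_pow hr
  rw [Ideal.span_singleton_pow, Ideal.span_singleton_pow, Submodule.mem_sup] at hr'
  obtain ⟨y, hy, z, hz, rfl⟩ := hr'
  obtain ⟨y, rfl⟩ := Ideal.mem_span_singleton'.1 hy
  obtain ⟨z, rfl⟩ := Ideal.mem_span_singleton'.1 hz
  rw [add_smul, mul_smul, mul_smul, ha, hb, smul_zero, smul_zero, add_zero]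

lemma maximalIdeal_pow_smul_eq_zero {j : ℕ} (hj : maximalIdeal R ^ j ≤ Ideal.span {a, b})
    {M : Type*} [AddCommGroup M] [Module R M] {n : ℕ} {h : M}
    (ha : a ^ n • h = 0) (hb : b ^ n • h = 0) :
    ∀ r ∈ maximalIdeal R ^ (j * (n + n)), r • h = 0 := fun r hr =>
  span_pair_pow_le ha hb r (by rw [pow_mul] at hr; exact Ideal.pow_right_mono hj _ hr)

variable {K : Type u} [AddCommGroup K] [Module R K]

/-- `Ext` of a module and of its second Čech quotient. -/
noncomputable def extCechTop (ha : a ∈ maximalIdeal R) (hb : b ∈ maximalIdeal R)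
    (H : CechRegular a b K) (n : ℕ) :
    Ext (ModuleCat.of R (ResidueField R)) (ModuleCat.of R (CechTop a b K)) n ≃ₗ[R]
      Ext (ModuleCat.of R (ResidueField R)) (ModuleCat.of R K) (n + 2) :=
  (extCechQuot (residue_smul_eq_zero hb) H.right n).trans
    (extCechQuot (residue_smul_eq_zero ha) H.left (n + 1))

/-- Depth two makes the parameters a, b regular. Let T be the a-power torsion of K. Since K/T has no
a-torsion, Ext⁰(κ, T) and Ext¹(κ, T) vanish; hence b is injective on T and Hom(κ, T/bT) = 0. But
every element of T/bT is killed by a power of the maximal ideal, so T = bT and T = 0 by Nakayama.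
Then Hom(κ, K_a/K) = Ext¹(κ, K) = 0, and elements of K_a/K killed by b vanish for the same torsion
reason. -/
lemma cechRegular_of_subsingleton_ext [IsNoetherianRing R] [Module.Finite R K]
    (ha : a ∈ maximalIdeal R) (hb : b ∈ maximalIdeal R) {j : ℕ}
    (hj : maximalIdeal R ^ j ≤ Ideal.span {a, b})
    (h0 : Subsingleton (Ext (ModuleCat.of R (ResidueField R)) (ModuleCat.of R K) 0))
    (h1 : Subsingleton (Ext (ModuleCat.of R (ResidueField R)) (ModuleCat.of R K) 1)) :
    CechRegular a b K := by
  have hleft : ∀ k : K, a • k = 0 → k = 0 := by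
    let T : Submodule R K := ⨆ n : ℕ, LinearMap.ker (LinearMap.lsmul R K (a ^ n))
    have hTmem : ∀ k, k ∈ T ↔ ∃ n : ℕ, a ^ n • k = 0 := by
      intro k
      rw [Submodule.mem_iSup_of_directed]
      · rfl
      · refine Monotone.directed_le fun m n hmn k hk => ?_
        exact smul_eq_zero_of_pow_le hmn hk
    have hK0 := subsingleton_hom_of_ext h0
    have hQ0 : Subsingleton
        (Ext (ModuleCat.of R (ResidueField R)) (ModuleCat.of R (K ⧸ T)) 0) := by
      refine subsingleton_ext_zero_of_regular ha fun m hm => ?_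
      obtain ⟨k, rfl⟩ := Submodule.Quotient.mk_surjective _ m
      rw [← Submodule.Quotient.mk_smul, Submodule.Quotient.mk_eq_zero, hTmem] at hm
      obtain ⟨n, hn⟩ := hm
      rw [Submodule.Quotient.mk_eq_zero, hTmem]
      exact ⟨n + 1, by rwa [pow_succ, mul_smul]⟩
    have hT1 : Subsingleton
        (Ext (ModuleCat.of R (ResidueField R)) (ModuleCat.of R T) 1) := by
      refine subsingleton_of_forall_eq 0 fun α => ?_
      have hS := shortExact_mk T.subtype T.mkQ T.injective_subtype
        (LinearMap.exact_subtype_mkQ T) T.mkQ_surjective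
      obtain ⟨β, rfl⟩ := Ext.covariant_sequence_exact₁ _ hS α (h1.elim _ _) (zero_add 1)
      rw [hQ0.elim β 0, Ext.zero_comp]
    have hTb : ∀ t : T, b • t = 0 → t = 0 := by
      rintro ⟨t, ht⟩ htb
      obtain ⟨n, hn⟩ := (hTmem t).1 ht
      refine Subtype.ext (eq_zero_of_hom_subsingleton hK0
        (maximalIdeal_pow_smul_eq_zero hj (n := n + 1) ?_ ?_))
      · exact smul_eq_zero_of_pow_le n.le_succ hn
      · rw [pow_succ, mul_smul]
        have : b • t = 0 := congrArg Subtype.val htb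
        rw [this, smul_zero]
    have hTb0 : Subsingleton (Ext (ModuleCat.of R (ResidueField R)) (ModuleCat.of R
        (T ⧸ LinearMap.range (LinearMap.lsmul R T b))) 0) := by
      refine subsingleton_of_forall_eq 0 fun α => ?_
      have hS := shortExact_mk (LinearMap.lsmul R T b) (Submodule.mkQ _)
        (by rw [injective_iff_map_eq_zero]; exact hTb)
        (LinearMap.exact_map_mkQ_range _) (Submodule.mkQ_surjective _)
      obtain ⟨β, rfl⟩ := Ext.covariant_sequence_exact₃ _ hS α (zero_add 1) (hT1.elim _ _)
      have : Subsingleton (Ext (ModuleCat.of R (ResidueField R)) (ModuleCat.of R T) 0) :=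
        subsingleton_ext_zero_of_regular hb hTb
      rw [this.elim β 0, Ext.zero_comp]
    have hTbot : (⊤ : Submodule R T) ≤ Ideal.span {b} • ⊤ := by
      intro t _
      rw [Submodule.ideal_span_singleton_smul]
      have : (Submodule.Quotient.mk t : T ⧸ LinearMap.range (LinearMap.lsmul R T b)) = 0 := by
        obtain ⟨n, hn⟩ := (hTmem t).1 t.2
        refine eq_zero_of_hom_subsingleton (subsingleton_hom_of_ext hTb0)
          (maximalIdeal_pow_smul_eq_zero hj (n := n + 1) ?_ ?_)
        · refine smul_eq_zero_of_pow_le n.le_succ ?_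
          rw [← Submodule.Quotient.mk_smul]
          have : a ^ n • t = 0 := Subtype.ext hn
          rw [this, Submodule.Quotient.mk_zero]
        · rw [pow_succ', mul_smul, ← Submodule.Quotient.mk_smul, ← Submodule.Quotient.mk_smul,
            Submodule.Quotient.mk_eq_zero]
          exact ⟨_, rfl⟩
      rw [Submodule.Quotient.mk_eq_zero] at this
      obtain ⟨t', rfl⟩ := this
      exact Submodule.smul_mem_pointwise_smul _ _ _ trivial
    have hTtop : (⊤ : Submodule R T) = ⊥ :=
      Submodule.eq_bot_of_le_smul_of_le_jacobson_bot (Ideal.span {b}) ⊤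
        (Module.Finite.fg_top) hTbot (by
          rw [IsLocalRing.jacobson_eq_maximalIdeal _ bot_ne_top, Ideal.span_le,
            Set.singleton_subset_iff]
          exact hb)
    intro k hk
    have hkT : k ∈ T := (hTmem k).2 ⟨1, by simpa using hk⟩
    have : (⟨k, hkT⟩ : T) ∈ (⊤ : Submodule R T) := trivial
    rw [hTtop, Submodule.mem_bot] at this
    exact congrArg Subtype.val this
  refine ⟨hleft, fun q hq => ?_⟩
  have hQ : Subsingleton
      (Ext (ModuleCat.of R (ResidueField R)) (ModuleCat.of R (CechQuot a K)) 0) :=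
    (extCechQuot (residue_smul_eq_zero ha) hleft 0).toEquiv.subsingleton
  obtain ⟨n, hn⟩ := cechQuot_exists_pow_smul q
  refine eq_zero_of_hom_subsingleton (subsingleton_hom_of_ext hQ)
    (maximalIdeal_pow_smul_eq_zero hj (n := n + 1) (smul_eq_zero_of_pow_le n.le_succ hn) ?_)
  rw [pow_succ, mul_smul, hq, smul_zero]

end LocalRing

end Kleinian

namespace Kleinian

open CategoryTheory CategoryTheory.Abelian IsLocalRing

/-! ### Gorenstein rings of dimension two and their canonical modules -/

section Gorenstein

variable {R : Type u} [CommRing R] [IsLocalRing R]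

/-- The ideal `(a ^ n, b ^ n)`. -/
def powIdeal (a b : R) (n : ℕ) : Ideal R := Ideal.span {a ^ n, b ^ n}

lemma mem_powIdeal {a b : R} {n : ℕ} {r : R} :
    r ∈ powIdeal a b n ↔ ∃ y z, r = a ^ n * y + b ^ n * z := by
  rw [powIdeal, Ideal.mem_span_pair]
  constructor
  · rintro ⟨y, z, h⟩
    exact ⟨y, z, by rw [← h]; ring⟩
  · rintro ⟨y, z, h⟩
    exact ⟨y, z, by rw [h]; ring⟩

/-- A regular system of parameters `a, b` of a local ring such that the quotients by
`(a ^ n, b ^ n)` are self-injective, and such that the socle of the quotient by `(a, b)` is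
generated by `δ`. -/
structure IsGorensteinSystem (a b δ : R) : Prop where
  left_mem : a ∈ maximalIdeal R
  right_mem : b ∈ maximalIdeal R
  exists_pow_le : ∃ j, maximalIdeal R ^ j ≤ Ideal.span {a, b}
  regular : CechRegular a b R
  selfInjective : ∀ (n : ℕ) (J : Ideal R) (φ : J →ₗ[R] R ⧸ powIdeal a b n),
    (∀ x : J, (x : R) ∈ powIdeal a b n → φ x = 0) →
      ∃ y : R ⧸ powIdeal a b n, ∀ x : J, φ x = (x : R) • y
  notMem : δ ∉ powIdeal a b 1
  smul_mem : ∀ r ∈ maximalIdeal R, r * δ ∈ powIdeal a b 1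
  socle : ∀ x, (∀ r ∈ maximalIdeal R, r * x ∈ powIdeal a b 1) →
    ∃ s, x - s * δ ∈ powIdeal a b 1

variable {a b δ : R}

lemma topFrac_eq_zero' (H : CechRegular a b R) {n : ℕ} {r : R} :
    topFrac a b R n r = 0 ↔ r ∈ powIdeal a b n := by
  rw [topFrac_eq_zero H, mem_powIdeal]; rfl

variable [IsNoetherianRing R]

/-- A map φ from an ideal J has finitely generated image, hence image killed by some a^n and b^n.
For large c it lands in the copy of R/(a^c, b^c) and vanishes on J ∩ (a^c, b^c), so self-injectivity
of that quotient extends it. -/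
lemma IsGorensteinSystem.baer (G : IsGorensteinSystem a b δ) :
    Module.Baer R (CechTop a b R) := by
  intro J φ
  obtain ⟨n, hn⟩ : ∃ n, ∀ x : J, a ^ n • φ x = 0 ∧ b ^ n • φ x = 0 := by
    obtain ⟨s, hs⟩ := (Module.Finite.fg_top : (⊤ : Submodule R J).FG)
    choose N hN using fun x : J => cechTop_exists_pow_smul (φ x)
    refine ⟨s.sup N, fun x => ?_⟩
    have hx : x ∈ Submodule.span R (s : Set J) := hs ▸ trivial
    induction hx using Submodule.span_induction with
    | mem x hx =>
      exact ⟨smul_eq_zero_of_pow_le (Finset.le_sup hx) (hN x).1,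
        smul_eq_zero_of_pow_le (Finset.le_sup hx) (hN x).2⟩
    | zero => simp
    | add x y _ _ hx hy => simp [hx.1, hx.2, hy.1, hy.2]
    | smul r x _ hx =>
      rw [map_smul, smul_comm, hx.1, smul_comm, hx.2, smul_zero]
      exact ⟨rfl, rfl⟩
  -- Artin–Rees: J ∩ (a, b)^c ⊆ (a, b)^(2n) J for c = t + 2n, and (a, b)^(2n) kills the image of φ.
  obtain ⟨t, ht⟩ := Ideal.exists_pow_inf_eq_pow_smul (Ideal.span {a, b}) (J : Submodule R R)
  set c := t + (n + n) with hc
  have hkill : ∀ x : J, (x : R) ∈ powIdeal a b c → φ x = 0 := by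
    intro x hx
    have hx1 : (x : R) ∈ Ideal.span {a, b} ^ c := by
      obtain ⟨y, z, h⟩ := mem_powIdeal.1 hx
      rw [h]
      exact Ideal.add_mem _
        (Ideal.mul_mem_right _ _ (Ideal.pow_mem_pow (Ideal.subset_span (by simp)) _))
        (Ideal.mul_mem_right _ _ (Ideal.pow_mem_pow (Ideal.subset_span (by simp)) _))
    have hx2 : (x : R) ∈ Ideal.span {a, b} ^ (n + n) • (J : Submodule R R) := by
      have h3 : (x : R) ∈ Ideal.span {a, b} ^ c • (⊤ : Submodule R R) ⊓ J :=
        ⟨by simpa using hx1, x.2⟩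
      rw [ht c (by lia), hc, Nat.add_sub_cancel_left] at h3
      exact Submodule.smul_mono le_rfl inf_le_right h3
    have key : ∀ w ∈ Ideal.span {a, b} ^ (n + n) • (J : Submodule R R),
        ∃ hw : w ∈ J, φ ⟨w, hw⟩ = 0 := by
      intro w hw
      induction hw using Submodule.smul_induction_on' with
      | smul r hr m hm =>
        refine ⟨J.smul_mem r hm, ?_⟩
        have : (⟨r • m, J.smul_mem r hm⟩ : J) = r • ⟨m, hm⟩ := rfl
        rw [this, map_smul]
        exact span_pair_pow_le (hn _).1 (hn _).2 r hr
      | add y _ z _ hy hz =>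
        obtain ⟨hy, hy'⟩ := hy
        obtain ⟨hz, hz'⟩ := hz
        refine ⟨J.add_mem hy hz, ?_⟩
        have : (⟨y + z, J.add_mem hy hz⟩ : J) = ⟨y, hy⟩ + ⟨z, hz⟩ := rfl
        rw [this, map_add, hy', hz', add_zero]
    exact (key x hx2).2
  let ι : R ⧸ powIdeal a b c →ₗ[R] CechTop a b R :=
    Submodule.liftQ _ (topFrac a b R c) fun r hr => (topFrac_eq_zero' G.regular).2 hr
  have hι : ∀ r : R, ι (Submodule.Quotient.mk r) = topFrac a b R c r := fun r => rfl
  have hιinj : Function.Injective ι := by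
    rw [injective_iff_map_eq_zero]
    intro r hr
    obtain ⟨r, rfl⟩ := Submodule.Quotient.mk_surjective _ r
    rw [hι, topFrac_eq_zero' G.regular] at hr
    rwa [Submodule.Quotient.mk_eq_zero]
  have hφ : ∀ x, φ x ∈ LinearMap.range ι := by
    intro x
    obtain ⟨k, hk⟩ := exists_topFrac_of_smul_eq_zero G.regular (n := c)
      (smul_eq_zero_of_pow_le (by lia) (hn x).1) (smul_eq_zero_of_pow_le (by lia) (hn x).2)
    exact ⟨Submodule.Quotient.mk k, hk.symm⟩
  let e := LinearEquiv.ofInjective ι hιinj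
  have he : ∀ x, ι (e.symm x) = x := fun x => congrArg Subtype.val (e.apply_symm_apply x)
  obtain ⟨y, hy⟩ := G.selfInjective c J (e.symm.toLinearMap ∘ₗ φ.codRestrict _ hφ) (by
    intro x hx
    rw [LinearMap.comp_apply, LinearEquiv.coe_coe, LinearEquiv.map_eq_zero_iff]
    exact Subtype.ext (hkill x hx))
  refine ⟨LinearMap.toSpanSingleton R _ (ι y), fun x hx => ?_⟩
  rw [LinearMap.toSpanSingleton_apply, ← map_smul, ← hy ⟨x, hx⟩]
  exact he ⟨φ ⟨x, hx⟩, _⟩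

lemma IsGorensteinSystem.subsingleton_ext (G : IsGorensteinSystem a b δ) (M : Type u)
    [AddCommGroup M] [Module R M] (n : ℕ) :
    Subsingleton (Ext (ModuleCat.of R M) (ModuleCat.of R (CechTop a b R)) (n + 1)) := by
  have h1 : Module.Injective R (CechTop a b R) := G.baer.injective
  have : Injective (ModuleCat.of R (CechTop a b R)) :=
    (Module.injective_iff_injective_object R _).1 h1
  exact subsingleton_of_forall_eq 0 Ext.eq_zero_of_injective

/-- The linear maps out of the residue field into a module whose socle is generated by `h`. -/
lemma nonempty_hom_residueField_equiv {M : Type u} [AddCommGroup M] [Module R M] (h : M)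
    (h0 : h ≠ 0) (hh : ∀ r ∈ maximalIdeal R, r • h = 0)
    (hs : ∀ m : M, (∀ r ∈ maximalIdeal R, r • m = 0) → ∃ s : R, m = s • h) :
    Nonempty ((ResidueField R →ₗ[R] M) ≃ₗ[R] ResidueField R) := by
  let f := LinearMap.toSpanSingleton R (ResidueField R →ₗ[R] M) (ofSocle h hh)
  have hf : Function.Surjective f := by
    intro g
    obtain ⟨s, hs⟩ := hs (g 1) fun r hr => by
      rw [← map_smul, residue_smul_eq_zero hr, map_zero]
    refine ⟨s, ?_⟩
    ext t
    obtain ⟨t, rfl⟩ := residue_surjective t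
    rw [LinearMap.toSpanSingleton_apply, LinearMap.smul_apply, ofSocle_residue,
      residue_eq_smul_one, map_smul, hs, smul_comm]
  have hk : LinearMap.ker f = maximalIdeal R := by
    ext r
    rw [LinearMap.mem_ker, LinearMap.toSpanSingleton_apply]
    constructor
    · intro hr
      by_contra hr'
      rw [mem_maximalIdeal, mem_nonunits_iff, not_not] at hr'
      have := DFunLike.congr_fun hr (residue R 1)
      rw [LinearMap.smul_apply, ofSocle_residue, one_smul, LinearMap.zero_apply] at this
      exact h0 ((IsUnit.smul_eq_zero hr').1 this)
    · intro hr
      ext t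
      rw [LinearMap.smul_apply, ← map_smul, residue_smul_eq_zero hr, map_zero]
      rfl
  exact ⟨((Submodule.quotEquivOfEq _ _ hk).symm.trans (f.quotKerEquivOfSurjective hf)).symm⟩

lemma IsGorensteinSystem.topFrac_ne_zero (G : IsGorensteinSystem a b δ) :
    topFrac a b R 1 δ ≠ 0 := fun h => G.notMem ((topFrac_eq_zero' G.regular).1 h)

lemma IsGorensteinSystem.smul_topFrac (G : IsGorensteinSystem a b δ) :
    ∀ r ∈ maximalIdeal R, r • topFrac a b R 1 δ = 0 := fun r hr => by
  rw [← map_smul, topFrac_eq_zero' G.regular]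
  exact G.smul_mem r hr

lemma IsGorensteinSystem.eq_smul_topFrac (G : IsGorensteinSystem a b δ) (h : CechTop a b R)
    (hh : ∀ r ∈ maximalIdeal R, r • h = 0) : ∃ s : R, h = s • topFrac a b R 1 δ := by
  obtain ⟨k, rfl⟩ := exists_topFrac_of_smul_eq_zero G.regular (n := 1) (h := h)
    (by rw [pow_one]; exact hh _ G.left_mem) (by rw [pow_one]; exact hh _ G.right_mem)
  obtain ⟨s, hs⟩ := G.socle k fun r hr => by
    rw [← topFrac_eq_zero' G.regular, ← smul_eq_mul, map_smul, hh r hr]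
  refine ⟨s, ?_⟩
  rwa [← topFrac_eq_zero' G.regular, map_sub, sub_eq_zero, ← smul_eq_mul, map_smul] at hs

/-- Dimension shifting by two moves the conditions in degrees at least 2 to the top Čech quotient;
degrees 0 and 1 vanish by regularity. -/
lemma isCanonicalModule_iff_of_cechRegular {K : Type u} [AddCommGroup K] [Module R K]
    [Module.Finite R K] (ha : a ∈ maximalIdeal R) (hb : b ∈ maximalIdeal R)
    (H : CechRegular a b K) : IsCanonicalModule R 2 K ↔
      Nonempty ((ResidueField R →ₗ[R] CechTop a b K) ≃ₗ[R] ResidueField R) ∧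
      ∀ n, Subsingleton (Ext (ModuleCat.of R (ResidueField R))
        (ModuleCat.of R (CechTop a b K)) (n + 1)) := by
  have e := extCechTop ha hb H
  have e0 := (extZeroEquiv (ResidueField R) (CechTop a b K)).symm.trans (e 0)
  constructor
  · rintro ⟨_, ⟨f⟩, h⟩
    refine ⟨⟨e0.trans f⟩, fun n => ?_⟩
    have := h (n + 1 + 2) (by lia)
    exact (e (n + 1)).toEquiv.subsingleton
  · rintro ⟨⟨f⟩, h⟩
    refine ⟨inferInstance, ⟨e0.symm.trans f⟩, fun i hi => ?_⟩
    match i with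
    | 0 => exact subsingleton_ext_zero_of_regular ha H.left
    | 1 =>
      have := subsingleton_ext_zero_of_regular hb H.right
      exact (extCechQuot (residue_smul_eq_zero ha) H.left 0).symm.toEquiv.subsingleton
    | 2 => exact absurd rfl hi
    | n + 3 =>
      have := h n
      exact (e (n + 1)).symm.toEquiv.subsingleton

lemma IsGorensteinSystem.isCanonicalModule (G : IsGorensteinSystem a b δ) :
    IsCanonicalModule R 2 R :=
  (isCanonicalModule_iff_of_cechRegular G.left_mem G.right_mem G.regular).2
    ⟨nonempty_hom_residueField_equiv _ G.topFrac_ne_zero G.smul_topFrac G.eq_smul_topFrac,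
      G.subsingleton_ext _⟩

/-- The identification of the two socles extends to a map Ψ because the target is injective. Ψ is
injective since every nonzero element has a nonzero multiple in the socle, where Ψ is known. Its
cokernel has zero socle, because socle elements of the cokernel lift along Ψ's quotient map by
Ext¹(κ, H²(K)) = 0 and the lifts lie in the image of Ψ; torsion then forces the cokernel to vanish.
-/
lemma IsGorensteinSystem.nonempty_cechTop_equiv (G : IsGorensteinSystem a b δ) {K : Type u}
    [AddCommGroup K] [Module R K] (H : CechRegular a b K) (hK : IsCanonicalModule R 2 K) :
    Nonempty (CechTop a b K ≃ₗ[R] CechTop a b R) := by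
  obtain ⟨j, hj⟩ := G.exists_pow_le
  have := hK.1
  obtain ⟨⟨e⟩, hext⟩ := (isCanonicalModule_iff_of_cechRegular G.left_mem G.right_mem H).1 hK
  set f0 := e.symm 1 with hf0
  have hf : ∀ f : ResidueField R →ₗ[R] CechTop a b K, ∃ s : R, f = s • f0 := by
    intro f
    obtain ⟨s, hs⟩ := residue_surjective (e f)
    refine ⟨s, e.injective ?_⟩
    rw [map_smul, hf0, LinearEquiv.apply_symm_apply, ← hs, residue_eq_smul_one]
  have hf0ne : f0 ≠ 0 := by
    rw [hf0, ne_eq, LinearEquiv.map_eq_zero_iff]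
    exact one_ne_zero
  have hinj : Function.Injective f0 := by
    rw [injective_iff_map_eq_zero]
    intro t ht
    by_contra htne
    apply hf0ne
    ext s
    obtain ⟨r, hr⟩ := residue_surjective (s / t)
    have : s = r • t := by
      rw [Algebra.smul_def]
      change s = residue R r * t
      rw [hr, div_mul_cancel₀ _ htne]
    rw [this, map_smul, ht, smul_zero]; rfl
  obtain ⟨Ψ, hΨ⟩ := Module.Baer.extension_property G.baer f0 hinj
    (ofSocle _ G.smul_topFrac)
  have hΨ0 : Ψ (f0 1) = topFrac a b R 1 δ := by
    have := DFunLike.congr_fun hΨ (residue R 1)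
    rwa [ofSocle_residue, one_smul, map_one] at this
  have hΨinj : Function.Injective Ψ := by
    rw [injective_iff_map_eq_zero]
    intro h hh
    by_contra hne
    obtain ⟨n, hna, hnb⟩ := cechTop_exists_pow_smul h
    obtain ⟨r, hr, hs⟩ := exists_smul_ne_zero_of_pow_smul_eq_zero _ _ hne
      (maximalIdeal_pow_smul_eq_zero hj hna hnb)
    obtain ⟨s, hs'⟩ := hf (ofSocle (r • h) hs)
    have h1 : r • h = s • f0 1 := by
      have := DFunLike.congr_fun hs' (residue R 1)
      rwa [ofSocle_residue, one_smul, map_one] at this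
    have h2 : s • topFrac a b R 1 δ = 0 := by
      rw [← hΨ0, ← map_smul, ← h1, map_smul, hh, smul_zero]
    have h3 : s ∈ maximalIdeal R := by
      by_contra hs''
      rw [mem_maximalIdeal, mem_nonunits_iff, not_not] at hs''
      exact G.topFrac_ne_zero ((IsUnit.smul_eq_zero hs'').1 h2)
    apply hr
    rw [h1, ← map_smul, residue_smul_eq_zero h3, map_zero]
  refine ⟨LinearEquiv.ofBijective Ψ ⟨hΨinj, ?_⟩⟩
  have hC : Subsingleton (ResidueField R →ₗ[R] (CechTop a b R ⧸ LinearMap.range Ψ)) := by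
    refine subsingleton_of_forall_eq 0 fun α => ?_
    obtain ⟨β, rfl⟩ := exists_comp_eq_of_subsingleton_ext Ψ (Submodule.mkQ (LinearMap.range Ψ))
      hΨinj (LinearMap.exact_map_mkQ_range _) (Submodule.mkQ_surjective _) (hext 0) α
    ext t
    obtain ⟨s, hs⟩ := G.eq_smul_topFrac (β t) fun r hr => by
      rw [← map_smul, residue_smul_eq_zero hr, map_zero]
    rw [LinearMap.comp_apply, hs, ← hΨ0, ← map_smul, Submodule.mkQ_apply]
    exact (Submodule.Quotient.mk_eq_zero _).2 ⟨_, rfl⟩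
  intro h
  rw [← LinearMap.mem_range, ← Submodule.Quotient.mk_eq_zero]
  obtain ⟨n, hna, hnb⟩ := cechTop_exists_pow_smul h
  refine eq_zero_of_hom_subsingleton hC (maximalIdeal_pow_smul_eq_zero hj (n := n) ?_ ?_)
  · rw [← Submodule.Quotient.mk_smul, hna, Submodule.Quotient.mk_zero]
  · rw [← Submodule.Quotient.mk_smul, hnb, Submodule.Quotient.mk_zero]

/-- A canonical module over a ring with a Gorenstein system of parameters is free of rank one. -/
lemma IsGorensteinSystem.nonempty_equiv_of_isCanonicalModule (G : IsGorensteinSystem a b δ)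
    {K : Type u} [AddCommGroup K] [Module R K] (hK : IsCanonicalModule R 2 K) :
    Nonempty (R ≃ₗ[R] K) := by
  obtain ⟨j, hj⟩ := G.exists_pow_le
  have := hK.1
  have H : CechRegular a b K := cechRegular_of_subsingleton_ext G.left_mem G.right_mem hj
    (hK.2.2 0 (by lia)) (hK.2.2 1 (by lia))
  obtain ⟨Ψ⟩ := G.nonempty_cechTop_equiv H hK
  -- The class of 1/(ab). Its preimage is killed by a and b, so it has the form k0/(ab), and
  -- Nakayama shows that k0 generates K.
  set t := topFrac a b R 1 1 with ht
  obtain ⟨k0, hk0⟩ := exists_topFrac_of_smul_eq_zero H (n := 1) (h := Ψ.symm t)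
    (by rw [← map_smul, ht, pow_smul_topFrac_left, map_zero])
    (by rw [← map_smul, ht, pow_smul_topFrac_right, map_zero])
  have hgen : (⊤ : Submodule R K) ≤ Submodule.span R {k0} ⊔ maximalIdeal R • ⊤ := by
    intro k _
    obtain ⟨r, hr⟩ := exists_topFrac_of_smul_eq_zero G.regular (n := 1)
      (h := Ψ (topFrac a b K 1 k))
      (by rw [← map_smul, pow_smul_topFrac_left, map_zero])
      (by rw [← map_smul, pow_smul_topFrac_right, map_zero])
    have h1 : topFrac a b K 1 (k - r • k0) = 0 := by
      rw [map_sub, map_smul, ← hk0, ← map_smul, ht, ← map_smul, smul_eq_mul, mul_one, ← hr,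
        LinearEquiv.symm_apply_apply, sub_self]
    obtain ⟨y, z, hyz⟩ := (topFrac_eq_zero H).1 h1
    rw [sub_eq_iff_eq_add] at hyz
    rw [hyz, pow_one, pow_one, add_comm]
    exact Submodule.add_mem_sup (Submodule.smul_mem _ _ (Submodule.mem_span_singleton_self _))
      (Submodule.add_mem _ (Submodule.smul_mem_smul G.left_mem trivial)
        (Submodule.smul_mem_smul G.right_mem trivial))
  have hspan : (⊤ : Submodule R K) ≤ Submodule.span R {k0} :=
    Submodule.le_of_le_smul_of_le_jacobson_bot Module.Finite.fg_top
      (maximalIdeal_le_jacobson _) hgen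
  refine ⟨LinearEquiv.ofBijective (LinearMap.toSpanSingleton R K k0) ⟨?_, ?_⟩⟩
  · rw [injective_iff_map_eq_zero]
    intro r hr
    rw [LinearMap.toSpanSingleton_apply] at hr
    have h1 : ∀ k : K, r • k = 0 := by
      intro k
      obtain ⟨s, rfl⟩ := Submodule.mem_span_singleton.1 (hspan (trivial : k ∈ ⊤))
      rw [smul_comm, hr, smul_zero]
    -- An annihilator of K kills H²(K) ≅ H²(R), so it lies in every (a^n, b^n) and is zero by
    -- Krull's intersection theorem.
    have h2 : ∀ n, r ∈ powIdeal a b n := by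
      intro n
      rw [← topFrac_eq_zero' G.regular, ← mul_one r, ← smul_eq_mul, map_smul,
        ← Ψ.symm.map_eq_zero_iff, map_smul]
      obtain ⟨m, k, hm⟩ := exists_topFrac (Ψ.symm (topFrac a b R n 1))
      rw [hm, ← map_smul, h1, map_zero]
    have h3 : r ∈ (⨅ n : ℕ, maximalIdeal R ^ n : Ideal R) := by
      rw [Ideal.mem_iInf]
      intro n
      obtain ⟨y, z, h⟩ := mem_powIdeal.1 (h2 n)
      rw [h]
      exact Ideal.add_mem _ (Ideal.mul_mem_right _ _ (Ideal.pow_mem_pow G.left_mem _))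
        (Ideal.mul_mem_right _ _ (Ideal.pow_mem_pow G.right_mem _))
    rwa [Ideal.iInf_pow_eq_bot_of_isLocalRing _ (Ideal.IsPrime.ne_top inferInstance),
      Ideal.mem_bot] at h3
  · intro k
    exact Submodule.mem_span_singleton.1 (hspan (trivial : k ∈ ⊤))

end Gorenstein

end Kleinian

namespace Kleinian

open CategoryTheory CategoryTheory.Abelian IsLocalRing

/-! ### Extensions of the maximal ideal by the ring -/

section Extensions

variable {R : Type u} [CommRing R]

lemma exists_extension_of_comp_extClass_eq_zero {A B C Y : Type u} [AddCommGroup A]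
    [AddCommGroup B] [AddCommGroup C] [AddCommGroup Y] [Module R A] [Module R B] [Module R C]
    [Module R Y] (f : A →ₗ[R] B) (g : B →ₗ[R] C) (hf : Function.Injective f)
    (hfg : Function.Exact f g) (hg : Function.Surjective g) (α : A →ₗ[R] Y)
    (h : (shortExact_mk f g hf hfg hg).extClass.comp (Ext.mk₀ (ModuleCat.ofHom α))
      (add_zero 1) = 0) :
    ∃ β : B →ₗ[R] Y, β ∘ₗ f = α := by
  obtain ⟨β, hβ⟩ := Ext.contravariant_sequence_exact₁ (shortExact_mk f g hf hfg hg)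
    (ModuleCat.of R Y) (Ext.mk₀ (ModuleCat.ofHom α)) (add_zero 1) h
  obtain ⟨β, rfl⟩ := (Ext.mk₀_bijective _ _).2 β
  rw [Ext.mk₀_comp_mk₀] at hβ
  exact ⟨β.hom, congrArg ModuleCat.Hom.hom ((Ext.mk₀_bijective _ _).1 hβ)⟩

lemma exists_lift_of_comp_extClass_eq_zero {M A B C : Type u} [AddCommGroup M] [Module R M]
    [AddCommGroup A] [AddCommGroup B] [AddCommGroup C] [Module R A] [Module R B] [Module R C]
    (f : A →ₗ[R] B) (g : B →ₗ[R] C) (hf : Function.Injective f) (hfg : Function.Exact f g)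
    (hg : Function.Surjective g) (α : M →ₗ[R] C)
    (h : (Ext.mk₀ (ModuleCat.ofHom α)).comp (shortExact_mk f g hf hfg hg).extClass
      (zero_add 1) = 0) :
    ∃ β : M →ₗ[R] B, g ∘ₗ β = α := by
  obtain ⟨β, hβ⟩ := Ext.covariant_sequence_exact₃ (ModuleCat.of R M) (shortExact_mk f g hf hfg hg)
    (Ext.mk₀ (ModuleCat.ofHom α)) (zero_add 1) h
  obtain ⟨β, rfl⟩ := (Ext.mk₀_bijective _ _).2 β
  rw [Ext.mk₀_comp_mk₀] at hβ
  exact ⟨β.hom, congrArg ModuleCat.Hom.hom ((Ext.mk₀_bijective _ _).1 hβ)⟩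

variable [IsLocalRing R]

lemma exact_subtype_maximalIdeal_residue :
    Function.Exact (maximalIdeal R).subtype (Algebra.linearMap R (ResidueField R)) := by
  intro r
  rw [Algebra.linearMap_apply]
  change residue R r = 0 ↔ _
  rw [residue_eq_zero_iff]
  exact ⟨fun h => ⟨⟨r, h⟩, rfl⟩, fun ⟨s, hs⟩ => hs ▸ s.2⟩

lemma subsingleton_ext_self (Y : ModuleCat.{u} R) (n : ℕ) :
    Subsingleton (Ext (ModuleCat.of R R) Y (n + 1)) := by
  have : Projective (ModuleCat.of R R) := ModuleCat.projective_of_free (Module.Basis.singleton Unit R)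
  exact subsingleton_of_forall_eq 0 Ext.eq_zero_of_projective

/-- The isomorphism of `Ext^1(𝔪, Y)` and `Ext^2(κ, Y)`. -/
noncomputable def extMaximalIdealEquiv (Y : ModuleCat.{u} R) :
    Ext (ModuleCat.of R (maximalIdeal R)) Y 1 ≃ₗ[R]
      Ext (ModuleCat.of R (ResidueField R)) Y 2 :=
  LinearEquiv.ofBijective ((shortExact_mk (maximalIdeal R).subtype
    (Algebra.linearMap R (ResidueField R)) (Submodule.injective_subtype _)
    exact_subtype_maximalIdeal_residue residue_surjective).extClass.precompOfLinear R Y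
      (show 1 + 1 = 2 from rfl)) <| by
    have hS := shortExact_mk (maximalIdeal R).subtype
      (Algebra.linearMap R (ResidueField R)) (Submodule.injective_subtype _)
      exact_subtype_maximalIdeal_residue residue_surjective
    constructor
    · rw [injective_iff_map_eq_zero]
      intro x hx
      obtain ⟨y, rfl⟩ := Ext.contravariant_sequence_exact₁ hS Y x rfl hx
      rw [(subsingleton_ext_self Y 0).elim y 0, Ext.comp_zero]
    · intro x
      exact Ext.contravariant_sequence_exact₃ hS Y x ((subsingleton_ext_self Y 1).elim _ _) rfl

/-- Ext¹(𝔪, R) ≅ Ext²(κ, R) ≅ κ, a one-dimensional space over the residue field. -/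
lemma exists_eq_smul_of_ne_zero (hR : IsCanonicalModule R 2 R)
    {α β : Ext (ModuleCat.of R (maximalIdeal R)) (ModuleCat.of R R) 1} (hβ : β ≠ 0) :
    ∃ r : R, α = r • β := by
  obtain ⟨e⟩ := hR.2.1
  let e' := (extMaximalIdealEquiv (ModuleCat.of R R)).trans e
  have hβ' : e' β ≠ 0 := by rwa [ne_eq, LinearEquiv.map_eq_zero_iff]
  obtain ⟨r, hr⟩ := residue_surjective (e' α / e' β)
  refine ⟨r, e'.injective ?_⟩
  rw [map_smul, Algebra.smul_def]
  change _ = residue R r * _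
  rw [hr, div_mul_cancel₀ _ hβ']

lemma smul_eq_zero_of_mem_maximalIdeal (hR : IsCanonicalModule R 2 R) {r : R}
    (hr : r ∈ maximalIdeal R)
    (α : Ext (ModuleCat.of R (maximalIdeal R)) (ModuleCat.of R R) 1) : r • α = 0 := by
  obtain ⟨e⟩ := hR.2.1
  let e' := (extMaximalIdealEquiv (ModuleCat.of R R)).trans e
  apply e'.injective
  rw [map_smul, residue_smul_eq_zero hr, map_zero]

/-- Among two linear forms on a module `N` with `0 → N → F → 𝔪 → 0`, a nontrivial combination
extends to `F`. -/
lemma exists_combination_extension (hR : IsCanonicalModule R 2 R) {N F : Type u}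
    [AddCommGroup N] [AddCommGroup F] [Module R N] [Module R F] (f : N →ₗ[R] F)
    (g : F →ₗ[R] maximalIdeal R) (hf : Function.Injective f) (hfg : Function.Exact f g)
    (hg : Function.Surjective g) (h₁ h₂ : N →ₗ[R] R) :
    ∃ r₁ r₂ : R, (r₁ ∉ maximalIdeal R ∨ r₂ ∉ maximalIdeal R) ∧
      ∃ β : F →ₗ[R] R, β ∘ₗ f = r₁ • h₁ + r₂ • h₂ := by
  set c := (shortExact_mk f g hf hfg hg).extClass
  -- The pushout of the extension class along a form on N is the obstruction to extending that form
  -- to F. The two obstructions lie in a one-dimensional space, so they are dependent.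
  have key : ∀ r₁ r₂ : R, r₁ • c.comp (Ext.mk₀ (ModuleCat.ofHom h₁)) (add_zero 1) +
      r₂ • c.comp (Ext.mk₀ (ModuleCat.ofHom h₂)) (add_zero 1) = 0 →
      ∃ β : F →ₗ[R] R, β ∘ₗ f = r₁ • h₁ + r₂ • h₂ := by
    intro r₁ r₂ h
    refine exists_extension_of_comp_extClass_eq_zero f g hf hfg hg _ ?_
    rw [← h, ← Ext.comp_smul, ← Ext.comp_smul, ← Ext.mk₀_smul, ← Ext.mk₀_smul, ← Ext.comp_add,
      ← Ext.mk₀_add]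
    rfl
  have h1 : (1 : R) ∉ maximalIdeal R := fun h => (Ideal.ne_top_iff_one _).1 (maximalIdeal.isMaximal R).ne_top h
  by_cases h0 : c.comp (Ext.mk₀ (ModuleCat.ofHom h₂)) (add_zero 1) = 0
  · exact ⟨0, 1, Or.inr h1, key 0 1 (by rw [h0, zero_smul, smul_zero, add_zero])⟩
  · obtain ⟨r, hr⟩ := exists_eq_smul_of_ne_zero hR h0
      (α := c.comp (Ext.mk₀ (ModuleCat.ofHom h₁)) (add_zero 1))
    exact ⟨1, -r, Or.inl h1, key 1 (-r) (by rw [hr, one_smul, neg_smul, add_neg_cancel])⟩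

lemma extClass_ne_zero {A B C : Type u} [AddCommGroup A] [AddCommGroup B] [AddCommGroup C]
    [Module R A] [Module R B] [Module R C] (f : A →ₗ[R] B) (g : B →ₗ[R] C)
    (hf : Function.Injective f) (hfg : Function.Exact f g) (hg : Function.Surjective g)
    (hns : ¬ ∃ s : C →ₗ[R] B, g ∘ₗ s = LinearMap.id) :
    (shortExact_mk f g hf hfg hg).extClass ≠ 0 := by
  intro h
  refine hns (exists_lift_of_comp_extClass_eq_zero f g hf hfg hg LinearMap.id ?_)
  rw [h, Ext.comp_zero]

/-- Over a ring which is its own canonical module, any two non-split extensions of the maximal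
ideal by the ring have isomorphic middle terms. -/
lemma nonempty_equiv_of_nonsplit (hR : IsCanonicalModule R 2 R) {E E' : Type u}
    [AddCommGroup E] [AddCommGroup E'] [Module R E] [Module R E'] (f : R →ₗ[R] E)
    (g : E →ₗ[R] maximalIdeal R) (f' : R →ₗ[R] E') (g' : E' →ₗ[R] maximalIdeal R)
    (hf : Function.Injective f) (hfg : Function.Exact f g) (hg : Function.Surjective g)
    (hns : ¬ ∃ s : maximalIdeal R →ₗ[R] E, g ∘ₗ s = LinearMap.id)
    (hf' : Function.Injective f') (hfg' : Function.Exact f' g') (hg' : Function.Surjective g')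
    (hns' : ¬ ∃ s : maximalIdeal R →ₗ[R] E', g' ∘ₗ s = LinearMap.id) :
    Nonempty (E ≃ₗ[R] E') := by
  have hc := extClass_ne_zero f g hf hfg hg hns
  have hc' := extClass_ne_zero f' g' hf' hfg' hg' hns'
  obtain ⟨r, hr⟩ := exists_eq_smul_of_ne_zero hR hc
    (α := (shortExact_mk f' g' hf' hfg' hg').extClass)
  -- The two classes differ by a unit r. Multiplication by r on the kernels thus extends to a map t
  -- of middle terms, which induces an endomorphism u of the maximal ideal.
  have hrunit : IsUnit r := by
    by_contra h
    exact hc' (hr.trans (smul_eq_zero_of_mem_maximalIdeal hR h _))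
  have hr2 : (shortExact_mk f g hf hfg hg).extClass.comp
      (Ext.mk₀ (ModuleCat.ofHom (r • LinearMap.id : R →ₗ[R] R))) (add_zero 1) =
      (shortExact_mk f' g' hf' hfg' hg').extClass := by
    have : ModuleCat.ofHom (r • LinearMap.id : R →ₗ[R] R) = r • 𝟙 (ModuleCat.of R R) := rfl
    rw [this, Ext.mk₀_smul, Ext.comp_smul, Ext.comp_mk₀_id, hr]
  obtain ⟨t, ht⟩ := exists_extension_of_comp_extClass_eq_zero f g hf hfg hg
    (f' ∘ₗ (r • LinearMap.id : R →ₗ[R] R)) (by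
      have hsplit : Ext.mk₀ (ModuleCat.ofHom (f' ∘ₗ (r • LinearMap.id : R →ₗ[R] R))) =
          (Ext.mk₀ (ModuleCat.ofHom (r • LinearMap.id : R →ₗ[R] R))).comp
            (Ext.mk₀ (ModuleCat.ofHom f')) (add_zero 0) := by
        rw [Ext.mk₀_comp_mk₀, ModuleCat.ofHom_comp]
      rw [hsplit, ← Ext.comp_assoc (a₁₂ := 1) _ _ _ (by lia) (by lia) (by lia), hr2]
      exact (shortExact_mk f' g' hf' hfg' hg').extClass_comp)
  have htf : ∀ x, t (f x) = f' (r * x) := fun x => DFunLike.congr_fun ht x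
  let u : maximalIdeal R →ₗ[R] maximalIdeal R :=
    (Submodule.liftQ (LinearMap.range f) (g' ∘ₗ t) (by
      rintro _ ⟨x, rfl⟩
      rw [LinearMap.mem_ker, LinearMap.comp_apply, htf]
      exact (hfg' _).2 ⟨_, rfl⟩)) ∘ₗ
      (hfg.linearEquivOfSurjective hg).symm.toLinearMap
  have hu : ∀ e, u (g e) = g' (t e) := by
    intro e
    have : (hfg.linearEquivOfSurjective hg).symm (g e) = Submodule.Quotient.mk e := by
      rw [LinearEquiv.symm_apply_eq]; rfl
    simp only [u, LinearMap.comp_apply, LinearEquiv.coe_coe, this]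
    rfl
  have hnat := ShortComplex.ShortExact.extClass_naturality (shortExact_mk f g hf hfg hg)
    (shortExact_mk f' g' hf' hfg' hg')
    { τ₁ := ModuleCat.ofHom (r • LinearMap.id : R →ₗ[R] R)
      τ₂ := ModuleCat.ofHom t
      τ₃ := ModuleCat.ofHom u
      comm₁₂ := by ext; exact (htf _).symm
      comm₂₃ := by ext e; exact congrArg Subtype.val (hu e).symm }
  dsimp only at hnat
  rw [hr2] at hnat
  -- Since Ext¹(κ, R) = 0, the endomorphism u extends to R and is multiplication by v 1. By
  -- naturality it fixes the nonzero second class, so v 1 is a unit. Both outer maps are then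
  -- bijective, and hence so is t.
  obtain ⟨v, hv⟩ := exists_extension_of_comp_extClass_eq_zero (maximalIdeal R).subtype
    (Algebra.linearMap R (ResidueField R)) (Submodule.injective_subtype _)
    exact_subtype_maximalIdeal_residue residue_surjective ((maximalIdeal R).subtype ∘ₗ u)
    ((hR.2.2 1 (by lia)).elim _ _)
  have hus : u = v 1 • LinearMap.id := by
    ext x
    have h1 := DFunLike.congr_fun hv x
    change v (x : R) = (u x : R) at h1
    rw [← h1, ← mul_one (x : R), ← smul_eq_mul, map_smul, smul_eq_mul, mul_comm]
    rfl
  have hunit : IsUnit (v 1) := by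
    by_contra h
    apply hc'
    rw [hnat, hus]
    have : ModuleCat.ofHom (v 1 • LinearMap.id : maximalIdeal R →ₗ[R] maximalIdeal R) =
      v 1 • 𝟙 (ModuleCat.of R (maximalIdeal R)) := rfl
    rw [this, Ext.mk₀_smul, Ext.smul_comp]
    rw [Ext.mk₀_id_comp]
    exact smul_eq_zero_of_mem_maximalIdeal hR h _
  refine ⟨LinearEquiv.ofBijective t ⟨?_, ?_⟩⟩
  · rw [injective_iff_map_eq_zero]
    intro e he
    have h1 := hu e
    rw [he, map_zero, hus] at h1
    have h2 : g e = 0 := (IsUnit.smul_eq_zero hunit).1 h1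
    obtain ⟨x, rfl⟩ := (hfg e).1 h2
    rw [htf, map_eq_zero_iff _ hf', hrunit.mul_right_eq_zero] at he
    rw [he, map_zero]
  · intro e'
    obtain ⟨s, hs⟩ := hunit.exists_left_inv
    obtain ⟨e, he⟩ := hg (s • g' e')
    have h1 : g' (e' - t e) = 0 := by
      rw [map_sub, ← hu, he, hus, LinearMap.smul_apply, LinearMap.id_apply, smul_smul,
        mul_comm, hs, one_smul, sub_self]
    obtain ⟨x, hx⟩ := (hfg' _).1 h1
    obtain ⟨q, hq⟩ := hrunit.exists_right_inv
    refine ⟨e + f (q * x), ?_⟩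
    rw [map_add, htf, ← mul_assoc, hq, one_mul, hx]
    abel

/-- Over a ring with a Gorenstein system of parameters, a fundamental module is isomorphic to the
middle term of any non-split extension of the maximal ideal by the ring. -/
lemma IsGorensteinSystem.nonempty_equiv_of_isFundamentalModule [IsNoetherianRing R] {a b δ : R}
    (G : IsGorensteinSystem a b δ) {E E' : Type u}
    [AddCommGroup E] [AddCommGroup E'] [Module R E] [Module R E'] (f : R →ₗ[R] E)
    (g : E →ₗ[R] maximalIdeal R)
    (hf : Function.Injective f) (hfg : Function.Exact f g) (hg : Function.Surjective g)
    (hns : ¬ ∃ s : maximalIdeal R →ₗ[R] E, g ∘ₗ s = LinearMap.id)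
    (hE' : IsFundamentalModule R E') : Nonempty (E ≃ₗ[R] E') := by
  obtain ⟨-, -, K, _, _, f', g', hK, hf', hfg', hg', hns'⟩ := hE'
  obtain ⟨e⟩ := G.nonempty_equiv_of_isCanonicalModule hK
  refine nonempty_equiv_of_nonsplit G.isCanonicalModule f g (f' ∘ₗ e.toLinearMap) g' hf hfg hg hns
    (hf'.comp e.injective) ?_ hg' hns'
  intro x
  rw [hfg' x]
  constructor
  · rintro ⟨y, rfl⟩
    exact ⟨e.symm y, by simp⟩
  · rintro ⟨y, rfl⟩
    exact ⟨e y, rfl⟩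

end Extensions

end Kleinian

namespace Kleinian

/-! ### Multiplicities of simple modules over a semisimple algebra -/

section Multiplicities

variable (k : Type u) [Field k] (A : Type u) [Ring A] [Algebra k A]

lemma finite_submodule {Y : Type u} [AddCommGroup Y] [Module k Y] [Module A Y]
    [IsScalarTower k A Y] [Module.Finite k Y] (p : Submodule A Y) : Module.Finite k p :=
  inferInstanceAs (Module.Finite k (p.restrictScalars k))

/-- The dimension of the space of linear maps between two modules. -/
noncomputable def homRank (X Y : Type u) [AddCommGroup X] [AddCommGroup Y] [Module k Y]
    [Module A X] [Module A Y] [IsScalarTower k A Y] : ℕ :=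
  Module.finrank k (X →ₗ[A] Y)

section Basic

variable {X X' Y Y' Z : Type u} [AddCommGroup X] [AddCommGroup X'] [AddCommGroup Y]
  [AddCommGroup Y'] [AddCommGroup Z] [Module k X] [Module k X'] [Module k Y] [Module k Y']
  [Module k Z] [Module A X] [Module A X'] [Module A Y] [Module A Y'] [Module A Z]
  [IsScalarTower k A X] [IsScalarTower k A X'] [IsScalarTower k A Y] [IsScalarTower k A Y']
  [IsScalarTower k A Z]

variable {A}

lemma homRank_congr_right (e : Y ≃ₗ[A] Y') : homRank k A X Y = homRank k A X Y' :=
  LinearEquiv.finrank_eq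
    { toFun f := e.toLinearMap ∘ₗ f
      invFun f := e.symm.toLinearMap ∘ₗ f
      map_add' f g := by ext; simp
      map_smul' c f := by
        ext x
        exact (e.toLinearMap.restrictScalars k).map_smul c (f x)
      left_inv f := by ext; simp
      right_inv f := by ext; simp }

lemma homRank_congr_left (e : X ≃ₗ[A] X') : homRank k A X Y = homRank k A X' Y :=
  LinearEquiv.finrank_eq
    { toFun f := f ∘ₗ e.symm.toLinearMap
      invFun f := f ∘ₗ e.toLinearMap
      map_add' f g := by ext; simp
      map_smul' c f := by ext; simp
      left_inv f := by ext; simp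
      right_inv f := by ext; simp }

lemma homRank_prod_right [Module.Finite k X] [Module.Finite k Y] [Module.Finite k Y'] :
    homRank k A X (Y × Y') = homRank k A X Y + homRank k A X Y' := by
  rw [homRank, homRank, homRank, ← Module.finrank_prod]
  exact LinearEquiv.finrank_eq
    { toFun f := (LinearMap.fst A Y Y' ∘ₗ f, LinearMap.snd A Y Y' ∘ₗ f)
      invFun f := f.1.prod f.2
      map_add' f g := rfl
      map_smul' c f := rfl
      left_inv f := rfl
      right_inv f := rfl }

lemma homRank_prod_left [Module.Finite k X] [Module.Finite k X'] [Module.Finite k Y] :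
    homRank k A (X × X') Y = homRank k A X Y + homRank k A X' Y := by
  rw [homRank, homRank, homRank, ← Module.finrank_prod]
  exact LinearEquiv.finrank_eq
    { toFun f := (f ∘ₗ LinearMap.inl A X X', f ∘ₗ LinearMap.inr A X X')
      invFun f := f.1.coprod f.2
      map_add' f g := rfl
      map_smul' c f := rfl
      left_inv f := by ext <;> simp
      right_inv f := by ext <;> simp }

lemma homRank_subsingleton_right [Subsingleton Y] : homRank k A X Y = 0 :=
  Module.finrank_zero_of_subsingleton

lemma homRank_subsingleton_left [Subsingleton X] : homRank k A X Y = 0 := by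
  have : Subsingleton (X →ₗ[A] Y) :=
    ⟨fun f g => LinearMap.ext fun x => by rw [Subsingleton.elim x 0, map_zero, map_zero]⟩
  exact Module.finrank_zero_of_subsingleton

variable [IsSemisimpleRing A]

lemma nonempty_equiv_prod_submodule (p : Submodule A Y) :
    ∃ q : Submodule A Y, Nonempty ((p × q) ≃ₗ[A] Y) := by
  obtain ⟨q, hq⟩ := exists_isCompl p
  exact ⟨q, ⟨Submodule.prodEquivOfIsCompl p q hq⟩⟩

lemma nonempty_equiv_ker_prod (f : Y →ₗ[A] Z) (hf : Function.Surjective f) :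
    Nonempty (Y ≃ₗ[A] (LinearMap.ker f × Z)) := by
  obtain ⟨q, hq⟩ := exists_isCompl (LinearMap.ker f)
  exact ⟨(Submodule.prodEquivOfIsCompl _ q hq).symm.trans
    (LinearEquiv.prodCongr (LinearEquiv.refl A _)
      ((Submodule.quotientEquivOfIsCompl _ q hq).symm.trans
        (f.quotKerEquivOfSurjective hf)))⟩

lemma homRank_eq_ker_add [Module.Finite k X] [Module.Finite k Y] [Module.Finite k Z]
    (f : Y →ₗ[A] Z) (hf : Function.Surjective f) :
    homRank k A X Y = homRank k A X (LinearMap.ker f) + homRank k A X Z := by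
  obtain ⟨e⟩ := nonempty_equiv_ker_prod f hf
  have := finite_submodule k A (LinearMap.ker f)
  rw [homRank_congr_right k e, homRank_prod_right]

lemma homRank_eq_ker_add_range [Module.Finite k X] [Module.Finite k Y] [Module.Finite k Z]
    (f : Y →ₗ[A] Z) :
    homRank k A X Y = homRank k A X (LinearMap.ker f) + homRank k A X (LinearMap.range f) := by
  have := finite_submodule k A (LinearMap.range f)
  have h := homRank_eq_ker_add k (X := X) f.rangeRestrict f.surjective_rangeRestrict
  rwa [LinearMap.ker_rangeRestrict] at h

lemma homRank_eq_add_quotient [Module.Finite k X] [Module.Finite k Y] (p : Submodule A Y) :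
    homRank k A X Y = homRank k A X p + homRank k A X (Y ⧸ p) := by
  have h := homRank_eq_ker_add k (X := X) p.mkQ p.mkQ_surjective
  rwa [Submodule.ker_mkQ] at h

end Basic

variable {A}

/-- Induction over the finite-dimensional modules of a semisimple algebra. -/
theorem semisimple_induction [IsSemisimpleRing A]
    (P : ∀ (Y : Type u) [AddCommGroup Y] [Module k Y] [Module A Y] [IsScalarTower k A Y], Prop)
    (hcongr : ∀ (Y Y' : Type u) [AddCommGroup Y] [Module k Y] [Module A Y] [IsScalarTower k A Y]
      [AddCommGroup Y'] [Module k Y'] [Module A Y'] [IsScalarTower k A Y'],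
      (Y ≃ₗ[A] Y') → P Y → P Y')
    (hzero : ∀ (Y : Type u) [AddCommGroup Y] [Module k Y] [Module A Y] [IsScalarTower k A Y]
      [Subsingleton Y], P Y)
    (hsimple : ∀ (Y : Type u) [AddCommGroup Y] [Module k Y] [Module A Y] [IsScalarTower k A Y]
      [Module.Finite k Y] [IsSimpleModule A Y], P Y)
    (hprod : ∀ (Y Y' : Type u) [AddCommGroup Y] [Module k Y] [Module A Y] [IsScalarTower k A Y]
      [AddCommGroup Y'] [Module k Y'] [Module A Y'] [IsScalarTower k A Y']
      [Module.Finite k Y] [Module.Finite k Y'], P Y → P Y' → P (Y × Y'))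
    (Y : Type u) [AddCommGroup Y] [Module k Y] [Module A Y] [IsScalarTower k A Y]
    [Module.Finite k Y] : P Y := by
  obtain ⟨n, hn⟩ : ∃ n, Module.finrank k Y = n := ⟨_, rfl⟩
  induction n using Nat.strong_induction_on generalizing Y with
  | _ n ih =>
    rcases subsingleton_or_nontrivial Y with h | h
    · exact hzero Y
    · obtain ⟨W, hW⟩ := IsSemisimpleModule.exists_simple_submodule A Y
      obtain ⟨Z, ⟨e⟩⟩ := nonempty_equiv_prod_submodule W
      have := finite_submodule k A W
      have := finite_submodule k A Z
      have := IsSimpleModule.nontrivial A W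
      refine hcongr _ _ e (hprod _ _ (hsimple _) (ih _ ?_ Z rfl))
      have h1 := (e.restrictScalars k).finrank_eq
      rw [Module.finrank_prod] at h1
      have h2 : 0 < Module.finrank k W := Module.finrank_pos
      lia

section Simple

variable [IsAlgClosed k]

lemma homRank_of_simple_equiv {X Y : Type u} [AddCommGroup X] [AddCommGroup Y] [Module k X]
    [Module k Y] [Module A X] [Module A Y] [IsScalarTower k A X] [IsScalarTower k A Y]
    [IsSimpleModule A Y] [Module.Finite k Y] (e : X ≃ₗ[A] Y) : homRank k A X Y = 1 := by
  rw [homRank_congr_left k e, homRank]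
  have h := IsSimpleModule.algebraMap_end_bijective_of_isAlgClosed (A := A) (V := Y) k
  rw [← (LinearEquiv.ofBijective (Algebra.linearMap k (Module.End A Y)) h).finrank_eq,
    Module.finrank_self]

lemma homRank_of_simple_of_isEmpty {X Y : Type u} [AddCommGroup X] [AddCommGroup Y] [Module k X]
    [Module k Y] [Module A X] [Module A Y] [IsScalarTower k A X] [IsScalarTower k A Y]
    [IsSimpleModule A X] [IsSimpleModule A Y] (h : IsEmpty (X ≃ₗ[A] Y)) :
    homRank k A X Y = 0 := by
  have : Subsingleton (X →ₗ[A] Y) := by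
    refine subsingleton_of_forall_eq 0 fun f => ?_
    rcases f.bijective_or_eq_zero with hf | hf
    · exact (h.false (LinearEquiv.ofBijective f hf)).elim
    · exact hf
  exact Module.finrank_zero_of_subsingleton

end Simple

variable (A) in
/-- A choice of simple module for every isotypic component of the regular module. -/
noncomputable def simpleRep (c : isotypicComponents A A) : Submodule A A := c.2.choose

instance isSimpleModule_simpleRep (c : isotypicComponents A A) :
    IsSimpleModule A (simpleRep A c) := c.2.choose_spec.1

lemma isotypicComponent_simpleRep (c : isotypicComponents A A) :
    (c : Submodule A A) = isotypicComponent A A (simpleRep A c) := c.2.choose_spec.2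

lemma simpleRep_injective {c d : isotypicComponents A A}
    (e : simpleRep A c ≃ₗ[A] simpleRep A d) : c = d :=
  Subtype.ext (by rw [isotypicComponent_simpleRep, isotypicComponent_simpleRep,
    e.isotypicComponent_eq])

lemma exists_equiv_simpleRep [IsSemisimpleRing A] (W : Type u) [AddCommGroup W] [Module A W]
    [IsSimpleModule A W] : ∃ c, Nonempty (W ≃ₗ[A] simpleRep A c) := by
  obtain ⟨I, ⟨e⟩⟩ := IsSemisimpleRing.exists_linearEquiv_ideal_of_isSimpleModule A W
  have : IsSimpleModule A I := IsSimpleModule.congr e.symm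
  let c : isotypicComponents A A := ⟨isotypicComponent A A I, I, this, rfl⟩
  refine ⟨c, ?_⟩
  have h := IsIsotypicOfType.isotypicComponent A A I
  rw [isIsotypicOfType_submodule_iff] at h
  obtain ⟨e'⟩ := h (simpleRep A c)
    ((Submodule.le_isotypicComponent _).trans (isotypicComponent_simpleRep c).ge)
  exact ⟨e.trans e'.symm⟩

variable [IsAlgClosed k] [IsSemisimpleRing A] [Module.Finite k A]

variable (A) in
/-- The multiplicity of the simple module of index `c`. -/
noncomputable def mult (c : isotypicComponents A A) (Y : Type u) [AddCommGroup Y] [Module k Y]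
    [Module A Y] [IsScalarTower k A Y] : ℕ := homRank k A (simpleRep A c) Y

noncomputable instance : Fintype (isotypicComponents A A) := Fintype.ofFinite _

instance (c : isotypicComponents A A) : Module.Finite k (simpleRep A c) :=
  finite_submodule k A _

open Classical in
lemma mult_simple {W : Type u} [AddCommGroup W] [Module k W] [Module A W] [IsScalarTower k A W]
    {d : isotypicComponents A A} (e : W ≃ₗ[A] simpleRep A d) (c : isotypicComponents A A) :
    mult k A c W = if c = d then 1 else 0 := by
  rw [mult, homRank_congr_right k e]
  split_ifs with h
  · subst h
    exact homRank_of_simple_equiv k (LinearEquiv.refl A _)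
  · exact homRank_of_simple_of_isEmpty k ⟨fun e' => h (simpleRep_injective e')⟩

lemma homRank_eq_sum (X Y : Type u) [AddCommGroup X] [Module k X] [Module A X]
    [IsScalarTower k A X] [Module.Finite k X] [AddCommGroup Y] [Module k Y] [Module A Y]
    [IsScalarTower k A Y] [Module.Finite k Y] :
    homRank k A X Y = ∑ c, homRank k A X (simpleRep A c) * mult k A c Y := by
  classical
  refine semisimple_induction k (A := A) (P := fun Y => homRank k A X Y =
    ∑ c, homRank k A X (simpleRep A c) * mult k A c Y) ?_ ?_ ?_ ?_ Y
  · intro Y Y' _ _ _ _ _ _ _ _ e h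
    simp only [mult] at h ⊢
    simp only [← homRank_congr_right k e, h]
  · intro Y _ _ _ _ _
    simp [mult, homRank_subsingleton_right]
  · intro Y _ _ _ _ _ _
    obtain ⟨d, ⟨e⟩⟩ := exists_equiv_simpleRep (A := A) Y
    simp [mult_simple k e, homRank_congr_right k e]
  · intro Y Y' _ _ _ _ _ _ _ _ _ _ h h'
    simp only [mult] at h h' ⊢
    simp only [homRank_prod_right, h, h', mul_add, Finset.sum_add_distrib]

/-- Schur's lemma over an algebraically closed field makes dim Hom symmetric on simple modules;
additivity does the rest. -/
lemma homRank_simpleRep_right (X : Type u) [AddCommGroup X] [Module k X] [Module A X]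
    [IsScalarTower k A X] [Module.Finite k X] (c : isotypicComponents A A) :
    homRank k A X (simpleRep A c) = mult k A c X := by
  classical
  refine semisimple_induction k (A := A) (P := fun X => homRank k A X (simpleRep A c) =
    mult k A c X) ?_ ?_ ?_ ?_ X
  · intro Y Y' _ _ _ _ _ _ _ _ e h
    rw [← homRank_congr_left k e, h, mult, homRank_congr_right k e]; rfl
  · intro Y _ _ _ _ _
    rw [homRank_subsingleton_left, mult, homRank_subsingleton_right]
  · intro Y _ _ _ _ _ _
    obtain ⟨d, ⟨e⟩⟩ := exists_equiv_simpleRep (A := A) Y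
    rw [mult_simple k e, homRank_congr_left k e]
    change mult k A d (simpleRep A c) = _
    rw [mult_simple k (LinearEquiv.refl A _)]
    simp only [eq_comm]
  · intro Y Y' _ _ _ _ _ _ _ _ _ _ h h'
    rw [homRank_prod_left, h, h', mult, mult, mult, homRank_prod_right]

lemma homRank_eq_sum_mult (X Y : Type u) [AddCommGroup X] [Module k X] [Module A X]
    [IsScalarTower k A X] [Module.Finite k X] [AddCommGroup Y] [Module k Y] [Module A Y]
    [IsScalarTower k A Y] [Module.Finite k Y] :
    homRank k A X Y = ∑ c, mult k A c X * mult k A c Y := by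
  rw [homRank_eq_sum]
  simp only [homRank_simpleRep_right]

lemma homRank_comm (X Y : Type u) [AddCommGroup X] [Module k X] [Module A X]
    [IsScalarTower k A X] [Module.Finite k X] [AddCommGroup Y] [Module k Y] [Module A Y]
    [IsScalarTower k A Y] [Module.Finite k Y] : homRank k A X Y = homRank k A Y X := by
  rw [homRank_eq_sum_mult, homRank_eq_sum_mult]
  simp only [mul_comm]

lemma finrank_eq_sum_mult (Y : Type u) [AddCommGroup Y] [Module k Y] [Module A Y]
    [IsScalarTower k A Y] [Module.Finite k Y] :
    Module.finrank k Y = ∑ c, mult k A c Y * Module.finrank k (simpleRep A c) := by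
  classical
  refine semisimple_induction k (A := A) (P := fun Y => Module.finrank k Y =
    ∑ c, mult k A c Y * Module.finrank k (simpleRep A c)) ?_ ?_ ?_ ?_ Y
  · intro Y Y' _ _ _ _ _ _ _ _ e h
    simp only [mult] at h ⊢
    rw [← (e.restrictScalars k).finrank_eq, h]
    simp only [homRank_congr_right k e]
  · intro Y _ _ _ _ _
    simp [mult, homRank_subsingleton_right, Module.finrank_zero_of_subsingleton]
  · intro Y _ _ _ _ _ _
    obtain ⟨d, ⟨e⟩⟩ := exists_equiv_simpleRep (A := A) Y
    simp [mult_simple k e, (e.restrictScalars k).finrank_eq]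
  · intro Y Y' _ _ _ _ _ _ _ _ _ _ h h'
    simp only [mult] at h h' ⊢
    simp only [Module.finrank_prod, homRank_prod_right, h, h', add_mul, Finset.sum_add_distrib]

/-- Split off a simple summand W of Y. Equal multiplicities give a nonzero, hence injective, map
from it into Z; cancel both copies and induct on the dimension. -/
lemma nonempty_equiv_of_mult_eq (Y Z : Type u) [AddCommGroup Y] [Module k Y] [Module A Y]
    [IsScalarTower k A Y] [Module.Finite k Y] [AddCommGroup Z] [Module k Z] [Module A Z]
    [IsScalarTower k A Z] [Module.Finite k Z] (h : ∀ c, mult k A c Y = mult k A c Z) :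
    Nonempty (Y ≃ₗ[A] Z) := by
  obtain ⟨n, hn⟩ : ∃ n, Module.finrank k Y = n := ⟨_, rfl⟩
  induction n using Nat.strong_induction_on generalizing Y Z with
  | _ n ih =>
    have hfin : Module.finrank k Y = Module.finrank k Z := by
      rw [finrank_eq_sum_mult k (A := A) Y, finrank_eq_sum_mult k (A := A) Z]
      simp only [h]
    rcases subsingleton_or_nontrivial Y with hY | hY
    · have hZ : Subsingleton Z := by
        rw [← Module.finrank_zero_iff (R := k), ← hfin]
        exact Module.finrank_zero_of_subsingleton
      exact ⟨LinearEquiv.ofSubsingleton Y Z⟩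
    · obtain ⟨W, hW⟩ := IsSemisimpleModule.exists_simple_submodule A Y
      obtain ⟨Y', ⟨e⟩⟩ := nonempty_equiv_prod_submodule W
      have := finite_submodule k A W
      have := finite_submodule k A Y'
      obtain ⟨d, ⟨eW⟩⟩ := exists_equiv_simpleRep (A := A) W
      have hW0 : mult k A d W = 1 := by
        classical
        rw [mult_simple k eW, if_pos rfl]
      have hadd : ∀ c, mult k A c Y = mult k A c W + mult k A c Y' := by
        intro c
        rw [mult, ← homRank_congr_right k e, homRank_prod_right]; rfl
      have hpos : 0 < Module.finrank k (simpleRep A d →ₗ[A] Z) := by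
        have h1 : mult k A d Z = Module.finrank k (simpleRep A d →ₗ[A] Z) := rfl
        rw [← h1, ← h, hadd, hW0]
        lia
      have := Module.nontrivial_of_finrank_pos hpos
      obtain ⟨f, hf⟩ := exists_ne (0 : simpleRep A d →ₗ[A] Z)
      let e1 := LinearEquiv.ofInjective f (LinearMap.injective_of_ne_zero hf)
      obtain ⟨Z', ⟨e'⟩⟩ := nonempty_equiv_prod_submodule (LinearMap.range f)
      have := finite_submodule k A Z'
      have := finite_submodule k A (LinearMap.range f)
      have hadd' : ∀ c, mult k A c Z = mult k A c W + mult k A c Z' := by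
        intro c
        rw [mult, ← homRank_congr_right k e', homRank_prod_right,
          ← homRank_congr_right k (eW.trans e1)]; rfl
      obtain ⟨e2⟩ := ih (Module.finrank k Y') (by
        have h1 := (e.restrictScalars k).finrank_eq
        rw [Module.finrank_prod] at h1
        have := IsSimpleModule.nontrivial A W
        have h2 : 0 < Module.finrank k W := Module.finrank_pos
        lia) Y' Z' (fun c => by
          have h1 := h c
          rw [hadd, hadd'] at h1
          lia) rfl
      exact ⟨e.symm.trans ((LinearEquiv.prodCongr (eW.trans e1) e2).trans e')⟩

end Multiplicities

end Kleinian

namespace Kleinian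

/-! ### A Perron-type inequality -/

/-- Because M d = 2d and M is symmetric, twice the difference 2 ∑ x_i² − ∑ M_ij x_i x_j equals ∑
M_ij d_i d_j (x_i/d_i − x_j/d_j)². In the case of equality every term vanishes, so M_ij x_j = M_ij
d_j (x_i/d_i), and summing over j gives M x = 2x. -/
lemma sum_mul_le_two_mul_sum_sq {ι : Type*} [Fintype ι] (M : ι → ι → ℝ) (d x : ι → ℝ)
    (hM : ∀ i j, 0 ≤ M i j) (hsymm : ∀ i j, M i j = M j i) (hd : ∀ i, 0 < d i)
    (hMd : ∀ i, ∑ j, M i j * d j = 2 * d i) :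
    ∑ i, ∑ j, M i j * x i * x j ≤ 2 * ∑ i, x i ^ 2 ∧
      (∑ i, ∑ j, M i j * x i * x j = 2 * ∑ i, x i ^ 2 → ∀ i, ∑ j, M i j * x j = 2 * x i) := by
  have hterm : ∀ i j, M i j * d i * d j * (x i / d i - x j / d j) ^ 2 =
      (M i j * d j) * (x i ^ 2 / d i) + (M j i * d i) * (x j ^ 2 / d j)
        - 2 * (M i j * x i * x j) := by
    intro i j
    rw [hsymm j i]
    have := (hd i).ne'
    have := (hd j).ne'
    field_simp
    ring
  have h1 : ∑ i, ∑ j, (M i j * d j) * (x i ^ 2 / d i) = 2 * ∑ i, x i ^ 2 := by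
    rw [Finset.mul_sum]
    refine Finset.sum_congr rfl fun i _ => ?_
    rw [← Finset.sum_mul, hMd]
    have := (hd i).ne'
    field_simp
  have hsum : ∑ i, ∑ j, M i j * d i * d j * (x i / d i - x j / d j) ^ 2 =
      2 * (2 * ∑ i, x i ^ 2 - ∑ i, ∑ j, M i j * x i * x j) := by
    simp only [hterm, Finset.sum_sub_distrib, Finset.sum_add_distrib, h1, ← Finset.mul_sum]
    rw [Finset.sum_comm, h1]
    ring
  have hpos : ∀ i j, 0 ≤ M i j * d i * d j * (x i / d i - x j / d j) ^ 2 := fun i j =>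
    mul_nonneg (mul_nonneg (mul_nonneg (hM i j) (hd i).le) (hd j).le) (sq_nonneg _)
  constructor
  · have : 0 ≤ ∑ i, ∑ j, M i j * d i * d j * (x i / d i - x j / d j) ^ 2 :=
      Finset.sum_nonneg fun i _ => Finset.sum_nonneg fun j _ => hpos i j
    linarith
  · intro h i
    rw [h, sub_self, mul_zero] at hsum
    rw [Finset.sum_eq_zero_iff_of_nonneg
      (fun i _ => Finset.sum_nonneg fun j _ => hpos i j)] at hsum
    have h2 := hsum i (Finset.mem_univ i)
    rw [Finset.sum_eq_zero_iff_of_nonneg (fun j _ => hpos i j)] at h2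
    have h3 : ∀ j, M i j * x j = M i j * d j * (x i / d i) := by
      intro j
      have h4 := h2 j (Finset.mem_univ j)
      have := (hd i).ne'
      have := (hd j).ne'
      rcases mul_eq_zero.1 h4 with h5 | h5
      · rcases mul_eq_zero.1 h5 with h6 | h6
        · rcases mul_eq_zero.1 h6 with h7 | h7
          · simp [h7]
          · exact absurd h7 (hd i).ne'
        · exact absurd h6 (hd j).ne'
      · have h6 : x i / d i = x j / d j := by
          rw [← sub_eq_zero]
          exact pow_eq_zero_iff (two_ne_zero) |>.1 h5
        rw [h6]
        field_simp
    simp only [h3]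
    rw [← Finset.sum_mul, hMd]
    have := (hd i).ne'
    field_simp

/-! ### Modules over the group algebra of a subgroup of `SL(2, k)` -/

section GroupModule

variable {k : Type u} [Field k]

section Monoid

variable {Γ : Type u} [Group Γ]

/-- The module over the group algebra defined by a representation. -/
@[reducible]
noncomputable def moduleOfRep {Y : Type u} [AddCommGroup Y] [Module k Y]
    (ρ : Representation k Γ Y) : Module (MonoidAlgebra k Γ) Y :=
  Module.compHom Y ρ.asAlgebraHom.toRingHom

lemma isScalarTower_moduleOfRep {Y : Type u} [AddCommGroup Y] [Module k Y]
    (ρ : Representation k Γ Y) :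
    letI := moduleOfRep ρ
    IsScalarTower k (MonoidAlgebra k Γ) Y := by
  let := moduleOfRep ρ
  refine ⟨fun c a y => ?_⟩
  change ρ.asAlgebraHom (c • a) y = c • ρ.asAlgebraHom a y
  rw [map_smul]; rfl

lemma single_smul_moduleOfRep {Y : Type u} [AddCommGroup Y] [Module k Y]
    (ρ : Representation k Γ Y) (g : Γ) (y : Y) :
    letI := moduleOfRep ρ
    (MonoidAlgebra.single g (1 : k)) • y = ρ g y := by
  let := moduleOfRep ρ
  change ρ.asAlgebraHom (MonoidAlgebra.single g 1) y = _
  rw [Representation.asAlgebraHom_single_one]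

/-- A linear map commuting with the group elements, as a map over the group algebra. -/
noncomputable def ofCommutes {X Y : Type u} [AddCommGroup X] [Module k X] [AddCommGroup Y] [Module k Y]
    [Module (MonoidAlgebra k Γ) X] [Module (MonoidAlgebra k Γ) Y]
    [IsScalarTower k (MonoidAlgebra k Γ) X] [IsScalarTower k (MonoidAlgebra k Γ) Y]
    (f : X →ₗ[k] Y) (hf : ∀ (g : Γ) (x : X),
      f (MonoidAlgebra.single g (1 : k) • x) = MonoidAlgebra.single g (1 : k) • f x) :
    X →ₗ[MonoidAlgebra k Γ] Y :=
  MonoidAlgebra.equivariantOfLinearOfComm f hf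

/-- The trivial one-dimensional module. -/
def TrivMod (k : Type u) (_Γ : Type u) : Type u := k

noncomputable instance : AddCommGroup (TrivMod k Γ) := inferInstanceAs (AddCommGroup k)
noncomputable instance : Module k (TrivMod k Γ) := inferInstanceAs (Module k k)
instance : Module.Finite k (TrivMod k Γ) := inferInstanceAs (Module.Finite k k)
noncomputable instance : Module (MonoidAlgebra k Γ) (TrivMod k Γ) :=
  moduleOfRep (Representation.trivial k Γ (TrivMod k Γ))
instance : IsScalarTower k (MonoidAlgebra k Γ) (TrivMod k Γ) :=
  isScalarTower_moduleOfRep (Representation.trivial k Γ (TrivMod k Γ))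

lemma single_smul_trivMod (g : Γ) (y : TrivMod k Γ) : MonoidAlgebra.single g (1 : k) • y = y :=
  single_smul_moduleOfRep (Representation.trivial k Γ (TrivMod k Γ)) g y

lemma finrank_trivMod : Module.finrank k (TrivMod k Γ) = 1 := Module.finrank_self k

lemma mul_single_one (g h : Γ) :
    MonoidAlgebra.single (g * h) (1 : k) = MonoidAlgebra.single g 1 * MonoidAlgebra.single h 1 := by
  rw [MonoidAlgebra.single_mul_single, one_mul]

end Monoid

variable (G : Subgroup SL(2, k))

section Twist

variable (Y : Type u) [AddCommGroup Y] [Module k Y] [Module (MonoidAlgebra k G) Y]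
  [IsScalarTower k (MonoidAlgebra k G) Y]

lemma smul_single_comm (g : G) (c : k) (y : Y) :
    MonoidAlgebra.single g (1 : k) • c • y = c • MonoidAlgebra.single g (1 : k) • y :=
  smul_comm _ _ _

/-- The diagonal action on `k² ⊗ Y`, where an element of it is a pair of elements of `Y`. -/
noncomputable def twistRep : Representation k G (Fin 2 → Y) where
  toFun g :=
    { toFun y := fun i => ∑ j, (g : SL(2, k)).val i j • MonoidAlgebra.single g (1 : k) • y j
      map_add' y z := by
        ext i
        simp [smul_add, Finset.sum_add_distrib]
      map_smul' c y := by
        ext i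
        simp only [Pi.smul_apply, Finset.smul_sum, RingHom.id_apply]
        refine Finset.sum_congr rfl fun j _ => ?_
        rw [smul_single_comm, smul_comm] }
  map_one' := by
    ext y i
    simp [Matrix.one_apply, MonoidAlgebra.one_def.symm]
  map_mul' g h := by
    refine LinearMap.ext fun y => funext fun i => ?_
    have key : ∀ z : Y, MonoidAlgebra.single (g * h) (1 : k) • z =
        MonoidAlgebra.single g (1 : k) • MonoidAlgebra.single h (1 : k) • z := fun z => by
      rw [mul_single_one, mul_smul]
    simp only [LinearMap.coe_mk, AddHom.coe_mk, Module.End.mul_apply, Subgroup.coe_mul,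
      Matrix.SpecialLinearGroup.coe_mul, Matrix.mul_apply, Fin.sum_univ_two, smul_add, key,
      smul_single_comm]
    generalize MonoidAlgebra.single g (1 : k) • MonoidAlgebra.single h (1 : k) • y 0 = z
    generalize MonoidAlgebra.single g (1 : k) • MonoidAlgebra.single h (1 : k) • y 1 = w
    module

/-- The tensor product of `Y` with the fundamental representation. -/
def Twist (_G : Subgroup SL(2, k)) (Y : Type u) : Type u := Fin 2 → Y

instance : AddCommGroup (Twist G Y) := inferInstanceAs (AddCommGroup (Fin 2 → Y))
instance : Module k (Twist G Y) := inferInstanceAs (Module k (Fin 2 → Y))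
instance [Module.Finite k Y] : Module.Finite k (Twist G Y) :=
  inferInstanceAs (Module.Finite k (Fin 2 → Y))
noncomputable instance : Module (MonoidAlgebra k G) (Twist G Y) :=
  moduleOfRep (Y := Twist G Y) (twistRep G Y)
instance : IsScalarTower k (MonoidAlgebra k G) (Twist G Y) :=
  isScalarTower_moduleOfRep (Y := Twist G Y) (twistRep G Y)

variable {Y}

lemma single_smul_twist (g : G) (y : Twist G Y) (i : Fin 2) :
    (MonoidAlgebra.single g (1 : k) • y) i =
      ∑ j, (g : SL(2, k)).val i j • MonoidAlgebra.single g (1 : k) • y j :=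
  congrFun (single_smul_moduleOfRep (Y := Twist G Y) (twistRep G Y) g y) i

lemma single_smul_twist_two (g : G) (y : Twist G Y) (i : Fin 2) :
    (MonoidAlgebra.single g (1 : k) • y) i =
      (g : SL(2, k)).val i 0 • MonoidAlgebra.single g (1 : k) • y 0 +
      (g : SL(2, k)).val i 1 • MonoidAlgebra.single g (1 : k) • y 1 := by
  rw [single_smul_twist, Fin.sum_univ_two]

lemma det_eq (g : G) : (g : SL(2, k)).val 0 0 * (g : SL(2, k)).val 1 1 -
    (g : SL(2, k)).val 0 1 * (g : SL(2, k)).val 1 0 = 1 := by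
  have := (g : SL(2, k)).2
  rwa [Matrix.det_fin_two] at this

lemma finrank_twist [Module.Finite k Y] :
    Module.finrank k (Twist G Y) = 2 * Module.finrank k Y := by
  change Module.finrank k (Fin 2 → Y) = _
  rw [Module.finrank_pi_fintype]
  simp

variable {X : Type u} [AddCommGroup X] [Module k X] [Module (MonoidAlgebra k G) X]
  [IsScalarTower k (MonoidAlgebra k G) X]

/-- The map on homomorphisms given by the self-duality of the fundamental representation. -/
noncomputable def twistHom : (X →ₗ[MonoidAlgebra k G] Twist G Y) →ₗ[k]
    (Twist G X →ₗ[MonoidAlgebra k G] Y) where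
  toFun f := ofCommutes
    -- Contraction with the determinant pairing on k², which is invariant because det g = 1.
    { toFun x := f (x 0) 1 - f (x 1) 0
      map_add' x y := by
        change f (x 0 + y 0) 1 - f (x 1 + y 1) 0 = _
        rw [map_add, map_add]
        change (f (x 0) 1 + f (y 0) 1) - (f (x 1) 0 + f (y 1) 0) = _
        abel
      map_smul' c x := by
        change f (c • x 0) 1 - f (c • x 1) 0 = c • (f (x 0) 1 - f (x 1) 0)
        rw [LinearMap.map_smul_of_tower, LinearMap.map_smul_of_tower, smul_sub]
        rfl } (by
      intro g x
      change f ((MonoidAlgebra.single g (1 : k) • x) 0) 1 -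
        f ((MonoidAlgebra.single g (1 : k) • x) 1) 0 =
        MonoidAlgebra.single g (1 : k) • (f (x 0) 1 - f (x 1) 0)
      have key : ∀ (c : k) (z : X) (i : Fin 2), f (c • MonoidAlgebra.single g (1 : k) • z) i =
          c • (MonoidAlgebra.single g (1 : k) • f z) i := by
        intro c z i
        rw [LinearMap.map_smul_of_tower, map_smul]; rfl
      have hadd : ∀ (y z : X) (i : Fin 2), f (y + z) i = f y i + f z i := by
        intro y z i
        rw [map_add]; rfl
      rw [single_smul_twist_two, single_smul_twist_two, hadd, hadd]
      simp only [key, single_smul_twist_two]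
      have hdet := det_eq G g
      set p := (g : SL(2, k)).val
      have h2 : ∀ v w : Y, v - w = (p 0 0 * p 1 1 - p 0 1 * p 1 0) • v -
          (p 0 0 * p 1 1 - p 0 1 * p 1 0) • w := by
        intro v w
        rw [hdet, one_smul, one_smul]
      conv_rhs => rw [smul_sub, h2]
      generalize MonoidAlgebra.single g (1 : k) • f (x 0) 0 = z00
      generalize MonoidAlgebra.single g (1 : k) • f (x 0) 1 = z01
      generalize MonoidAlgebra.single g (1 : k) • f (x 1) 0 = z10
      generalize MonoidAlgebra.single g (1 : k) • f (x 1) 1 = z11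
      module)
  map_add' f f' := by
    ext x
    change (f (x 0) + f' (x 0)) 1 - (f (x 1) + f' (x 1)) 0 =
      (f (x 0) 1 - f (x 1) 0) + (f' (x 0) 1 - f' (x 1) 0)
    change (f (x 0) 1 + f' (x 0) 1) - (f (x 1) 0 + f' (x 1) 0) = _
    abel
  map_smul' c f := by
    ext x
    change c • f (x 0) 1 - c • f (x 1) 0 = c • (f (x 0) 1 - f (x 1) 0)
    rw [smul_sub]

lemma twistHom_injective :
    Function.Injective (twistHom G : (X →ₗ[MonoidAlgebra k G] Twist G Y) →ₗ[k] _) := by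
  rw [injective_iff_map_eq_zero]
  intro f hf
  ext x
  refine funext fun i => ?_
  have h0 : ∀ x0 x1 : X, f x0 1 - f x1 0 = 0 := fun x0 x1 =>
    DFunLike.congr_fun hf (![x0, x1] : Fin 2 → X)
  have hz : ∀ i, f 0 i = 0 := fun i => by rw [map_zero]; rfl
  match i with
  | 0 =>
    have := h0 0 x
    rw [hz, zero_sub, neg_eq_zero] at this
    exact this
  | 1 =>
    have := h0 x 0
    rw [hz, sub_zero] at this
    exact this

variable [Finite G] [NeZero (Nat.card G : k)] [Module.Finite k X] [Module.Finite k Y]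

/-- Injectivity of `twistHom` gives one inequality for all pairs of modules. Symmetry of dim Hom
turns it into the reverse one. -/
lemma homRank_twist [IsAlgClosed k] :
    homRank k (MonoidAlgebra k G) X (Twist G Y) = homRank k (MonoidAlgebra k G) (Twist G X) Y := by
  have h1 : ∀ (X Y : Type u) [AddCommGroup X] [Module k X] [Module (MonoidAlgebra k G) X]
      [IsScalarTower k (MonoidAlgebra k G) X] [AddCommGroup Y] [Module k Y]
      [Module (MonoidAlgebra k G) Y] [IsScalarTower k (MonoidAlgebra k G) Y]
      [Module.Finite k X] [Module.Finite k Y],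
      homRank k (MonoidAlgebra k G) X (Twist G Y) ≤
        homRank k (MonoidAlgebra k G) (Twist G X) Y := by
    intro X Y _ _ _ _ _ _ _ _ _ _
    exact LinearMap.finrank_le_finrank_of_injective (twistHom_injective G)
  refine le_antisymm (h1 X Y) ?_
  rw [homRank_comm k (Twist G X) Y, homRank_comm k X (Twist G Y)]
  exact h1 Y X

variable [IsAlgClosed k]

lemma mult_twist (Y : Type u) [AddCommGroup Y] [Module k Y] [Module (MonoidAlgebra k G) Y]
    [IsScalarTower k (MonoidAlgebra k G) Y] [Module.Finite k Y]
    (c : isotypicComponents (MonoidAlgebra k G) (MonoidAlgebra k G)) :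
    mult k (MonoidAlgebra k G) c (Twist G Y) =
      ∑ d, mult k (MonoidAlgebra k G) c (Twist G (simpleRep (MonoidAlgebra k G) d)) *
        mult k (MonoidAlgebra k G) d Y := by
  rw [mult, homRank_twist, homRank_eq_sum_mult]
  refine Finset.sum_congr rfl fun d _ => ?_
  rw [← homRank_simpleRep_right, ← homRank_twist]; rfl

lemma mult_twist_simpleRep_comm
    (c d : isotypicComponents (MonoidAlgebra k G) (MonoidAlgebra k G)) :
    mult k (MonoidAlgebra k G) c (Twist G (simpleRep (MonoidAlgebra k G) d)) =
      mult k (MonoidAlgebra k G) d (Twist G (simpleRep (MonoidAlgebra k G) c)) := by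
  rw [mult, homRank_twist, homRank_simpleRep_right]

/-- `sum_mul_le_two_mul_sum_sq` for the McKay matrix: it is symmetric by self-duality of k², and the
dimension vector has eigenvalue 2 because tensoring with k² doubles dimensions. -/
theorem homRank_twist_le (X : Type u) [AddCommGroup X] [Module k X] [Module (MonoidAlgebra k G) X]
    [IsScalarTower k (MonoidAlgebra k G) X] [Module.Finite k X] :
    homRank k (MonoidAlgebra k G) X (Twist G X) ≤ 2 * homRank k (MonoidAlgebra k G) X X ∧
      (homRank k (MonoidAlgebra k G) X (Twist G X) = 2 * homRank k (MonoidAlgebra k G) X X →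
        ∀ c, mult k (MonoidAlgebra k G) c (Twist G X) = 2 * mult k (MonoidAlgebra k G) c X) := by
  have key := sum_mul_le_two_mul_sum_sq
    (fun c d => (mult k (MonoidAlgebra k G) c
      (Twist G (simpleRep (MonoidAlgebra k G) d)) : ℝ))
    (fun c => (Module.finrank k (simpleRep (MonoidAlgebra k G) c) : ℝ))
    (fun c => (mult k (MonoidAlgebra k G) c X : ℝ))
    (fun c d => Nat.cast_nonneg _)
    (fun c d => by rw [mult_twist_simpleRep_comm])
    (fun c => by
      have := IsSimpleModule.nontrivial (MonoidAlgebra k G) (simpleRep (MonoidAlgebra k G) c)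
      exact_mod_cast Module.finrank_pos)
    (fun c => by
      have h := finrank_twist G (Y := simpleRep (MonoidAlgebra k G) c)
      rw [finrank_eq_sum_mult k (A := MonoidAlgebra k G)] at h
      simp only [mult_twist_simpleRep_comm G _ c] at h
      exact_mod_cast h)
  have h1 : (homRank k (MonoidAlgebra k G) X (Twist G X) : ℝ) =
      ∑ c, ∑ d, (mult k (MonoidAlgebra k G) c
      (Twist G (simpleRep (MonoidAlgebra k G) d)) : ℝ) * (mult k (MonoidAlgebra k G) c X : ℝ) *
        (mult k (MonoidAlgebra k G) d X : ℝ) := by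
    rw [homRank_eq_sum_mult]
    push_cast
    refine Finset.sum_congr rfl fun c _ => ?_
    rw [mult_twist]
    push_cast
    rw [Finset.mul_sum]
    refine Finset.sum_congr rfl fun d _ => ?_
    ring
  have h2 : (homRank k (MonoidAlgebra k G) X X : ℝ) =
      ∑ c, (mult k (MonoidAlgebra k G) c X : ℝ) ^ 2 := by
    rw [homRank_eq_sum_mult]
    push_cast
    simp only [sq]
  rw [← h1, ← h2] at key
  refine ⟨by exact_mod_cast key.1, fun h c => ?_⟩
  have h3 := key.2 (by exact_mod_cast h) c
  rw [mult_twist]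
  exact_mod_cast h3

end Twist

end GroupModule

end Kleinian

namespace Kleinian

/-! ### Fixed vectors and the trivial module -/

section Invariants

variable (k : Type u) [Field k] {Γ : Type u} [Group Γ]

/-- The elements fixed by the group. -/
noncomputable def fixedPart (Γ : Type u) [Group Γ] (Y : Type u) [AddCommGroup Y] [Module k Y]
    [Module (MonoidAlgebra k Γ) Y] [IsScalarTower k (MonoidAlgebra k Γ) Y] : Submodule k Y where
  carrier := {y | ∀ g : Γ, MonoidAlgebra.single g (1 : k) • y = y}
  add_mem' hx hy g := by rw [smul_add, hx g, hy g]
  zero_mem' g := smul_zero _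
  smul_mem' c y hy g := by rw [smul_comm, hy g]

variable (Y : Type u) [AddCommGroup Y] [Module k Y]
  [Module (MonoidAlgebra k Γ) Y] [IsScalarTower k (MonoidAlgebra k Γ) Y]

/-- The map from the trivial module to `Y` given by a fixed element. -/
noncomputable def ofFixed (y : fixedPart k Γ Y) : TrivMod k Γ →ₗ[MonoidAlgebra k Γ] Y :=
  ofCommutes (X := TrivMod k Γ) (show TrivMod k Γ →ₗ[k] Y from (LinearMap.toSpanSingleton k Y (y : Y) : k →ₗ[k] Y)) (fun g x => by
    rw [single_smul_trivMod]
    have h : ∀ c : k, c • (y : Y) = MonoidAlgebra.single g (1 : k) • c • (y : Y) := fun c => by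
      rw [smul_comm, y.2 g]
    exact h x)

lemma homRank_trivMod :
    homRank k (MonoidAlgebra k Γ) (TrivMod k Γ) Y = Module.finrank k (fixedPart k Γ Y) := by
  let o : TrivMod k Γ := (1 : k)
  have ho : ∀ c : k, c • o = c := fun c => mul_one c
  refine LinearEquiv.finrank_eq
    { toFun f := ⟨f o, fun g => by rw [← map_smul, single_smul_trivMod]⟩
      map_add' f g := rfl
      map_smul' c f := rfl
      invFun y := ofFixed k Y y
      left_inv f := ?_
      right_inv y := ?_ }
  · refine LinearMap.ext fun x => ?_
    have h : ∀ c : k, c • f o = f (c • o) := fun c => (LinearMap.map_smul_of_tower f c o).symm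
    exact (h x).trans (congrArg f (ho x))
  · exact Subtype.ext (one_smul k (y : Y))

lemma homRank_trivMod_self :
    homRank k (MonoidAlgebra k Γ) (TrivMod k Γ) (TrivMod k Γ) = 1 := by
  rw [homRank_trivMod]
  have : fixedPart k Γ (TrivMod k Γ) = ⊤ :=
    eq_top_iff.2 fun y _ g => single_smul_trivMod g y
  rw [this, finrank_top, finrank_trivMod]

end Invariants

/-! ### The numerical bound on the number of generators -/

section Main

variable {k : Type u} [Field k] [IsAlgClosed k] (G : Subgroup SL(2, k)) [Finite G]
  [NeZero (Nat.card G : k)]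

/-- A finite-dimensional module `B` and its resolution data bound the number of generators. -/
theorem le_three_of_relation (B U : Type u) [AddCommGroup B] [Module k B]
    [Module (MonoidAlgebra k G) B] [IsScalarTower k (MonoidAlgebra k G) B] [Module.Finite k B]
    [AddCommGroup U] [Module k U] [Module (MonoidAlgebra k G) U]
    [IsScalarTower k (MonoidAlgebra k G) U] [Module.Finite k U] (e : ℕ)
    (hrel : ∀ c, mult k (MonoidAlgebra k G) c (Twist G B) + mult k (MonoidAlgebra k G) c U +
      mult k (MonoidAlgebra k G) c (TrivMod k G) = 2 * mult k (MonoidAlgebra k G) c B +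
        e * mult k (MonoidAlgebra k G) c (TrivMod k G))
    (hB : homRank k (MonoidAlgebra k G) (TrivMod k G) B = 1)
    (hU : homRank k (MonoidAlgebra k G) (TrivMod k G) U = 0)
    (hV : homRank k (MonoidAlgebra k G) (TrivMod k G) (Twist G (TrivMod k G)) = 0)
    (hUB : homRank k (MonoidAlgebra k G) U B ≤ e + 1) :
    e ≤ 3 ∧ (e = 3 → Nonempty (U ≃ₗ[MonoidAlgebra k G] Twist G (TrivMod k G))) := by
  have hpair : ∀ (X : Type u) [AddCommGroup X] [Module k X] [Module (MonoidAlgebra k G) X]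
      [IsScalarTower k (MonoidAlgebra k G) X] [Module.Finite k X],
      homRank k (MonoidAlgebra k G) X (Twist G B) + homRank k (MonoidAlgebra k G) X U +
        homRank k (MonoidAlgebra k G) X (TrivMod k G) = 2 * homRank k (MonoidAlgebra k G) X B +
        e * homRank k (MonoidAlgebra k G) X (TrivMod k G) := by
    intro X _ _ _ _ _
    simp only [homRank_eq_sum_mult, ← Finset.sum_add_distrib, Finset.mul_sum, ← mul_add, hrel]
    refine Finset.sum_congr rfl fun c _ => ?_
    ring
  have h1 := homRank_trivMod_self k (Γ := G)
  have hBB := hpair B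
  have hTB := hpair (TrivMod k G)
  have hB' := homRank_comm k (A := MonoidAlgebra k G) B (TrivMod k G)
  have hBU := homRank_comm k (A := MonoidAlgebra k G) B U
  have hBV := homRank_twist G (X := B) (Y := TrivMod k G)
  rw [homRank_comm k (A := MonoidAlgebra k G) (Twist G B)] at hBV
  -- Put β = dim Hom(B, B) and γ = dim Hom(B, U) ≤ e + 1. Pairing the relation with 1 and with B
  -- gives dim Hom(1, V ⊗ B) = e + 1 and dim Hom(B, V ⊗ B) = 2β + e − 1 − γ. The inequality for B ⊕
  -- 1 becomes 2β + 3e + 1 − γ ≤ 2β + 6, whence 2e ≤ 6.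
  obtain ⟨hle, heq⟩ := homRank_twist_le G (B × TrivMod k G)
  have hmult : ∀ c, mult k (MonoidAlgebra k G) c (Twist G (B × TrivMod k G)) =
      mult k (MonoidAlgebra k G) c (Twist G B) +
        mult k (MonoidAlgebra k G) c (Twist G (TrivMod k G)) := by
    intro c
    rw [mult_twist, mult_twist G B, mult_twist G (TrivMod k G), ← Finset.sum_add_distrib]
    refine Finset.sum_congr rfl fun d _ => ?_
    rw [← mul_add, mult, mult, mult, mult, homRank_prod_right]
  have htw : ∀ (X : Type u) [AddCommGroup X] [Module k X] [Module (MonoidAlgebra k G) X]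
      [IsScalarTower k (MonoidAlgebra k G) X] [Module.Finite k X],
      homRank k (MonoidAlgebra k G) X (Twist G (B × TrivMod k G)) =
        homRank k (MonoidAlgebra k G) X (Twist G B) +
          homRank k (MonoidAlgebra k G) X (Twist G (TrivMod k G)) := by
    intro X _ _ _ _ _
    simp only [homRank_eq_sum_mult, hmult, mul_add, Finset.sum_add_distrib]
  rw [homRank_prod_left, htw, htw, homRank_prod_left, homRank_prod_right, homRank_prod_right]
    at hle heq
  rw [hU, h1, hB] at hTB
  rw [hB', hB, hBU] at hBB
  rw [hB', hB, h1, hV, hBV] at hle heq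
  constructor
  · lia
  · intro he
    subst he
    -- For e = 3 the bound is attained, so V ⊗ B + V = 2B + 2·1. Comparison with V ⊗ B + U + 1 = 2B
    -- + 3·1 leaves U = V.
    have h2 := heq (by lia)
    refine nonempty_equiv_of_mult_eq k _ _ fun c => ?_
    have h3 := h2 c
    rw [hmult] at h3
    have h4 := hrel c
    have h5 : mult k (MonoidAlgebra k G) c (B × TrivMod k G) = mult k (MonoidAlgebra k G) c B +
        mult k (MonoidAlgebra k G) c (TrivMod k G) := by
      rw [mult, homRank_prod_right]; rfl
    rw [h5] at h3
    lia

/-- Taking dimensions in the relation, the terms 2 dim B cancel. -/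
lemma finrank_add_one_of_relation (B U : Type u) [AddCommGroup B] [Module k B]
    [Module (MonoidAlgebra k G) B] [IsScalarTower k (MonoidAlgebra k G) B] [Module.Finite k B]
    [AddCommGroup U] [Module k U] [Module (MonoidAlgebra k G) U]
    [IsScalarTower k (MonoidAlgebra k G) U] [Module.Finite k U] (e : ℕ)
    (hrel : ∀ c, mult k (MonoidAlgebra k G) c (Twist G B) + mult k (MonoidAlgebra k G) c U +
      mult k (MonoidAlgebra k G) c (TrivMod k G) = 2 * mult k (MonoidAlgebra k G) c B +
        e * mult k (MonoidAlgebra k G) c (TrivMod k G)) :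
    Module.finrank k U + 1 = e := by
  have h1 := finrank_eq_sum_mult k (A := MonoidAlgebra k G) (Twist G B)
  have h2 := finrank_eq_sum_mult k (A := MonoidAlgebra k G) B
  have h3 := finrank_eq_sum_mult k (A := MonoidAlgebra k G) U
  have h4 := finrank_eq_sum_mult k (A := MonoidAlgebra k G) (TrivMod k G)
  have h5 : Module.finrank k (Twist G B) + Module.finrank k U + Module.finrank k (TrivMod k G) =
      2 * Module.finrank k B + e * Module.finrank k (TrivMod k G) := by
    rw [h1, h2, h3, h4, ← Finset.sum_add_distrib, ← Finset.sum_add_distrib, Finset.mul_sum,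
      Finset.mul_sum, ← Finset.sum_add_distrib]
    refine Finset.sum_congr rfl fun c _ => ?_
    rw [← add_mul, ← add_mul, hrel]
    ring
  rw [finrank_twist, finrank_trivMod] at h5
  lia

end Main

end Kleinian

namespace Kleinian

/-! ### The power series ring as a module over the group algebra -/

section PowerSeries

variable {k : Type u} [Field k]

/-- The power series ring `k⟦x_0, x_1⟧`. -/
abbrev Pow (k : Type u) [Field k] : Type u := MvPowerSeries (Fin 2) k

lemma linForm_eq (A : Matrix (Fin 2) (Fin 2) k) (j : Fin 2) :
    linForm A j = A 0 j • (MvPowerSeries.X 0 : Pow k) + A 1 j • MvPowerSeries.X 1 := by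
  rw [linForm, Fin.sum_univ_two]

lemma linSubst_X (g : SL(2, k)) (j : Fin 2) :
    linSubst g (MvPowerSeries.X j) = linForm g.val j :=
  MvPowerSeries.substAlgHom_X _ _

lemma linSubst_X_eq (g : SL(2, k)) (j : Fin 2) : linSubst g (MvPowerSeries.X j) =
    g.val 0 j • (MvPowerSeries.X 0 : Pow k) + g.val 1 j • MvPowerSeries.X 1 := by
  rw [linSubst_X, linForm_eq]

lemma linSubst_one (f : Pow k) : linSubst (1 : SL(2, k)) f = f := by
  have h : linForm (1 : SL(2, k)).val = (MvPowerSeries.X : Fin 2 → Pow k) := by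
    ext1 j
    fin_cases j <;> simp [linForm_eq]
  rw [linSubst, MvPowerSeries.substAlgHom_apply, h, MvPowerSeries.subst_self]
  rfl

lemma linSubst_mul (g h : SL(2, k)) (f : Pow k) :
    linSubst (g * h) f = linSubst g (linSubst h f) := by
  rw [linSubst, linSubst, linSubst, MvPowerSeries.substAlgHom_comp_substAlgHom_apply,
    MvPowerSeries.substAlgHom_apply, MvPowerSeries.substAlgHom_apply]
  congr 1
  ext1 j
  change _ = linSubst g (linForm h.val j)
  rw [linForm_eq, linForm_eq, map_add, map_smul, map_smul, linSubst_X_eq, linSubst_X_eq,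
    Matrix.SpecialLinearGroup.coe_mul]
  simp only [Matrix.mul_apply, Fin.sum_univ_two]
  module

lemma constantCoeff_linSubst (g : SL(2, k)) (f : Pow k) :
    MvPowerSeries.constantCoeff (linSubst g f) = MvPowerSeries.constantCoeff f := by
  have h : ∀ f : Pow k, MvPowerSeries.constantCoeff f = 0 →
      MvPowerSeries.constantCoeff (linSubst g f) = 0 := by
    intro f hf
    rw [linSubst, MvPowerSeries.substAlgHom_apply]
    refine MvPowerSeries.constantCoeff_subst_eq_zero (hasSubst_linForm _) (fun j => ?_) hf
    simp [linForm, MvPowerSeries.smul_eq_C_mul]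
  have h1 := h (f - algebraMap k _ (MvPowerSeries.constantCoeff f)) (by
    simp [MvPowerSeries.algebraMap_apply])
  rw [map_sub, AlgHom.commutes, map_sub, sub_eq_zero] at h1
  rw [h1]
  simp [MvPowerSeries.algebraMap_apply]

variable (G : Subgroup SL(2, k))

/-- The representation of `G` on the power series ring. -/
noncomputable def powRep : Representation k G (Pow k) where
  toFun g := (linSubst (g : SL(2, k))).toLinearMap
  map_one' := LinearMap.ext fun f => linSubst_one f
  map_mul' _ _ := LinearMap.ext fun f => linSubst_mul _ _ f

noncomputable instance : Module (MonoidAlgebra k G) (Pow k) := moduleOfRep (powRep G)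

instance : IsScalarTower k (MonoidAlgebra k G) (Pow k) := isScalarTower_moduleOfRep (powRep G)

lemma single_smul_pow (g : G) (f : Pow k) :
    MonoidAlgebra.single g (1 : k) • f = linSubst (g : SL(2, k)) f :=
  single_smul_moduleOfRep (powRep G) g f

lemma single_smul_mul (g : G) (f f' : Pow k) : MonoidAlgebra.single g (1 : k) • (f * f') =
    (MonoidAlgebra.single g (1 : k) • f) * (MonoidAlgebra.single g (1 : k) • f') := by
  simp only [single_smul_pow, map_mul]

lemma constantCoeff_single_smul (g : G) (f : Pow k) :
    MvPowerSeries.constantCoeff (MonoidAlgebra.single g (1 : k) • f) =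
      MvPowerSeries.constantCoeff f := by
  rw [single_smul_pow, constantCoeff_linSubst]

variable {G}

lemma mem_invariantRing {f : Pow k} :
    f ∈ invariantRing G ↔ ∀ g : G, MonoidAlgebra.single g (1 : k) • f = f := by
  simp only [single_smul_pow]
  exact ⟨fun h g => h g g.2, fun h g hg => h ⟨g, hg⟩⟩

lemma single_smul_coe (g : G) (r : invariantRing G) :
    MonoidAlgebra.single g (1 : k) • (r : Pow k) = r :=
  mem_invariantRing.1 r.2 g

lemma smul_coe_mul (x : MonoidAlgebra k G) (r : invariantRing G) (f : Pow k) :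
    x • ((r : Pow k) * f) = (r : Pow k) * x • f := by
  induction x using MonoidAlgebra.induction_linear with
  | zero => simp
  | add x y hx hy => rw [add_smul, hx, hy, add_smul, mul_add]
  | single g c =>
    have h : MonoidAlgebra.single g c = c • MonoidAlgebra.single g (1 : k) := by simp
    rw [h, smul_assoc, single_smul_mul, single_smul_coe, smul_assoc c _ f, mul_smul_comm c]

variable (G)
variable [Finite G]

/-- The averaging element of the group algebra. -/
noncomputable def average : MonoidAlgebra k G :=
  letI := Fintype.ofFinite G
  (Nat.card G : k)⁻¹ • ∑ g : G, MonoidAlgebra.single g (1 : k)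

lemma single_mul_average (g : G) : MonoidAlgebra.single g (1 : k) * average G = average G := by
  let := Fintype.ofFinite G
  rw [average, mul_smul_comm, Finset.mul_sum]
  congr 1
  simp only [← mul_single_one]
  exact Fintype.sum_equiv (Equiv.mulLeft g) _ _ fun _ => rfl

section Modules

variable {G}
variable {Y : Type u} [AddCommGroup Y] [Module k Y] [Module (MonoidAlgebra k G) Y]
  [IsScalarTower k (MonoidAlgebra k G) Y]

lemma single_smul_average_smul (g : G) (y : Y) :
    MonoidAlgebra.single g (1 : k) • average G • y = average G • y := by
  rw [← mul_smul, single_mul_average]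

lemma average_smul_eq [NeZero (Nat.card G : k)] {y : Y}
    (hy : ∀ g : G, MonoidAlgebra.single g (1 : k) • y = y) : average G • y = y := by
  let := Fintype.ofFinite G
  rw [average, smul_assoc, Finset.sum_smul]
  simp only [hy]
  rw [Finset.sum_const, Finset.card_univ, ← Nat.card_eq_fintype_card, ← Nat.cast_smul_eq_nsmul k,
    smul_smul, inv_mul_cancel₀ (NeZero.ne _), one_smul]

end Modules

/-- The Reynolds operator. -/
noncomputable def reynolds : Pow k →ₗ[invariantRing G] invariantRing G where
  toFun f := ⟨average G • f, mem_invariantRing.2 fun g => single_smul_average_smul g f⟩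
  map_add' _ _ := Subtype.ext (smul_add _ _ _)
  map_smul' r f := Subtype.ext (smul_coe_mul _ r f)

lemma coe_reynolds (f : Pow k) : (reynolds G f : Pow k) = average G • f := rfl

lemma reynolds_mul (r : invariantRing G) (f : Pow k) :
    reynolds G ((r : Pow k) * f) = r * reynolds G f := (reynolds G).map_smul r f

variable [NeZero (Nat.card G : k)]

lemma reynolds_coe (r : invariantRing G) : reynolds G (r : Pow k) = r :=
  Subtype.ext (average_smul_eq fun g => single_smul_coe g r)

lemma constantCoeff_reynolds (f : Pow k) :
    MvPowerSeries.constantCoeff (reynolds G f : Pow k) = MvPowerSeries.constantCoeff f := by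
  let := Fintype.ofFinite G
  rw [coe_reynolds, average, smul_assoc, Finset.sum_smul, MvPowerSeries.smul_eq_C_mul, map_mul,
    map_sum]
  simp only [constantCoeff_single_smul]
  rw [MvPowerSeries.constantCoeff_C, Finset.sum_const, Finset.card_univ,
    ← Nat.card_eq_fintype_card, nsmul_eq_mul, ← mul_assoc, inv_mul_cancel₀ (NeZero.ne _), one_mul]

end PowerSeries

/-! ### The ring of invariants -/

section Invariants

variable {k : Type u} [Field k] (G : Subgroup SL(2, k))

noncomputable instance (I : Ideal (invariantRing G)) : Module (invariantRing G) I :=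
  Submodule.module I

lemma isUnit_coe_iff {r : invariantRing G} : IsUnit (r : Pow k) ↔ IsUnit r := by
  have := isLocalHom_subtype_invariantRing G
  exact isUnit_map_iff (invariantRing G).val.toRingHom r

lemma mem_maximalIdeal_iff {r : invariantRing G} :
    r ∈ IsLocalRing.maximalIdeal (invariantRing G) ↔
      MvPowerSeries.constantCoeff (r : Pow k) = 0 := by
  rw [IsLocalRing.mem_maximalIdeal, mem_nonunits_iff, ← isUnit_coe_iff,
    MvPowerSeries.isUnit_iff_constantCoeff, isUnit_iff_ne_zero, not_not]

lemma exists_sub_mem_maximalIdeal (r : invariantRing G) :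
    r - algebraMap k _ (MvPowerSeries.constantCoeff (r : Pow k)) ∈
      IsLocalRing.maximalIdeal (invariantRing G) := by
  rw [mem_maximalIdeal_iff]
  change MvPowerSeries.constantCoeff ((r : Pow k) - algebraMap k (Pow k) _) = 0
  simp [MvPowerSeries.algebraMap_apply]

variable [Finite G] [NeZero (Nat.card G : k)]

/-- Extension of ideals to the power series ring followed by contraction is the identity. -/
lemma comap_map_invariantRing (I : Ideal (invariantRing G)) {r : invariantRing G}
    (hr : (r : Pow k) ∈ I.map (algebraMap (invariantRing G) (Pow k))) : r ∈ I := by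
  -- The free factor t makes the statement stable under multiplication by S, so that it can be
  -- checked on generators of the extended ideal.
  have h : ∀ s ∈ I.map (algebraMap (invariantRing G) (Pow k)), ∀ t : Pow k,
      reynolds G (t * s) ∈ I := by
    intro s hs
    induction hs using Submodule.span_induction with
    | mem s hs =>
      obtain ⟨r, hr, rfl⟩ := hs
      intro t
      rw [mul_comm]
      change reynolds G ((r : Pow k) * t) ∈ I
      rw [reynolds_mul]
      exact I.mul_mem_right _ hr
    | zero => simp
    | add s t _ _ hs ht =>
      intro x
      rw [mul_add, map_add]
      exact I.add_mem (hs x) (ht x)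
    | smul a s _ hs =>
      intro x
      rw [smul_eq_mul, ← mul_assoc]
      exact hs _
  have := h _ hr 1
  rwa [one_mul, reynolds_coe] at this

/-- Extension of ideals to S is injective by `comap_map_invariantRing`, hence strictly monotone, and
the ascending chain condition descends from S. -/
instance isNoetherianRing_invariantRing : IsNoetherianRing (invariantRing G) := by
  rw [isNoetherianRing_iff, isNoetherian_iff']
  have hm : StrictMono (Ideal.map (algebraMap (invariantRing G) (Pow k))) := by
    refine Monotone.strictMono_of_injective (fun I J h => Ideal.map_mono h) fun I J h => ?_
    ext r
    constructor
    · intro hr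
      refine comap_map_invariantRing G J ?_
      rw [← h]
      exact Ideal.mem_map_of_mem (algebraMap (invariantRing G) (Pow k)) hr
    · intro hr
      refine comap_map_invariantRing G I ?_
      rw [h]
      exact Ideal.mem_map_of_mem (algebraMap (invariantRing G) (Pow k)) hr
  exact hm.wellFoundedGT

end Invariants

end Kleinian

namespace Kleinian

/-! ### Parameters of the power series ring -/

section Parameters

variable {k : Type u} [Field k]

local notation "U" => (MvPowerSeries.X 0 : Pow k)
local notation "V" => (MvPowerSeries.X 1 : Pow k)

lemma exists_eq_of_constantCoeff_eq_zero {f : Pow k} (hf : MvPowerSeries.constantCoeff f = 0) :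
    ∃ p q : Pow k, f = U * p + V * q := by
  -- The part of f free of u. Having no constant term it is divisible by v, and f − t is divisible
  -- by u.
  let t : Pow k := fun m => if m 0 = 0 then MvPowerSeries.coeff m f else 0
  have ht : ∀ m, MvPowerSeries.coeff m t = if m 0 = 0 then MvPowerSeries.coeff m f else 0 :=
    fun m => rfl
  have h1 : V ∣ t := by
    rw [MvPowerSeries.X_dvd_iff]
    intro m hm
    rw [ht]
    split_ifs with h
    · have : m = 0 := by
        ext i
        fin_cases i
        · exact h
        · exact hm
      rw [this, MvPowerSeries.coeff_zero_eq_constantCoeff_apply, hf]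
    · rfl
  have h2 : U ∣ f - t := by
    rw [MvPowerSeries.X_dvd_iff]
    intro m hm
    rw [map_sub, ht, if_pos hm, sub_self]
  obtain ⟨q, hq⟩ := h1
  obtain ⟨p, hp⟩ := h2
  exact ⟨p, q, by rw [← hp, ← hq]; ring⟩

lemma X_zero_dvd_of_dvd_mul {f : Pow k} (h : U ∣ V * f) : U ∣ f := by
  rw [MvPowerSeries.X_dvd_iff] at h ⊢
  intro m hm
  have h1 := h (Finsupp.single 1 1 + m) (by simp [hm])
  rw [MvPowerSeries.X, MvPowerSeries.coeff_add_monomial_mul, one_mul] at h1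
  exact h1

lemma X_ne_zero' (i : Fin 2) : (MvPowerSeries.X i : Pow k) ≠ 0 := by
  intro h
  have := congrArg (MvPowerSeries.coeff (Finsupp.single i 1)) h
  simp [MvPowerSeries.coeff_index_single_self_X] at this

lemma koszul {p q : Pow k} (h : U * p + V * q = 0) : ∃ y, p = V * y ∧ q = -(U * y) := by
  have h0 : U ∣ q := X_zero_dvd_of_dvd_mul ⟨-p, by linear_combination h⟩
  obtain ⟨y, rfl⟩ := h0
  refine ⟨-y, ?_, by ring⟩
  refine mul_left_cancel₀ (X_ne_zero' 0) ?_
  linear_combination h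

variable (k) in
/-- The maximal ideal of the power series ring. -/
noncomputable def maxPow : Ideal (Pow k) := Ideal.span {U, V}

lemma mem_maxPow {f : Pow k} : f ∈ maxPow k ↔ ∃ p q, f = U * p + V * q := by
  rw [maxPow, Ideal.mem_span_pair]
  constructor
  · rintro ⟨p, q, h⟩
    exact ⟨p, q, by rw [← h]; ring⟩
  · rintro ⟨p, q, h⟩
    exact ⟨p, q, by rw [h]; ring⟩

lemma mem_maxPow_iff {f : Pow k} : f ∈ maxPow k ↔ MvPowerSeries.constantCoeff f = 0 := by
  constructor
  · intro h
    obtain ⟨p, q, rfl⟩ := mem_maxPow.1 h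
    simp
  · exact fun h => mem_maxPow.2 (exists_eq_of_constantCoeff_eq_zero h)

/-- A system of parameters of the power series ring. -/
structure IsSys (a b : Pow k) : Prop where
  dvd : ∀ x, a ∣ b * x → a ∣ x
  exists_pow_le : ∃ j, maxPow k ^ j ≤ Ideal.span {a, b}

lemma IsSys.mul_right {a b c : Pow k} (h : IsSys a b) (h' : IsSys a c) : IsSys a (b * c) := by
  refine ⟨fun x hx => h'.dvd _ (h.dvd _ (by rwa [← mul_assoc])), ?_⟩
  obtain ⟨i, hi⟩ := h.exists_pow_le
  obtain ⟨j, hj⟩ := h'.exists_pow_le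
  refine ⟨i + j, ?_⟩
  rw [pow_add]
  refine (Ideal.mul_mono hi hj).trans ?_
  rw [Ideal.span_pair_mul_span_pair, Ideal.span_le]
  rintro x (rfl | rfl | rfl | rfl)
  · exact Ideal.mul_mem_left _ _ (Ideal.subset_span (by simp))
  · exact Ideal.mul_mem_right _ _ (Ideal.subset_span (by simp))
  · exact Ideal.mul_mem_left _ _ (Ideal.subset_span (by simp))
  · exact Ideal.subset_span (by simp)

lemma IsSys.mul_left {a b c : Pow k} (hb : b ≠ 0) (h : IsSys a c) (h' : IsSys b c) :
    IsSys (b * a) c := by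
  constructor
  · intro x hx
    obtain ⟨y, rfl⟩ := h'.dvd x (dvd_of_mul_right_dvd hx)
    rw [mul_left_comm] at hx
    exact mul_dvd_mul_left b (h.dvd y (Iff.mp (mul_dvd_mul_iff_left hb) hx))
  · obtain ⟨i, hi⟩ := h.exists_pow_le
    obtain ⟨j, hj⟩ := h'.exists_pow_le
    refine ⟨j + i, ?_⟩
    rw [pow_add]
    refine (Ideal.mul_mono hj hi).trans ?_
    rw [Ideal.span_pair_mul_span_pair, Ideal.span_le]
    rintro x (rfl | rfl | rfl | rfl)
    · exact Ideal.subset_span (by simp)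
    · exact Ideal.mul_mem_left _ _ (Ideal.subset_span (by simp))
    · exact Ideal.mul_mem_right _ _ (Ideal.subset_span (by simp))
    · exact Ideal.mul_mem_left _ _ (Ideal.subset_span (by simp))

lemma IsSys.one_right (a : Pow k) : IsSys a 1 :=
  ⟨fun x hx => by rwa [one_mul] at hx, 0, by
    rw [(Ideal.eq_top_iff_one _).2 (Ideal.subset_span (by simp) : (1 : Pow k) ∈ Ideal.span {a, 1})]
    exact le_top⟩

lemma IsSys.one_left (b : Pow k) : IsSys 1 b :=
  ⟨fun x _ => one_dvd x, 0, by
    rw [(Ideal.eq_top_iff_one _).2 (Ideal.subset_span (by simp) : (1 : Pow k) ∈ Ideal.span {1, b})]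
    exact le_top⟩

lemma IsSys.pow {a b : Pow k} (ha : a ≠ 0) (h : IsSys a b) (m n : ℕ) : IsSys (a ^ m) (b ^ n) := by
  have h1 : IsSys a (b ^ n) := by
    induction n with
    | zero => rw [pow_zero]; exact IsSys.one_right a
    | succ n ih => rw [pow_succ]; exact ih.mul_right h
  induction m with
  | zero => rw [pow_zero]; exact IsSys.one_left _
  | succ m ih => rw [pow_succ']; exact ih.mul_left ha h1

lemma IsSys.prod {ι : Type*} (s t : Finset ι) (a b : ι → Pow k) (ha : ∀ i, a i ≠ 0)
    (h : ∀ i j, IsSys (a i) (b j)) : IsSys (∏ i ∈ s, a i) (∏ j ∈ t, b j) := by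
  classical
  have h1 : ∀ i, IsSys (a i) (∏ j ∈ t, b j) := by
    intro i
    induction t using Finset.induction_on with
    | empty => rw [Finset.prod_empty]; exact IsSys.one_right _
    | insert j t hj ih => rw [Finset.prod_insert hj]; exact (h i j).mul_right ih
  induction s using Finset.induction_on with
  | empty => rw [Finset.prod_empty]; exact IsSys.one_left _
  | insert i s hi ih => rw [Finset.prod_insert hi]; exact ih.mul_left (ha i) (h1 i)

/-- Cramer's rule expresses u and v through the two forms; their syzygies then come from `koszul`.
-/
lemma isSys_linear {a b c d : k} (h : a * d - b * c ≠ 0) :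
    IsSys (a • U + b • V) (c • U + d • V) := by
  set l := a • U + b • V with hl
  set l' := c • U + d • V with hl'
  have hu : (a * d - b * c) • U = d • l - b • l' := by rw [hl, hl']; module
  have hv : (a * d - b * c) • V = a • l' - c • l := by rw [hl, hl']; module
  constructor
  · rintro y ⟨z, hz⟩
    have h1 : U * (a • z - c • y) + V * (b • z - d • y) = 0 := by
      have : U * (a • z - c • y) + V * (b • z - d • y) = l * z - l' * y := by
        rw [hl, hl']
        simp only [mul_sub, add_mul, mul_smul_comm, smul_mul_assoc]
        abel
      rw [this, hz, sub_self]
    obtain ⟨w, hw1, hw2⟩ := koszul h1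
    have h2 : (a * d - b * c) • y = l * w := by
      have h3 : (a * d - b * c) • y = b • (a • z - c • y) - a • (b • z - d • y) := by module
      rw [h3, hw1, hw2, hl]
      simp only [add_mul, smul_mul_assoc, smul_neg]
      abel
    refine ⟨(a * d - b * c)⁻¹ • w, ?_⟩
    rw [mul_smul_comm, ← h2, smul_smul, inv_mul_cancel₀ h, one_smul]
  · refine ⟨1, ?_⟩
    have hsm : ∀ (I : Ideal (Pow k)) (c : k) {x : Pow k}, x ∈ I → c • x ∈ I := fun I c x hx => by
      rw [← algebraMap_smul (Pow k) c x]
      exact I.smul_mem _ hx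
    rw [pow_one, maxPow, Ideal.span_le]
    have hmem : ∀ x y : k, x • l + y • l' ∈ Ideal.span {l, l'} := fun x y =>
      Ideal.add_mem _ (hsm _ _ (Ideal.subset_span (by simp)))
        (hsm _ _ (Ideal.subset_span (by simp)))
    have hc : ∀ x : Pow k, (a * d - b * c)⁻¹ • (a * d - b * c) • x = x := fun x => by
      rw [smul_smul, inv_mul_cancel₀ h, one_smul]
    rintro x (rfl | rfl)
    · rw [← hc U, hu]
      refine hsm _ _ ?_
      have := hmem d (-b)
      rwa [neg_smul, ← sub_eq_add_neg] at this
    · rw [← hc V, hv]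
      refine hsm _ _ ?_
      have := hmem (-c) a
      rwa [neg_smul, add_comm, ← sub_eq_add_neg] at this

/-- The socle of the quotient by a system of parameters. -/
lemma IsSys.exists_sub_mem {a b a₁ a₂ b₁ b₂ s : Pow k} (h : IsSys a b) (ha : a ≠ 0)
    (ea : a = U * a₁ + V * a₂) (eb : b = U * b₁ + V * b₂)
    (hs : ∀ f ∈ maxPow k, f * s ∈ Ideal.span {a, b}) :
    ∃ t, s - t * (a₁ * b₂ - a₂ * b₁) ∈ Ideal.span {a, b} := by
  -- Write us = xa + yb and vs = za + wb. Eliminating s gives a(vx − uz) = b(uw − vy), so regularity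
  -- of a, b produces t with uw − vy = at and vx − uz = bt. Substituting the expansions of a and b
  -- and applying `koszul` twice shows that t is the wanted coefficient of the determinant.
  obtain ⟨x, y, h1⟩ := Ideal.mem_span_pair.1 (hs U (Ideal.subset_span (by simp)))
  obtain ⟨z, w, h2⟩ := Ideal.mem_span_pair.1 (hs V (Ideal.subset_span (by simp)))
  obtain ⟨t, ht⟩ := h.dvd (U * w - V * y) ⟨V * x - U * z, by
    linear_combination U * h2 - V * h1⟩
  have ht' : V * x - U * z = b * t := by
    refine mul_left_cancel₀ ha ?_
    linear_combination b * ht + V * h1 - U * h2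
  obtain ⟨p, hp1, hp2⟩ := koszul (p := w - a₁ * t) (q := -(y + a₂ * t)) (by
    linear_combination ht + t * ea)
  obtain ⟨q, hq1, hq2⟩ := koszul (p := -(z + b₁ * t)) (q := x - b₂ * t) (by
    linear_combination ht' + t * eb)
  have hs' : s - t * (a₁ * b₂ - a₂ * b₁) = -q * a + p * b := by
    refine mul_left_cancel₀ (X_ne_zero' 0) ?_
    linear_combination -h1 + a * hq2 - b * hp2 + t * b₂ * ea - t * a₂ * eb
  exact ⟨t, hs' ▸ Ideal.mem_span_pair.2 ⟨_, _, rfl⟩⟩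

lemma mul_det_mem {a b a₁ a₂ b₁ b₂ f : Pow k}
    (ea : a = U * a₁ + V * a₂) (eb : b = U * b₁ + V * b₂)
    (hf : f ∈ maxPow k) : f * (a₁ * b₂ - a₂ * b₁) ∈ Ideal.span {a, b} := by
  obtain ⟨p, q, rfl⟩ := mem_maxPow.1 hf
  refine Ideal.mem_span_pair.2 ⟨p * b₂ - q * b₁, q * a₁ - p * a₂, ?_⟩
  rw [ea, eb]
  ring

/-- Every element outside of an ideal containing a power of the maximal ideal has a multiple that
represents a nonzero element of the socle. -/
lemma exists_mul_socle {I : Ideal (Pow k)} {j : ℕ} (hj : maxPow k ^ j ≤ I) {y : Pow k}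
    (hy : y ∉ I) : ∃ s, s * y ∉ I ∧ ∀ f ∈ maxPow k, f * (s * y) ∈ I := by
  have h : ∃ i, ∀ f ∈ maxPow k ^ i, f * y ∈ I :=
    ⟨j, fun f hf => I.mul_mem_right _ (hj hf)⟩
  classical
  have h0 : Nat.find h ≠ 0 := by
    intro h1
    have := Nat.find_spec h
    rw [h1] at this
    exact hy (by simpa using this 1 (by simp))
  obtain ⟨i, hi⟩ := Nat.exists_eq_succ_of_ne_zero h0
  have h2 := Nat.find_min h (m := i) (by lia)
  push Not at h2
  obtain ⟨s, hs, hsy⟩ := h2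
  refine ⟨s, hsy, fun f hf => ?_⟩
  rw [← mul_assoc]
  refine Nat.find_spec h _ ?_
  rw [hi, pow_succ']
  exact Ideal.mul_mem_mul hf hs

/-- Otherwise `IsSys.exists_sub_mem` would make the socle of S/(a, b) zero, whereas this ring is
nonzero and killed by a power of the maximal ideal. -/
lemma IsSys.det_notMem {a b a₁ a₂ b₁ b₂ : Pow k} (h : IsSys a b) (ha : a ≠ 0)
    (ea : a = U * a₁ + V * a₂) (eb : b = U * b₁ + V * b₂) :
    a₁ * b₂ - a₂ * b₁ ∉ Ideal.span {a, b} := by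
  intro hd
  have h1 : Ideal.span {a, b} ≤ maxPow k := by
    rw [Ideal.span_le]
    rintro x (rfl | rfl)
    · exact mem_maxPow.2 ⟨_, _, ea⟩
    · exact mem_maxPow.2 ⟨_, _, eb⟩
  have h2 : (1 : Pow k) ∉ Ideal.span {a, b} := fun h3 => by
    have := mem_maxPow_iff.1 (h1 h3)
    simp at this
  obtain ⟨j, hj⟩ := h.exists_pow_le
  obtain ⟨s, hs, hs'⟩ := exists_mul_socle hj h2
  obtain ⟨t, ht⟩ := h.exists_sub_mem ha ea eb hs'
  refine hs ?_
  have := Ideal.add_mem _ ht (Ideal.mul_mem_left _ t hd)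
  simpa using this

lemma exists_finite_sup_eq_top (j : ℕ) : ∃ F : Submodule k (Pow k), Module.Finite k F ∧
    F ⊔ (maxPow k ^ j).restrictScalars k = ⊤ := by
  induction j with
  | zero => exact ⟨⊥, inferInstance, by simp⟩
  | succ j ih =>
    obtain ⟨F, hF, h⟩ := ih
    refine ⟨k ∙ (1 : Pow k) ⊔ F.map (LinearMap.mulLeft k U) ⊔ F.map (LinearMap.mulLeft k V),
      inferInstance, eq_top_iff.2 fun f _ => ?_⟩
    obtain ⟨p, q, hpq⟩ := exists_eq_of_constantCoeff_eq_zero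
      (f := f - algebraMap k _ (MvPowerSeries.constantCoeff f)) (by
        simp [MvPowerSeries.algebraMap_apply])
    have hp : p ∈ F ⊔ (maxPow k ^ j).restrictScalars k := h ▸ trivial
    have hq : q ∈ F ⊔ (maxPow k ^ j).restrictScalars k := h ▸ trivial
    obtain ⟨p₁, hp₁, p₂, hp₂, rfl⟩ := Submodule.mem_sup.1 hp
    obtain ⟨q₁, hq₁, q₂, hq₂, rfl⟩ := Submodule.mem_sup.1 hq
    refine Submodule.mem_sup.2 ⟨MvPowerSeries.constantCoeff f • 1 + U * p₁ + V * q₁, ?_,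
      U * p₂ + V * q₂, ?_, ?_⟩
    · refine Submodule.add_mem_sup (Submodule.add_mem_sup ?_ ⟨p₁, hp₁, rfl⟩) ⟨q₁, hq₁, rfl⟩
      exact Submodule.smul_mem _ _ (Submodule.mem_span_singleton_self _)
    · rw [Submodule.restrictScalars_mem, pow_succ']
      exact Ideal.add_mem _ (Ideal.mul_mem_mul (Ideal.subset_span (by simp)) hp₂)
        (Ideal.mul_mem_mul (Ideal.subset_span (by simp)) hq₂)
    · rw [← Algebra.algebraMap_eq_smul_one]
      linear_combination -hpq

lemma finite_quotient_of_pow_le {p : Submodule k (Pow k)} {j : ℕ}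
    (hj : (maxPow k ^ j).restrictScalars k ≤ p) : Module.Finite k (Pow k ⧸ p) := by
  obtain ⟨F, hF, h⟩ := exists_finite_sup_eq_top (k := k) j
  refine Module.Finite.of_surjective (p.mkQ ∘ₗ F.subtype) fun q => ?_
  obtain ⟨f, rfl⟩ := p.mkQ_surjective q
  have hf : f ∈ F ⊔ (maxPow k ^ j).restrictScalars k := h ▸ trivial
  obtain ⟨x, hx, y, hy, rfl⟩ := Submodule.mem_sup.1 hf
  refine ⟨⟨x, hx⟩, ?_⟩
  have h0 : p.mkQ y = 0 := (Submodule.Quotient.mk_eq_zero p).2 (hj hy)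
  rw [map_add, h0, add_zero]
  rfl

end Parameters

end Kleinian

namespace Kleinian

open IsLocalRing

/-! ### Self-injectivity from a nondegenerate functional -/

section Functional

variable {k : Type u} [Field k] {R : Type u} [CommRing R] [Algebra k R]

/-- The pairing (x, y) ↦ l(xy) identifies R/I with its k-dual. The functional l ∘ φ factors through
the image of J in R/I, so it extends to R/I over k and equals x ↦ l(xy) for some y. Nondegeneracy
upgrades this to φ(x) = x y. -/
lemma exists_eq_smul_of_nondegenerate (I : Ideal R) [Module.Finite k (R ⧸ I)]
    (l : R ⧸ I →ₗ[k] k) (hl : ∀ x : R, (∀ r : R, l (Submodule.Quotient.mk (r * x)) = 0) → x ∈ I)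
    (J : Ideal R) (φ : J →ₗ[R] R ⧸ I) (hφ : ∀ x : J, (x : R) ∈ I → φ x = 0) :
    ∃ y : R ⧸ I, ∀ x : J, φ x = (x : R) • y := by
  let f : J →ₗ[k] R ⧸ I := (Submodule.mkQ I ∘ₗ J.subtype).restrictScalars k
  let h : J →ₗ[k] k := l ∘ₗ φ.restrictScalars k
  obtain ⟨ψ, hψ⟩ : h ∈ LinearMap.range f.dualMap := by
    rw [LinearMap.range_dualMap_eq_dualAnnihilator_ker, Submodule.mem_dualAnnihilator]
    intro x hx
    have hx' : (x : R) ∈ I := (Submodule.Quotient.mk_eq_zero I).1 hx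
    change l (φ x) = 0
    rw [hφ x hx', map_zero]
  let pair : R ⧸ I →ₗ[k] Module.Dual k (R ⧸ I) := (LinearMap.mul k (R ⧸ I)).compr₂ l
  have hinj : Function.Injective pair := by
    rw [injective_iff_map_eq_zero]
    intro y hy
    obtain ⟨y, rfl⟩ := Submodule.Quotient.mk_surjective _ y
    rw [Submodule.Quotient.mk_eq_zero]
    refine hl y fun r => ?_
    have := DFunLike.congr_fun hy (Submodule.Quotient.mk r)
    change l (Ideal.Quotient.mk I y * Ideal.Quotient.mk I r) = 0 at this
    rw [mul_comm] at this
    exact this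
  have hsurj := (LinearMap.injective_iff_surjective_of_finrank_eq_finrank
    (Subspace.dual_finrank_eq (K := k) (V := R ⧸ I)).symm).1 hinj
  obtain ⟨y, hy⟩ := hsurj ψ
  refine ⟨y, fun x => ?_⟩
  rw [← sub_eq_zero]
  obtain ⟨z, hz⟩ := Submodule.Quotient.mk_surjective _ (φ x - (x : R) • y)
  rw [← hz, Submodule.Quotient.mk_eq_zero]
  refine hl _ fun r => ?_
  rw [← smul_eq_mul, Submodule.Quotient.mk_smul, hz]
  have h1 : l (φ (r • x)) = ψ (Submodule.Quotient.mk (r * (x : R))) :=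
    (DFunLike.congr_fun hψ (r • x)).symm
  have h2 : ψ (Submodule.Quotient.mk (r * (x : R))) = l ((r * (x : R)) • y) := by
    rw [← hy]
    change l (y * Ideal.Quotient.mk I _) = _
    rw [mul_comm]
    rfl
  rw [smul_sub, map_sub, ← map_smul, h1, h2, smul_smul, sub_self]

end Functional

/-! ### Invariant parameters and the Gorenstein property of the ring of invariants -/

section System

variable {k : Type u} [Field k] (G : Subgroup SL(2, k))

local notation "U" => (MvPowerSeries.X 0 : Pow k)
local notation "V" => (MvPowerSeries.X 1 : Pow k)

/-- The Koszul map `(s, t) ↦ u s + v t`. -/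
noncomputable def koszulMap : Twist G (Pow k) →ₗ[MonoidAlgebra k G] Pow k :=
  ofCommutes
    (show Twist G (Pow k) →ₗ[k] Pow k from
      { toFun := fun t => U * t 0 + V * t 1
        map_add' := fun s t => by
          change U * (s 0 + t 0) + V * (s 1 + t 1) = _
          ring
        map_smul' := fun c t => by
          change U * (c • t 0) + V * (c • t 1) = c • (U * t 0 + V * t 1)
          rw [mul_smul_comm, mul_smul_comm, smul_add] }) (by
    intro g t
    change U * (MonoidAlgebra.single g (1 : k) • t) 0 + V * (MonoidAlgebra.single g (1 : k) • t) 1 =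
      MonoidAlgebra.single g (1 : k) • (U * t 0 + V * t 1)
    rw [single_smul_twist_two, single_smul_twist_two, smul_add, single_smul_mul, single_smul_mul,
      single_smul_pow G g U, single_smul_pow G g V, linSubst_X_eq, linSubst_X_eq]
    simp only [mul_add, add_mul, mul_smul_comm, smul_mul_assoc]
    abel)

lemma koszulMap_apply (t : Twist G (Pow k)) : koszulMap G t = U * t 0 + V * t 1 := rfl

variable {G} in
-- The determinant of two vectors of S ⊗ k² is scaled by det g = 1. This is why the socle generator
-- is invariant and R is Gorenstein.
lemma det_invariant {s t : Twist G (Pow k)} (hs : ∀ g : G, MonoidAlgebra.single g (1 : k) • s = s)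
    (ht : ∀ g : G, MonoidAlgebra.single g (1 : k) • t = t) :
    s 0 * t 1 - s 1 * t 0 ∈ invariantRing G := by
  rw [mem_invariantRing]
  intro g
  have h : ∀ {y : Twist G (Pow k)}, (∀ g : G, MonoidAlgebra.single g (1 : k) • y = y) → ∀ i,
      y i = (g : SL(2, k)).val i 0 • MonoidAlgebra.single g (1 : k) • y 0 +
        (g : SL(2, k)).val i 1 • MonoidAlgebra.single g (1 : k) • y 1 := fun {y} hy i => by
    conv_lhs => rw [← hy g]
    rw [single_smul_twist_two]
  have h1 := h hs 0
  have h2 := h hs 1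
  have h3 := h ht 0
  have h4 := h ht 1
  rw [smul_sub, single_smul_mul, single_smul_mul]
  generalize MonoidAlgebra.single g (1 : k) • s 0 = s₀ at *
  generalize MonoidAlgebra.single g (1 : k) • s 1 = s₁ at *
  generalize MonoidAlgebra.single g (1 : k) • t 0 = t₀ at *
  generalize MonoidAlgebra.single g (1 : k) • t 1 = t₁ at *
  rw [h1, h2, h3, h4]
  have hdet := congrArg (MvPowerSeries.C (σ := Fin 2)) (det_eq G g)
  simp only [map_sub, map_mul, map_one] at hdet
  simp only [MvPowerSeries.smul_eq_C_mul]
  linear_combination (s₁ * t₀ - s₀ * t₁) * hdet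

variable [Finite G] [NeZero (Nat.card G : k)]

/-- The Koszul map is equivariant, so averaging any lift of the invariant a gives an invariant lift.
-/
lemma exists_fixed_lift (a : invariantRing G) (ha : a ∈ maximalIdeal (invariantRing G)) :
    ∃ t : Twist G (Pow k), (∀ g : G, MonoidAlgebra.single g (1 : k) • t = t) ∧
      (a : Pow k) = U * t 0 + V * t 1 := by
  obtain ⟨p, q, h⟩ := exists_eq_of_constantCoeff_eq_zero (mem_maximalIdeal_iff G |>.1 ha)
  let t : Twist G (Pow k) := (![p, q] : Fin 2 → Pow k)
  have ht : koszulMap G t = a := h.symm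
  refine ⟨average G • t, fun g => single_smul_average_smul g t, ?_⟩
  rw [← koszulMap_apply, map_smul, ht, average_smul_eq (single_smul_coe · a)]

lemma mem_span_pair_coe {a b r : invariantRing G} :
    (r : Pow k) ∈ Ideal.span {(a : Pow k), (b : Pow k)} ↔ r ∈ Ideal.span {a, b} := by
  constructor
  · intro h
    refine comap_map_invariantRing G _ ?_
    rw [Ideal.map_span, Set.image_pair]
    exact h
  · intro h
    obtain ⟨x, y, rfl⟩ := Ideal.mem_span_pair.1 h
    exact Ideal.mem_span_pair.2 ⟨x, y, rfl⟩

/-- The determinant δ of invariant lifts of a and b generates the socle of S/(a, b) and lies in R. A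
functional on S/(a, b) nonzero at δ can be averaged and normalised. It is nondegenerate on R/(a, b)
because any element outside (a, b) has a multiple equal to a nonzero socle element, and the
multiplier may be replaced by its average. -/
lemma exists_nondegenerate_functional (a b : invariantRing G) (h : IsSys (a : Pow k) (b : Pow k))
    (ha0 : (a : Pow k) ≠ 0)
    (ha : a ∈ maximalIdeal (invariantRing G)) (hb : b ∈ maximalIdeal (invariantRing G)) :
    ∃ (δ : invariantRing G) (l : invariantRing G ⧸ Ideal.span {a, b} →ₗ[k] k),
      (∀ r ∈ maximalIdeal (invariantRing G), r * δ ∈ Ideal.span {a, b}) ∧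
      l (Submodule.Quotient.mk δ) = 1 ∧
      ∀ x, (∀ r, l (Submodule.Quotient.mk (r * x)) = 0) → x ∈ Ideal.span {a, b} := by
  obtain ⟨s, hs, es⟩ := exists_fixed_lift G a ha
  obtain ⟨t, ht, et⟩ := exists_fixed_lift G b hb
  let δ : invariantRing G := ⟨s 0 * t 1 - s 1 * t 0, det_invariant hs ht⟩
  have hδ : (δ : Pow k) = s 0 * t 1 - s 1 * t 0 := rfl
  set I : Ideal (Pow k) := Ideal.span {(a : Pow k), (b : Pow k)} with hI
  have hnot : (δ : Pow k) ∉ I := h.det_notMem ha0 es et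
  obtain ⟨l₀, hl₀, hl₁⟩ := Submodule.exists_dual_map_eq_bot_of_notMem
    (p := I.restrictScalars k) (x := (δ : Pow k)) hnot inferInstance
  have hl₂ : ∀ x ∈ I, l₀ x = 0 := fun x hx => by
    have : l₀ x ∈ (I.restrictScalars k).map l₀ := ⟨x, hx, rfl⟩
    rw [hl₁] at this
    exact this
  have hIG : ∀ x ∈ I, average G • x ∈ I := by
    intro x hx
    obtain ⟨y, z, rfl⟩ := Ideal.mem_span_pair.1 hx
    rw [smul_add, mul_comm y, mul_comm z, smul_coe_mul, smul_coe_mul]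
    exact Ideal.mem_span_pair.2 ⟨average G • y, average G • z, by ring⟩
  have hav : ∀ x : Pow k, average G • average G • x = average G • x := fun x =>
    average_smul_eq fun g => single_smul_average_smul g x
  -- the invariant functional on the power series ring
  let l₃ : Pow k → k := fun x => (l₀ (δ : Pow k))⁻¹ * l₀ (average G • x)
  have hδδ : average G • (δ : Pow k) = δ := average_smul_eq (single_smul_coe · δ)
  have h3δ : l₃ (δ : Pow k) = 1 := by
    change _⁻¹ * l₀ (average G • (δ : Pow k)) = 1
    rw [hδδ, inv_mul_cancel₀ hl₀]
  have h3add : ∀ x y, l₃ (x + y) = l₃ x + l₃ y := fun x y => by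
    change _ * l₀ (average G • (x + y)) = _ * l₀ _ + _ * l₀ _
    rw [smul_add, map_add, mul_add]
  have h3smul : ∀ (c : k) x, l₃ (c • x) = c * l₃ x := fun c x => by
    change _ * l₀ (average G • (c • x)) = _ * (_ * l₀ _)
    rw [smul_comm, map_smul, smul_eq_mul]
    ring
  have h3I : ∀ x ∈ I, l₃ x = 0 := fun x hx => by
    change _ * l₀ (average G • x) = 0
    rw [hl₂ _ (hIG x hx), mul_zero]
  have h3av : ∀ x, l₃ (average G • x) = l₃ x := fun x => by
    change _ * l₀ (average G • _) = _ * l₀ _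
    rw [hav]
  let l₄ : invariantRing G →ₗ[k] k :=
    { toFun x := l₃ x
      map_add' x y := h3add _ _
      map_smul' c x := h3smul _ _ }
  have h4 : (Ideal.span {a, b}).restrictScalars k ≤ LinearMap.ker l₄ := fun x hx =>
    h3I _ ((mem_span_pair_coe G).2 hx)
  let l : invariantRing G ⧸ Ideal.span {a, b} →ₗ[k] k :=
    (Submodule.liftQ _ l₄ h4) ∘ₗ
      (Submodule.Quotient.restrictScalarsEquiv k (Ideal.span {a, b})).symm.toLinearMap
  have hl : ∀ x : invariantRing G, l (Submodule.Quotient.mk x) = l₃ x := fun x => rfl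
  have hδm : ∀ f ∈ maxPow k, f * (δ : Pow k) ∈ I := fun f hf => mul_det_mem es et hf
  refine ⟨δ, l, ?_, ?_, ?_⟩
  · intro r hr
    rw [← mem_span_pair_coe]
    exact hδm _ (mem_maxPow_iff.2 ((mem_maximalIdeal_iff G).1 hr))
  · rw [hl, h3δ]
  · intro y hy
    by_contra hyI
    rw [← mem_span_pair_coe] at hyI
    obtain ⟨j, hj⟩ := h.exists_pow_le
    obtain ⟨x, hx, hx'⟩ := exists_mul_socle hj hyI
    obtain ⟨z, hz⟩ := h.exists_sub_mem ha0 es et hx'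
    -- As y is invariant, averaging x y amounts to averaging x, and the hypothesis on y applies to
    -- the Reynolds image of x.
    have h5 : l₃ (x * y) = 0 := by
      have := hy (reynolds G x)
      rw [hl] at this
      rw [← h3av, mul_comm x, smul_coe_mul, ← this, mul_comm]
      rfl
    -- The maximal ideal kills δ modulo (a, b), so only the constant term c of z matters: x y ≡ c δ,
    -- and applying l₃ gives c = 0.
    set c := MvPowerSeries.constantCoeff z with hc
    have hzm : z - algebraMap k _ c ∈ maxPow k := mem_maxPow_iff.2 (by
      simp [MvPowerSeries.algebraMap_apply, hc])
    have h6 : x * y - c • (δ : Pow k) ∈ I := by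
      have h7 := I.add_mem hz (hδm _ hzm)
      rw [← hδ, sub_mul, ← Algebra.smul_def] at h7
      have h8 : x * y - c • (δ : Pow k) = x * y - z * δ + (z * δ - c • (δ : Pow k)) := by abel
      rw [h8]
      exact h7
    have h9 : l₃ (x * y) = c := by
      have h10 : x * (y : Pow k) = (x * y - c • (δ : Pow k)) + c • (δ : Pow k) := by abel
      rw [h10, h3add, h3I _ h6, h3smul, h3δ, zero_add, mul_one]
    rw [h5] at h9
    rw [← h9, zero_smul, sub_zero] at h6
    exact hx h6

lemma finite_quotient_span_pair (a b : invariantRing G) (h : IsSys (a : Pow k) (b : Pow k)) :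
    Module.Finite k (invariantRing G ⧸ Ideal.span {a, b}) := by
  obtain ⟨j, hj⟩ := h.exists_pow_le
  have h1 : Module.Finite k
      (Pow k ⧸ (Ideal.span {(a : Pow k), (b : Pow k)}).restrictScalars k) :=
    finite_quotient_of_pow_le (j := j) fun x hx => hj hx
  let f : invariantRing G →ₗ[k]
      Pow k ⧸ (Ideal.span {(a : Pow k), (b : Pow k)}).restrictScalars k :=
    Submodule.mkQ _ ∘ₗ (invariantRing G).val.toLinearMap
  have hf : LinearMap.ker f = (Ideal.span {a, b}).restrictScalars k := by
    ext x
    rw [LinearMap.mem_ker, Submodule.restrictScalars_mem, ← mem_span_pair_coe]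
    exact Submodule.Quotient.mk_eq_zero _
  have h2 : Module.Finite k (invariantRing G ⧸ LinearMap.ker f) :=
    Module.Finite.equiv f.quotKerEquivRange.symm
  rw [hf] at h2
  exact Module.Finite.equiv (Submodule.Quotient.restrictScalarsEquiv k (Ideal.span {a, b}))

/-- The norm of a power series. -/
noncomputable def normPow (f : Pow k) : invariantRing G :=
  letI := Fintype.ofFinite G
  ⟨∏ g : G, linSubst (g : SL(2, k)) f, fun h hh => by
    rw [map_prod]
    simp only [← linSubst_mul]
    exact Fintype.prod_equiv (Equiv.mulLeft (⟨h, hh⟩ : G)) _ _ fun _ => rfl⟩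

lemma normPow_mem {f : Pow k} (hf : MvPowerSeries.constantCoeff f = 0) :
    normPow G f ∈ maximalIdeal (invariantRing G) := by
  let := Fintype.ofFinite G
  rw [mem_maximalIdeal_iff]
  change MvPowerSeries.constantCoeff (∏ g : G, linSubst (g : SL(2, k)) f) = 0
  rw [map_prod]
  simp only [constantCoeff_linSubst, hf]
  rw [Finset.prod_const, zero_pow (Finset.card_ne_zero.2 Finset.univ_nonempty)]

lemma linSubst_injective (g : SL(2, k)) : Function.Injective (linSubst g) := fun x y h => by
  have := congrArg (linSubst g⁻¹) h
  simpa only [← linSubst_mul, inv_mul_cancel, linSubst_one] using this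

/-- The norms of u and of a general linear form tu + v work: they are products of linear forms, and
a factor of one is never proportional to a factor of the other. -/
lemma exists_invariant_isSys [Infinite k] : ∃ a b : invariantRing G,
    IsSys (a : Pow k) (b : Pow k) ∧ (a : Pow k) ≠ 0 ∧
    a ∈ maximalIdeal (invariantRing G) ∧ b ∈ maximalIdeal (invariantRing G) := by
  classical
  let := Fintype.ofFinite G
  -- Proportional conjugates of u and tu + v would give some g with g_00 = g_10 t. The finitely many
  -- ratios are avoided; when g_10 = 0, invertibility of g already gives g_00 ≠ 0.
  obtain ⟨t, ht⟩ := Infinite.exists_notMem_finset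
    (Finset.univ.image fun g : G => (g : SL(2, k)).val 0 0 / (g : SL(2, k)).val 1 0)
  have h1 : ∀ g : SL(2, k), g ∈ G → g.val 0 0 - g.val 1 0 * t ≠ 0 := by
    intro g hg h
    by_cases h10 : g.val 1 0 = 0
    · have hdet := det_eq G ⟨g, hg⟩
      simp only [h10, zero_mul, sub_zero, mul_zero] at h hdet
      simp [h] at hdet
    · refine ht (Finset.mem_image.2 ⟨⟨g, hg⟩, Finset.mem_univ _, ?_⟩)
      rw [div_eq_iff h10]
      linear_combination h
  refine ⟨normPow G U, normPow G (t • U + V), ?_, ?_, normPow_mem G (by simp),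
    normPow_mem G (by simp [MvPowerSeries.smul_eq_C_mul])⟩
  · refine IsSys.prod _ _ _ _ (fun g => ?_) fun g h => ?_
    · rw [← map_zero (linSubst (g : SL(2, k)))]
      exact (linSubst_injective _).ne (X_ne_zero' 0)
    · have e1 : linSubst (h : SL(2, k)) (t • U + V) =
          ((h : SL(2, k)).val 0 0 * t + (h : SL(2, k)).val 0 1) • U +
          ((h : SL(2, k)).val 1 0 * t + (h : SL(2, k)).val 1 1) • V := by
        rw [map_add, map_smul, linSubst_X_eq, linSubst_X_eq]
        module
      rw [e1, linSubst_X_eq]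
      refine isSys_linear ?_
      have h2 := h1 (h⁻¹ * g : G) (h⁻¹ * g).2
      have e2 : ((h⁻¹ * g : G) : SL(2, k)).val 0 0 - ((h⁻¹ * g : G) : SL(2, k)).val 1 0 * t =
          (g : SL(2, k)).val 0 0 * ((h : SL(2, k)).val 1 0 * t + (h : SL(2, k)).val 1 1) -
          (g : SL(2, k)).val 1 0 * ((h : SL(2, k)).val 0 0 * t + (h : SL(2, k)).val 0 1) := by
        rw [Subgroup.coe_mul, Subgroup.coe_inv]
        rw [Matrix.SpecialLinearGroup.coe_mul, Matrix.SpecialLinearGroup.coe_inv,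
          Matrix.adjugate_fin_two]
        simp [Matrix.mul_apply, Fin.sum_univ_two]
        ring
      rw [e2] at h2
      exact h2
  · change ∏ g : G, linSubst (g : SL(2, k)) U ≠ 0
    refine Finset.prod_ne_zero_iff.2 fun g _ => ?_
    rw [← map_zero (linSubst (g : SL(2, k)))]
    exact (linSubst_injective _).ne (X_ne_zero' 0)

lemma mem_invariantRing_of_mul {a : invariantRing G} (ha : (a : Pow k) ≠ 0) {f : Pow k}
    (hf : (a : Pow k) * f ∈ invariantRing G) : f ∈ invariantRing G := by
  rw [mem_invariantRing] at hf ⊢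
  intro g
  have := hf g
  rw [smul_coe_mul] at this
  exact mul_left_cancel₀ ha this

/-- Divisibility by a^n in S descends to R, because the quotient of two invariants is invariant. -/
lemma cechRegular_of_isSys {a b : invariantRing G} (h : IsSys (a : Pow k) (b : Pow k))
    (ha : (a : Pow k) ≠ 0) : CechRegular a b (invariantRing G) := by
  have h0 : ∀ r : invariantRing G, a • r = 0 → r = 0 := fun r hr => by
    have h1 : (a : Pow k) * (r : Pow k) = 0 := congrArg Subtype.val hr
    exact Subtype.ext ((mul_eq_zero.1 h1).resolve_left ha)
  refine ⟨h0, fun q hq => ?_⟩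
  obtain ⟨n, r, rfl⟩ := exists_frac q
  rw [← map_smul, frac_eq_zero h0] at hq
  rw [frac_eq_zero h0]
  obtain ⟨s, hs⟩ := hq
  have hs' : (b : Pow k) * (r : Pow k) = (a : Pow k) ^ n * (s : Pow k) := congrArg Subtype.val hs
  have h2 := h.pow ha n 1
  rw [pow_one] at h2
  obtain ⟨f, hf⟩ := h2.dvd (r : Pow k) ⟨_, hs'⟩
  have hfm : f ∈ invariantRing G := mem_invariantRing_of_mul (a := a ^ n) G
    (by rw [SubmonoidClass.coe_pow]; exact pow_ne_zero n ha)
    (by rw [SubmonoidClass.coe_pow, ← hf]; exact r.2)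
  exact ⟨⟨f, hfm⟩, Subtype.ext hf⟩

theorem isGorensteinSystem_of_isSys {a b : invariantRing G} (h : IsSys (a : Pow k) (b : Pow k))
    (ha0 : (a : Pow k) ≠ 0) (ha : a ∈ maximalIdeal (invariantRing G))
    (hb : b ∈ maximalIdeal (invariantRing G)) : ∃ δ, IsGorensteinSystem a b δ := by
  obtain ⟨δ, l, h1, h2, h3⟩ := exists_nondegenerate_functional G a b h ha0 ha hb
  have hpow : powIdeal a b 1 = Ideal.span {a, b} := by rw [powIdeal, pow_one, pow_one]
  refine ⟨δ, ha, hb, ?_, cechRegular_of_isSys G h ha0, ?_, ?_, ?_, ?_⟩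
  · obtain ⟨j, hj⟩ := h.exists_pow_le
    refine ⟨j, fun r hr => ?_⟩
    rw [← mem_span_pair_coe]
    refine hj ?_
    have h4 : (maximalIdeal (invariantRing G)).map (algebraMap (invariantRing G) (Pow k)) ≤
        maxPow k := by
      rw [Ideal.map_le_iff_le_comap]
      intro x hx
      exact mem_maxPow_iff.2 ((mem_maximalIdeal_iff G).1 hx)
    have h5 := Ideal.mem_map_of_mem (algebraMap (invariantRing G) (Pow k)) hr
    rw [Ideal.map_pow] at h5
    exact Ideal.pow_right_mono h4 j h5
  · intro n J φ hφ
    -- For n = 0 the ideal is the whole ring and the quotient is zero; the functional exists only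
    -- for parameters in the maximal ideal.
    rcases Nat.eq_zero_or_pos n with rfl | hn
    · have hsub : Subsingleton (invariantRing G ⧸ powIdeal a b 0) := by
        rw [Ideal.Quotient.subsingleton_iff, Ideal.eq_top_iff_one]
        exact mem_powIdeal.2 ⟨1, 0, by simp⟩
      exact ⟨0, fun x => Subsingleton.elim _ _⟩
    · have hn' := h.pow ha0 n n
      rw [← SubmonoidClass.coe_pow, ← SubmonoidClass.coe_pow] at hn'
      have hfin := finite_quotient_span_pair G (a ^ n) (b ^ n) hn'
      obtain ⟨_, l', _, _, h3'⟩ := exists_nondegenerate_functional G (a ^ n) (b ^ n) hn'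
        (by rw [SubmonoidClass.coe_pow]; exact pow_ne_zero n ha0)
        (Ideal.pow_mem_of_mem _ ha n hn) (Ideal.pow_mem_of_mem _ hb n hn)
      exact exists_eq_smul_of_nondegenerate (Ideal.span {a ^ n, b ^ n}) l' h3' J φ hφ
  · rw [hpow]
    intro hmem
    rw [(Submodule.Quotient.mk_eq_zero _).2 hmem, map_zero] at h2
    exact zero_ne_one h2
  · rw [hpow]
    exact h1
  · rw [hpow]
    intro x hx
    -- Since l(δ) = 1, the difference x − l(x) δ is a socle element killed by l, hence by l after
    -- any multiplication, and nondegeneracy applies.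
    refine ⟨algebraMap k _ (l (Submodule.Quotient.mk x)), ?_⟩
    refine h3 _ fun r => ?_
    set c' := l (Submodule.Quotient.mk x) with hc'
    obtain ⟨c, r', hr', hr⟩ : ∃ (c : k), ∃ r' ∈ maximalIdeal (invariantRing G),
        r = r' + algebraMap k _ c := ⟨_, _, exists_sub_mem_maximalIdeal G r, by ring⟩
    have h4 : r * (x - algebraMap k _ c' * δ) = (r' * x - algebraMap k _ c' * (r' * δ)) +
        c • (x - c' • δ) := by
      rw [hr, Algebra.smul_def, Algebra.smul_def]
      ring
    have h5 : (Submodule.Quotient.mk (r' * x - algebraMap k _ c' * (r' * δ)) :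
        invariantRing G ⧸ Ideal.span {a, b}) = 0 := (Submodule.Quotient.mk_eq_zero _).2
      (Ideal.sub_mem _ (hx r' hr') (Ideal.mul_mem_left _ _ (h1 r' hr')))
    rw [h4, Submodule.Quotient.mk_add, h5, zero_add, Submodule.Quotient.mk_smul, map_smul,
      Submodule.Quotient.mk_sub, map_sub, Submodule.Quotient.mk_smul, map_smul, h2, ← hc',
      smul_eq_mul, smul_eq_mul, mul_one, sub_self, mul_zero]

end System

end Kleinian

namespace Kleinian

open IsLocalRing

/-! ### Invariant pairs -/

lemma finite_of_exact {R M N P : Type u} [CommRing R] [IsNoetherianRing R] [AddCommGroup M]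
    [AddCommGroup N] [AddCommGroup P] [Module R M] [Module R N] [Module R P] [Module.Finite R M]
    [Module.Finite R P] {f : M →ₗ[R] N} {g : N →ₗ[R] P} (h : Function.Exact f g) :
    Module.Finite R N := by
  have : IsNoetherian R N := isNoetherian_of_range_eq_ker f g (LinearMap.exact_iff.1 h).symm
  infer_instance

section Pairs

variable {k : Type u} [Field k] (G : Subgroup SL(2, k))

local notation "U" => (MvPowerSeries.X 0 : Pow k)
local notation "V" => (MvPowerSeries.X 1 : Pow k)

/-- The pairs of power series that are invariant under the diagonal action on `S ⊗ k²`. -/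
noncomputable def pairModule : Submodule (invariantRing G) (Fin 2 → Pow k) where
  carrier := {t | ∀ (g : G) i, t i = (g : SL(2, k)).val i 0 • linSubst (g : SL(2, k)) (t 0) +
    (g : SL(2, k)).val i 1 • linSubst (g : SL(2, k)) (t 1)}
  add_mem' {s t} hs ht g i := by
    change s i + t i = _ • linSubst _ (s 0 + t 0) + _ • linSubst _ (s 1 + t 1)
    rw [map_add, map_add, hs g i, ht g i]
    module
  zero_mem' g i := by simp
  smul_mem' r t ht g i := by
    change (r : Pow k) * t i = _ • linSubst _ ((r : Pow k) * t 0) +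
      _ • linSubst _ ((r : Pow k) * t 1)
    rw [map_mul, map_mul, r.2 g g.2, ht g i, mul_add, mul_smul_comm, mul_smul_comm]

variable {G} in
lemma mem_pairModule {t : Fin 2 → Pow k} : t ∈ pairModule G ↔
    ∀ g : G, MonoidAlgebra.single g (1 : k) • (show Twist G (Pow k) from t) = t := by
  have h : ∀ (g : G) i, (MonoidAlgebra.single g (1 : k) • (show Twist G (Pow k) from t)) i =
      (g : SL(2, k)).val i 0 • linSubst (g : SL(2, k)) (t 0) +
        (g : SL(2, k)).val i 1 • linSubst (g : SL(2, k)) (t 1) := fun g i => by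
    rw [single_smul_twist_two, single_smul_pow, single_smul_pow]
  exact ⟨fun ht g => funext fun i => (h g i).trans (ht g i).symm,
    fun ht g i => (congrFun (ht g) i).symm.trans (h g i)⟩

/-- Elements of `S ⊗ k²` as pairs. -/
noncomputable def tensorEquivPairs :
    (Pow k ⊗[k] (Fin 2 → k)) ≃ₗ[invariantRing G] (Fin 2 → Pow k) :=
  (TensorProduct.piScalarRight k (Pow k) (Pow k) (Fin 2)).restrictScalars (invariantRing G)

lemma tensorEquivPairs_tmul (f : Pow k) (v : Fin 2 → k) (i : Fin 2) :
    tensorEquivPairs G (f ⊗ₜ v) i = v i • f := by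
  change TensorProduct.piScalarRight k (Pow k) (Pow k) (Fin 2) (f ⊗ₜ v) i = _
  rw [TensorProduct.piScalarRight_apply, TensorProduct.piScalarRightHom_tmul]

lemma tensorEquivPairs_map (g : G) (t : Pow k ⊗[k] (Fin 2 → k)) (i : Fin 2) :
    tensorEquivPairs G (TensorProduct.map (linSubst (g : SL(2, k))).toLinearMap
      (fundamentalRep G g) t) i =
      (g : SL(2, k)).val i 0 • linSubst (g : SL(2, k)) (tensorEquivPairs G t 0) +
        (g : SL(2, k)).val i 1 • linSubst (g : SL(2, k)) (tensorEquivPairs G t 1) := by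
  induction t with
  | zero => simp
  | add x y hx hy =>
    rw [map_add, map_add, Pi.add_apply, hx, hy, map_add, Pi.add_apply, Pi.add_apply, map_add,
      map_add]
    module
  | tmul f v =>
    rw [TensorProduct.map_tmul, tensorEquivPairs_tmul, tensorEquivPairs_tmul,
      tensorEquivPairs_tmul, map_smul, map_smul]
    change (Matrix.toLin' (g : SL(2, k)).val v) i • linSubst (g : SL(2, k)) f = _
    rw [Matrix.toLin'_apply, Matrix.mulVec, dotProduct, Fin.sum_univ_two, add_smul, mul_smul,
      mul_smul]

lemma map_auslanderModule : (auslanderModule G (fundamentalRep G)).map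
    (tensorEquivPairs G).toLinearMap = pairModule G := by
  ext t
  obtain ⟨t, rfl⟩ := (tensorEquivPairs G).surjective t
  have h1 : tensorEquivPairs G t ∈ (auslanderModule G (fundamentalRep G)).map
      (tensorEquivPairs G).toLinearMap ↔ t ∈ auslanderModule G (fundamentalRep G) :=
    ⟨fun ⟨s, hs, h⟩ => (tensorEquivPairs G).injective h ▸ hs, fun h => ⟨t, h, rfl⟩⟩
  rw [h1]
  constructor
  · intro h g i
    rw [← tensorEquivPairs_map, h g]
  · intro h g
    refine (tensorEquivPairs G).injective (funext fun i => ?_)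
    rw [tensorEquivPairs_map, ← h g i]

lemma nonempty_auslanderModule_equiv :
    Nonempty (auslanderModule G (fundamentalRep G) ≃ₗ[invariantRing G] pairModule G) :=
  ⟨((tensorEquivPairs G).submoduleMap _).trans (LinearEquiv.ofEq _ _ (map_auslanderModule G))⟩

/-- The Koszul map `y ↦ (v y, - u y)`. -/
noncomputable def koszulDual : Pow k →ₗ[MonoidAlgebra k G] Twist G (Pow k) :=
  ofCommutes
    (show Pow k →ₗ[k] Twist G (Pow k) from
      { toFun := fun y => (![V * y, -(U * y)] : Fin 2 → Pow k)
        map_add' := fun s t => by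
          funext i
          fin_cases i
          · exact mul_add V s t
          · change -(U * (s + t)) = -(U * s) + -(U * t)
            ring
        map_smul' := fun c t => by
          funext i
          fin_cases i
          · exact mul_smul_comm c V t
          · change -(U * c • t) = c • -(U * t)
            rw [mul_smul_comm, smul_neg] }) (by
    intro g y
    have hdet := congrArg (MvPowerSeries.C (σ := Fin 2)) (det_eq G g)
    simp only [map_sub, map_mul, map_one] at hdet
    funext i
    refine Eq.trans ?_ (single_smul_twist_two G g (![V * y, -(U * y)] : Fin 2 → Pow k) i).symm
    change (![V * MonoidAlgebra.single g (1 : k) • y, -(U * MonoidAlgebra.single g (1 : k) • y)] :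
      Fin 2 → Pow k) i = _ • MonoidAlgebra.single g (1 : k) • (V * y) +
        _ • MonoidAlgebra.single g (1 : k) • (-(U * y))
    rw [smul_neg, single_smul_mul, single_smul_mul, single_smul_pow G g U, single_smul_pow G g V,
      linSubst_X_eq, linSubst_X_eq]
    generalize MonoidAlgebra.single g (1 : k) • y = z
    simp only [MvPowerSeries.smul_eq_C_mul]
    fin_cases i
    · change V * z = MvPowerSeries.C ((g : SL(2, k)).val 0 0) * _ +
        MvPowerSeries.C ((g : SL(2, k)).val 0 1) * _
      linear_combination (-(V * z)) * hdet
    · change -(U * z) = MvPowerSeries.C ((g : SL(2, k)).val 1 0) * _ +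
        MvPowerSeries.C ((g : SL(2, k)).val 1 1) * _
      linear_combination (U * z) * hdet)

lemma koszulDual_zero (y : Pow k) : koszulDual G y 0 = V * y := rfl

lemma koszulDual_one (y : Pow k) : koszulDual G y 1 = -(U * y) := rfl

lemma koszulDual_mem (r : invariantRing G) : koszulDual G (r : Pow k) ∈ pairModule G :=
  mem_pairModule.2 fun g => by
    change MonoidAlgebra.single g (1 : k) • koszulDual G (r : Pow k) = _
    rw [← map_smul, single_smul_coe]

lemma koszulDual_injective : Function.Injective (koszulDual G) := fun _ _ h =>
  mul_left_cancel₀ (X_ne_zero' (k := k) 1) (congrFun h 0)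

/-- The inclusion of the ring of invariants into the invariant pairs. -/
noncomputable def pairInl : invariantRing G →ₗ[invariantRing G] pairModule G where
  toFun r := ⟨koszulDual G (r : Pow k), koszulDual_mem G r⟩
  map_add' r s := Subtype.ext ((koszulDual G).map_add (r : Pow k) s)
  map_smul' r s := by
    refine Subtype.ext (funext fun i => ?_)
    fin_cases i
    · change V * ((r : Pow k) * (s : Pow k)) = (r : Pow k) * (V * (s : Pow k))
      ring
    · change -(U * ((r : Pow k) * (s : Pow k))) = (r : Pow k) * -(U * (s : Pow k))
      ring

lemma koszulMap_mem {t : Fin 2 → Pow k} (ht : t ∈ pairModule G) :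
    U * t 0 + V * t 1 ∈ invariantRing G := by
  rw [mem_invariantRing]
  intro g
  exact ((koszulMap G).map_smul (MonoidAlgebra.single g (1 : k)) t).symm.trans
    (congrArg (koszulMap G) (mem_pairModule.1 ht g))

/-- The projection of the invariant pairs onto the maximal ideal. -/
noncomputable def pairProj : pairModule G →ₗ[invariantRing G] maximalIdeal (invariantRing G) where
  toFun t := ⟨⟨U * t.1 0 + V * t.1 1, koszulMap_mem G t.2⟩, by
    rw [mem_maximalIdeal_iff]
    simp⟩
  map_add' s t := by
    refine Subtype.ext (Subtype.ext ?_)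
    change U * (s.1 0 + t.1 0) + V * (s.1 1 + t.1 1) = (U * s.1 0 + V * s.1 1) +
      (U * t.1 0 + V * t.1 1)
    ring
  map_smul' r t := by
    refine Subtype.ext (Subtype.ext ?_)
    change U * ((r : Pow k) * t.1 0) + V * ((r : Pow k) * t.1 1) =
      (r : Pow k) * (U * t.1 0 + V * t.1 1)
    ring

lemma pairInl_injective : Function.Injective (pairInl G) := fun _ _ h =>
  Subtype.ext (koszulDual_injective G (congrArg Subtype.val h))

lemma exact_pairInl_pairProj : Function.Exact (pairInl G) (pairProj G) := by
  intro t
  constructor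
  · intro h
    have h1 : U * t.1 0 + V * t.1 1 = 0 := congrArg (fun x : maximalIdeal (invariantRing G) => ((x : invariantRing G) : Pow k)) h
    obtain ⟨y, hy0, hy1⟩ := koszul h1
    have hy : koszulDual G y = t.1 := by
      funext i
      fin_cases i
      · exact hy0.symm
      · exact hy1.symm
    have hyR : y ∈ invariantRing G := by
      rw [mem_invariantRing]
      intro g
      refine koszulDual_injective G ?_
      rw [map_smul, hy]
      exact mem_pairModule.1 t.2 g
    exact ⟨⟨y, hyR⟩, Subtype.ext hy⟩
  · rintro ⟨r, rfl⟩
    refine Subtype.ext (Subtype.ext ?_)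
    change U * (V * (r : Pow k)) + V * -(U * (r : Pow k)) = 0
    ring

/-- A section s satisfies b s(a) = a s(b), so regularity of a, b on S makes both entries of s(a)
divisible by a. Cancelling a in u s(a)_0 + v s(a)_1 = a puts 1 into (u, v). -/
lemma not_exists_section_pairProj {a b : invariantRing G} (h : IsSys (a : Pow k) (b : Pow k))
    (ha0 : (a : Pow k) ≠ 0) (ha : a ∈ maximalIdeal (invariantRing G))
    (hb : b ∈ maximalIdeal (invariantRing G)) :
    ¬ ∃ s : maximalIdeal (invariantRing G) →ₗ[invariantRing G] pairModule G,
      pairProj G ∘ₗ s = LinearMap.id := by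
  rintro ⟨s, hs⟩
  have h1 : b • s ⟨a, ha⟩ = a • s ⟨b, hb⟩ := by
    rw [← map_smul, ← map_smul]
    congr 1
    exact Subtype.ext (mul_comm b a)
  have h2 : ∀ i, (a : Pow k) ∣ (s ⟨a, ha⟩).1 i := fun i =>
    h.dvd _ ⟨(s ⟨b, hb⟩).1 i, congrFun (congrArg Subtype.val h1) i⟩
  obtain ⟨p, hp⟩ := h2 0
  obtain ⟨q, hq⟩ := h2 1
  have h3 : U * (s ⟨a, ha⟩).1 0 + V * (s ⟨a, ha⟩).1 1 = (a : Pow k) := by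
    have := DFunLike.congr_fun hs ⟨a, ha⟩
    exact congrArg (fun x : maximalIdeal (invariantRing G) => ((x : invariantRing G) : Pow k)) this
  rw [hp, hq] at h3
  have h4 : U * p + V * q = 1 := by
    refine mul_left_cancel₀ ha0 ?_
    linear_combination h3
  have := congrArg MvPowerSeries.constantCoeff h4
  simp at this

variable [Finite G] [NeZero (Nat.card G : k)]

lemma pairProj_surjective : Function.Surjective (pairProj G) := by
  rintro ⟨a, ha⟩
  obtain ⟨t, ht, h⟩ := exists_fixed_lift G a ha
  exact ⟨⟨t, mem_pairModule.2 ht⟩, Subtype.ext (Subtype.ext h.symm)⟩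

instance finite_pairModule : Module.Finite (invariantRing G) (pairModule G) :=
  finite_of_exact (R := invariantRing G) (M := invariantRing G) (N := pairModule G)
    (P := maximalIdeal (invariantRing G)) (exact_pairInl_pairProj G)

end Pairs

end Kleinian

namespace Kleinian

open IsLocalRing

/-! ### Euler characteristics over a semisimple algebra -/

section Generic

lemma exists_comp_eq {A X Y Z : Type u} [Ring A] [AddCommGroup X] [AddCommGroup Y]
    [AddCommGroup Z] [Module A X] [Module A Y] [Module A Z] (f : X →ₗ[A] Y)
    (hf : Function.Surjective f) (g : X →ₗ[A] Z) (h : LinearMap.ker f ≤ LinearMap.ker g) :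
    ∃ p : Y →ₗ[A] Z, ∀ x, p (f x) = g x := by
  refine ⟨(LinearMap.ker f).liftQ g h ∘ₗ (f.quotKerEquivOfSurjective hf).symm.toLinearMap,
    fun x => ?_⟩
  have h1 : (f.quotKerEquivOfSurjective hf).symm (f x) = (LinearMap.ker f).mkQ x := by
    rw [LinearEquiv.symm_apply_eq]
    rfl
  rw [LinearMap.comp_apply, LinearEquiv.coe_coe, h1]
  rfl

lemma nonempty_equiv_of_ker_eq {A X Y Z : Type u} [Ring A] [AddCommGroup X] [AddCommGroup Y]
    [AddCommGroup Z] [Module A X] [Module A Y] [Module A Z] (f : X →ₗ[A] Y)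
    (hf : Function.Surjective f) (g : X →ₗ[A] Z) (hg : Function.Surjective g)
    (h : LinearMap.ker f = LinearMap.ker g) : Nonempty (Y ≃ₗ[A] Z) :=
  ⟨(f.quotKerEquivOfSurjective hf).symm.trans
    ((Submodule.quotEquivOfEq _ _ h).trans (g.quotKerEquivOfSurjective hg))⟩

variable (k : Type u) [Field k] {A : Type u} [Ring A] [Algebra k A]

lemma homRank_pi {X Y : Type u} [AddCommGroup X] [AddCommGroup Y] [Module k X] [Module k Y]
    [Module A X] [Module A Y] [IsScalarTower k A X] [IsScalarTower k A Y] [Module.Finite k X]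
    [Module.Finite k Y] (e : ℕ) : homRank k A X (Fin e → Y) = e * homRank k A X Y := by
  have h : Module.finrank k (X →ₗ[A] (Fin e → Y)) = Module.finrank k (Fin e → (X →ₗ[A] Y)) :=
    LinearEquiv.finrank_eq
      { toFun f i := LinearMap.proj i ∘ₗ f
        invFun f := LinearMap.pi f
        map_add' f g := rfl
        map_smul' c f := rfl
        left_inv f := rfl
        right_inv f := rfl }
  rw [homRank, h, Module.finrank_pi_fintype]
  simp [homRank]

variable [IsSemisimpleRing A]

/-- The Euler characteristic relation of a complex `B → T → B`. -/
lemma homRank_complex {X B T U H Q : Type u} [AddCommGroup X] [AddCommGroup B] [AddCommGroup T]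
    [AddCommGroup U] [AddCommGroup H] [AddCommGroup Q] [Module k X] [Module k B] [Module k T]
    [Module k U] [Module k H] [Module k Q] [Module A X] [Module A B] [Module A T]
    [Module A U] [Module A H] [Module A Q] [IsScalarTower k A X] [IsScalarTower k A B]
    [IsScalarTower k A T] [IsScalarTower k A U] [IsScalarTower k A H] [IsScalarTower k A Q]
    [Module.Finite k X] [Module.Finite k B] [Module.Finite k T]
    (d₂ : B →ₗ[A] T) (d₁ : T →ₗ[A] B) (hd : LinearMap.range d₂ ≤ LinearMap.ker d₁)
    (hU : Nonempty (LinearMap.ker d₂ ≃ₗ[A] U))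
    (hH : Nonempty ((LinearMap.ker d₁ ⧸ (LinearMap.range d₂).submoduleOf (LinearMap.ker d₁)) ≃ₗ[A] H))
    (hQ : Nonempty ((B ⧸ LinearMap.range d₁) ≃ₗ[A] Q)) :
    homRank k A X T + homRank k A X U + homRank k A X Q =
      2 * homRank k A X B + homRank k A X H := by
  obtain ⟨eU⟩ := hU
  obtain ⟨eH⟩ := hH
  obtain ⟨eQ⟩ := hQ
  have := finite_submodule k A (LinearMap.ker d₁)
  have h1 := homRank_eq_ker_add_range k (X := X) d₁
  have h2 := homRank_eq_ker_add_range k (X := X) d₂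
  have h3 := homRank_eq_add_quotient k (X := X) (LinearMap.range d₁)
  have h4 := homRank_eq_add_quotient k (X := X)
    ((LinearMap.range d₂).submoduleOf (LinearMap.ker d₁))
  have h5 := homRank_congr_right k (X := X) (Submodule.submoduleOfEquivOfLe hd)
  rw [homRank_congr_right k eU] at h2
  rw [homRank_congr_right k eH] at h4
  rw [homRank_congr_right k eQ] at h3
  lia

end Generic

/-! ### Generators of the maximal ideal, their fiber and their relations over S -/

section Setup

variable {k : Type u} [Field k] (G : Subgroup SL(2, k))

local notation "U" => (MvPowerSeries.X 0 : Pow k)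
local notation "V" => (MvPowerSeries.X 1 : Pow k)

/-- The map of twisted modules induced by a map. -/
noncomputable def twistMap {Y Z : Type u} [AddCommGroup Y] [Module k Y] [Module (MonoidAlgebra k G) Y]
    [IsScalarTower k (MonoidAlgebra k G) Y] [AddCommGroup Z] [Module k Z]
    [Module (MonoidAlgebra k G) Z] [IsScalarTower k (MonoidAlgebra k G) Z]
    (f : Y →ₗ[MonoidAlgebra k G] Z) : Twist G Y →ₗ[MonoidAlgebra k G] Twist G Z :=
  ofCommutes
    (show Twist G Y →ₗ[k] Twist G Z from
      { toFun := fun y i => f (y i)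
        map_add' := fun x y => funext fun i => map_add f (x i) (y i)
        map_smul' := fun c y => funext fun i => LinearMap.map_smul_of_tower f c (y i) }) (by
    intro g y
    funext i
    refine Eq.trans ?_ (single_smul_twist_two G g _ i).symm
    change f ((MonoidAlgebra.single g (1 : k) • y) i) =
      _ • MonoidAlgebra.single g (1 : k) • f (y 0) + _ • MonoidAlgebra.single g (1 : k) • f (y 1)
    have key : ∀ (c : k) (z : Y), f (c • MonoidAlgebra.single g (1 : k) • z) =
        c • MonoidAlgebra.single g (1 : k) • f z := fun c z => by
      rw [LinearMap.map_smul_of_tower f c, map_smul]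
    rw [single_smul_twist_two, map_add, key, key])

lemma twistMap_surjective {Y Z : Type u} [AddCommGroup Y] [Module k Y]
    [Module (MonoidAlgebra k G) Y]
    [IsScalarTower k (MonoidAlgebra k G) Y] [AddCommGroup Z] [Module k Z]
    [Module (MonoidAlgebra k G) Z] [IsScalarTower k (MonoidAlgebra k G) Z]
    (f : Y →ₗ[MonoidAlgebra k G] Z) (hf : Function.Surjective f) :
    Function.Surjective (twistMap G f) := fun z => by
  choose y hy using fun i => hf (z i)
  exact ⟨y, funext hy⟩

variable {G} {e : ℕ} (a : Fin e → invariantRing G)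

/-- The map `s ↦ ∑ a_i s_i`. -/
noncomputable def genMap : (Fin e → Pow k) →ₗ[MonoidAlgebra k G] Pow k where
  toFun s := ∑ i, (a i : Pow k) * s i
  map_add' s t := by simp [mul_add, Finset.sum_add_distrib]
  map_smul' x s := by
    rw [RingHom.id_apply, Finset.smul_sum]
    exact Finset.sum_congr rfl fun i _ => (smul_coe_mul x (a i) (s i)).symm

lemma genMap_apply (s : Fin e → Pow k) : genMap a s = ∑ i, (a i : Pow k) * s i := rfl

lemma genMap_smul (f : Pow k) (s : Fin e → Pow k) : genMap a (f • s) = f * genMap a s := by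
  rw [genMap_apply, genMap_apply, Finset.mul_sum]
  refine Finset.sum_congr rfl fun i _ => ?_
  change _ * (f * s i) = _
  ring

/-- The module of relations among the `a_i` over the power series ring. -/
noncomputable abbrev relMod : Submodule (MonoidAlgebra k G) (Fin e → Pow k) :=
  LinearMap.ker (genMap a)

/-- The fiber of the power series ring over the closed point. -/
abbrev Fiber : Type u := Pow k ⧸ LinearMap.range (genMap a)

lemma mul_mem_range {x : Pow k} (hx : x ∈ LinearMap.range (genMap a)) (f : Pow k) :
    f * x ∈ LinearMap.range (genMap a) := by
  obtain ⟨s, rfl⟩ := hx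
  exact ⟨f • s, genMap_smul a f s⟩

/-- A minimal system of generators of the maximal ideal of the ring of invariants. -/
structure IsMinGen : Prop where
  mem : ∀ i, a i ∈ maximalIdeal (invariantRing G)
  exists_eq : ∀ r ∈ maximalIdeal (invariantRing G), ∃ x : Fin e → invariantRing G,
    r = ∑ i, a i * x i
  minimal : ∀ x : Fin e → invariantRing G, ∑ i, a i * x i = 0 →
    ∀ i, x i ∈ maximalIdeal (invariantRing G)

variable {a}

lemma IsMinGen.coe_mem_range (h : IsMinGen a) {r : invariantRing G}
    (hr : r ∈ maximalIdeal (invariantRing G)) : (r : Pow k) ∈ LinearMap.range (genMap a) := by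
  obtain ⟨x, rfl⟩ := h.exists_eq r hr
  refine ⟨fun i => x i, ?_⟩
  rw [genMap_apply]
  push_cast
  rfl

lemma IsMinGen.range_le (h : IsMinGen a) {f : Pow k} (hf : f ∈ LinearMap.range (genMap a)) :
    f ∈ maxPow k := by
  obtain ⟨s, rfl⟩ := hf
  rw [genMap_apply]
  exact Ideal.sum_mem _ fun i _ => Ideal.mul_mem_right _ _
    (mem_maxPow_iff.2 ((mem_maximalIdeal_iff G).1 (h.mem i)))

variable [Finite G] [NeZero (Nat.card G : k)]

lemma reynolds_genMap (s : Fin e → Pow k) :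
    reynolds G (genMap a s) = ∑ i, a i * reynolds G (s i) := by
  rw [genMap_apply, map_sum]
  exact Finset.sum_congr rfl fun i _ => reynolds_mul G _ _

/-- Averaging a relation over S yields a relation over R with the same constant terms, and these
vanish by minimality. -/
lemma IsMinGen.relMod_mem (h : IsMinGen a) {s : Fin e → Pow k} (hs : s ∈ relMod a) (i : Fin e) :
    s i ∈ maxPow k := by
  have h1 := h.minimal (fun i => reynolds G (s i)) (by
    rw [← reynolds_genMap, LinearMap.mem_ker.1 hs, map_zero]) i
  rw [mem_maxPow_iff, ← constantCoeff_reynolds G]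
  exact (mem_maximalIdeal_iff G).1 h1

variable [Infinite k]

lemma IsMinGen.exists_pow_le (h : IsMinGen a) :
    ∃ j, ∀ f ∈ maxPow k ^ j, f ∈ LinearMap.range (genMap a) := by
  obtain ⟨p, q, hs, -, hp, hq⟩ := exists_invariant_isSys G
  obtain ⟨j, hj⟩ := hs.exists_pow_le
  refine ⟨j, fun f hf => ?_⟩
  obtain ⟨x, y, rfl⟩ := Ideal.mem_span_pair.1 (hj hf)
  exact add_mem (mul_mem_range a (h.coe_mem_range hp) x) (mul_mem_range a (h.coe_mem_range hq) y)

lemma IsMinGen.finite_fiber (h : IsMinGen a) : Module.Finite k (Fiber a) := by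
  obtain ⟨j, hj⟩ := h.exists_pow_le
  exact finite_quotient_of_pow_le (p := (LinearMap.range (genMap a)).restrictScalars k)
    (j := j) hj

end Setup

/-! ### Koszul homology of the fiber -/

section Complex

variable {k : Type u} [Field k] {G : Subgroup SL(2, k)} {e : ℕ} (a : Fin e → invariantRing G)

local notation "U" => (MvPowerSeries.X 0 : Pow k)
local notation "V" => (MvPowerSeries.X 1 : Pow k)

lemma twistMap_mkQ_eq_zero {t : Twist G (Pow k)} :
    twistMap G (LinearMap.range (genMap a)).mkQ t = 0 ↔
      ∀ i, t i ∈ LinearMap.range (genMap a) :=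
  ⟨fun h i => (Submodule.Quotient.mk_eq_zero _).1 (congrFun h i),
    fun h => funext fun i => (Submodule.Quotient.mk_eq_zero _).2 (h i)⟩

lemma exists_koszulMap_fiber : ∃ d : Twist G (Fiber a) →ₗ[MonoidAlgebra k G] Fiber a,
    ∀ t, d (twistMap G (Submodule.mkQ _) t) = Submodule.mkQ _ (koszulMap G t) := by
  refine exists_comp_eq (twistMap G (LinearMap.range (genMap a)).mkQ)
    (twistMap_surjective G _ (Submodule.mkQ_surjective _))
    ((LinearMap.range (genMap a)).mkQ ∘ₗ koszulMap G) fun t ht => ?_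
  have h := (twistMap_mkQ_eq_zero a).1 (LinearMap.mem_ker.1 ht)
  exact (Submodule.Quotient.mk_eq_zero _).2
    (add_mem (mul_mem_range a (h 0) _) (mul_mem_range a (h 1) _))

lemma exists_koszulDual_fiber : ∃ d : Fiber a →ₗ[MonoidAlgebra k G] Twist G (Fiber a),
    ∀ t, d (Submodule.mkQ _ t) = twistMap G (Submodule.mkQ _) (koszulDual G t) := by
  refine exists_comp_eq (LinearMap.range (genMap a)).mkQ (Submodule.mkQ_surjective _)
    (twistMap G (LinearMap.range (genMap a)).mkQ ∘ₗ koszulDual G) fun t ht => ?_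
  have h : t ∈ LinearMap.range (genMap a) := (Submodule.Quotient.mk_eq_zero _).1 ht
  refine LinearMap.mem_ker.2 ((twistMap_mkQ_eq_zero a).2 fun i => ?_)
  fin_cases i
  · exact mul_mem_range a h V
  · exact neg_mem (mul_mem_range a h U)

/-- The map `(s, t) ↦ u s + v t` on pairs of vectors. -/
noncomputable def koszulPi (G : Subgroup SL(2, k)) (e : ℕ) :
    Twist G (Fin e → Pow k) →ₗ[MonoidAlgebra k G] (Fin e → Pow k) :=
  LinearMap.pi fun j => koszulMap G ∘ₗ twistMap G (LinearMap.proj j)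

lemma koszulPi_apply (t : Twist G (Fin e → Pow k)) :
    koszulPi G e t = U • t 0 + V • t 1 := rfl

lemma genMap_koszulPi (t : Twist G (Fin e → Pow k)) :
    genMap a (koszulPi G e t) = U * genMap a (t 0) + V * genMap a (t 1) := by
  rw [koszulPi_apply, map_add, genMap_smul, genMap_smul]

/-- The map `(s, t) ↦ u s + v t` on pairs of relations. -/
noncomputable def relKoszul : Twist G (relMod a) →ₗ[MonoidAlgebra k G] relMod a :=
  LinearMap.codRestrict (relMod a) (koszulPi G e ∘ₗ twistMap G (relMod a).subtype) fun t => by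
    rw [LinearMap.mem_ker, LinearMap.comp_apply, genMap_koszulPi]
    have h : ∀ i, genMap a (twistMap G (relMod a).subtype t i) = 0 := fun i => (t i).2
    rw [h, h, mul_zero, mul_zero, add_zero]

lemma mem_range_relKoszul {s : relMod a} : s ∈ LinearMap.range (relKoszul a) ↔
    ∃ p ∈ relMod a, ∃ q ∈ relMod a, (s : Fin e → Pow k) = U • p + V • q := by
  constructor
  · rintro ⟨t, rfl⟩
    exact ⟨_, (t 0).2, _, (t 1).2, rfl⟩
  · rintro ⟨p, hp, q, hq, h⟩
    exact ⟨(![⟨p, hp⟩, ⟨q, hq⟩] : Fin 2 → relMod a), Subtype.ext h.symm⟩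

lemma koszul_pi {p q : Fin e → Pow k} (h : U • p + V • q = 0) :
    ∃ y : Fin e → Pow k, p = V • y ∧ q = -(U • y) := by
  choose y hy using fun i => koszul (congrFun h i)
  exact ⟨y, funext fun i => (hy i).1, funext fun i => (hy i).2⟩

lemma exists_pi_eq {s : Fin e → Pow k} (h : ∀ i, s i ∈ maxPow k) : ∃ p q : Fin e → Pow k,
    s = U • p + V • q := by
  choose p q hpq using fun i => mem_maxPow.1 (h i)
  exact ⟨p, q, funext hpq⟩

/-- The constant coefficient as a linear map. -/
noncomputable def constLin (k : Type u) [Field k] : Pow k →ₗ[k] k where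
  toFun f := MvPowerSeries.constantCoeff f
  map_add' f g := map_add _ f g
  map_smul' c f := by
    rw [MvPowerSeries.smul_eq_C_mul, map_mul, MvPowerSeries.constantCoeff_C]
    rfl

/-- The constant coefficient as an equivariant map. -/
noncomputable def constMap (G : Subgroup SL(2, k)) : Pow k →ₗ[MonoidAlgebra k G] TrivMod k G :=
  ofCommutes (show Pow k →ₗ[k] TrivMod k G from constLin k) (by
    intro g f
    rw [single_smul_trivMod]
    exact constantCoeff_single_smul G g f)

lemma constMap_eq_zero {f : Pow k} : constMap G f = 0 ↔ f ∈ maxPow k :=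
  (mem_maxPow_iff (f := f)).symm

lemma constLin_surjective : Function.Surjective (constLin k) := fun c =>
  ⟨MvPowerSeries.C (σ := Fin 2) c, MvPowerSeries.constantCoeff_C (σ := Fin 2) c⟩

lemma constMap_surjective : Function.Surjective (constMap G) := fun c =>
  constLin_surjective (k := k) c

variable {a} [Finite G] [NeZero (Nat.card G : k)]

/-- Both sides are Tor₂ of B = S/mS and k over S, computed from the Koszul complex and from the
resolution of B. The comparison T consists of (y, s₀, s₁) with v y = ∑ a_i s₀ᵢ and −u y = ∑ a_i s₁ᵢ.
It maps onto one side by y and onto the other by u s₀ + v s₁, with equal kernels. -/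
lemma IsMinGen.nonempty_socle_equiv (h : IsMinGen a)
    {d : Fiber a →ₗ[MonoidAlgebra k G] Twist G (Fiber a)}
    (hd : ∀ t, d (Submodule.mkQ _ t) = twistMap G (Submodule.mkQ _) (koszulDual G t)) :
    Nonempty (LinearMap.ker d ≃ₗ[MonoidAlgebra k G]
      (relMod a ⧸ LinearMap.range (relKoszul a))) := by
  let T : Submodule (MonoidAlgebra k G) (Pow k × Twist G (Fin e → Pow k)) :=
    LinearMap.ker (koszulDual G ∘ₗ LinearMap.fst _ _ _ -
      twistMap G (genMap a) ∘ₗ LinearMap.snd _ _ _)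
  have hT : ∀ t : Pow k × Twist G (Fin e → Pow k), t ∈ T ↔
      V * t.1 = genMap a (t.2 0) ∧ -(U * t.1) = genMap a (t.2 1) := by
    intro t
    rw [LinearMap.mem_ker, LinearMap.sub_apply, sub_eq_zero]
    constructor
    · exact fun h => ⟨congrFun h 0, congrFun h 1⟩
    · intro h
      funext i
      fin_cases i
      · exact h.1
      · exact h.2
  let f : T →ₗ[MonoidAlgebra k G] LinearMap.ker d :=
    LinearMap.codRestrict _ ((LinearMap.range (genMap a)).mkQ ∘ₗ LinearMap.fst _ _ _ ∘ₗ T.subtype)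
      fun t => by
        rw [LinearMap.mem_ker]
        change d (Submodule.mkQ _ t.1.1) = 0
        rw [hd, twistMap_mkQ_eq_zero]
        obtain ⟨h0, h1⟩ := (hT _).1 t.2
        intro i
        fin_cases i
        · exact ⟨_, h0.symm⟩
        · exact ⟨_, h1.symm⟩
  let p : T →ₗ[MonoidAlgebra k G] relMod a :=
    LinearMap.codRestrict _ (koszulPi G e ∘ₗ LinearMap.snd _ _ _ ∘ₗ T.subtype) fun t => by
      obtain ⟨h0, h1⟩ := (hT _).1 t.2
      rw [LinearMap.mem_ker]
      change genMap a (koszulPi G e t.1.2) = 0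
      rw [genMap_koszulPi, ← h0, ← h1]
      ring
  have hf : Function.Surjective f := by
    rintro ⟨y, hy⟩
    obtain ⟨y, rfl⟩ := Submodule.mkQ_surjective _ y
    rw [LinearMap.mem_ker, hd, twistMap_mkQ_eq_zero] at hy
    choose s hs using hy
    refine ⟨⟨(y, s), (hT _).2 ⟨(hs 0).symm, (hs 1).symm⟩⟩, rfl⟩
  have hp : Function.Surjective p := by
    rintro ⟨s, hs⟩
    obtain ⟨q₀, q₁, hq⟩ := exists_pi_eq (h.relMod_mem hs)
    have hs' := LinearMap.mem_ker.1 hs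
    rw [hq, map_add, genMap_smul, genMap_smul] at hs'
    obtain ⟨y, hy0, hy1⟩ := koszul hs'
    exact ⟨⟨(y, (![q₀, q₁] : Fin 2 → Fin e → Pow k)), (hT _).2 ⟨hy0.symm, hy1.symm⟩⟩,
      Subtype.ext hq.symm⟩
  refine nonempty_equiv_of_ker_eq f hf ((LinearMap.range (relKoszul a)).mkQ ∘ₗ p)
    ((Submodule.mkQ_surjective _).comp hp) ?_
  ext t
  obtain ⟨h0, h1⟩ := (hT _).1 t.2
  rw [LinearMap.mem_ker, LinearMap.mem_ker, LinearMap.comp_apply, Submodule.mkQ_apply,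
    Submodule.Quotient.mk_eq_zero, mem_range_relKoszul]
  have h2 : f t = 0 ↔ t.1.1 ∈ LinearMap.range (genMap a) :=
    ⟨fun h => (Submodule.Quotient.mk_eq_zero _).1 (congrArg Subtype.val h),
      fun h => Subtype.ext ((Submodule.Quotient.mk_eq_zero _).2 h)⟩
  have h3 : (p t : Fin e → Pow k) = U • t.1.2 0 + V • t.1.2 1 := rfl
  rw [h2, h3]
  constructor
  · rintro ⟨s₀, hs₀⟩
    refine ⟨t.1.2 0 - V • s₀, ?_, t.1.2 1 + U • s₀, ?_, ?_⟩
    · rw [LinearMap.mem_ker, map_sub, genMap_smul, hs₀, h0, sub_self]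
    · rw [LinearMap.mem_ker, map_add, genMap_smul, hs₀, ← h1, neg_add_cancel]
    · rw [smul_sub, smul_add, smul_smul, smul_smul, mul_comm V U]
      abel
  · rintro ⟨p₀, hp₀, q₀, hq₀, hpq⟩
    obtain ⟨s₀, hs₀, -⟩ := koszul_pi (p := t.1.2 0 - p₀) (q := t.1.2 1 - q₀) (by
      rw [smul_sub, smul_sub, sub_add_sub_comm, hpq, sub_self])
    refine ⟨s₀, mul_left_cancel₀ (X_ne_zero' (k := k) 1) ?_⟩
    rw [h0, ← genMap_smul, ← hs₀, map_sub, LinearMap.mem_ker.1 hp₀, sub_zero]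

set_option maxHeartbeats 800000 in
-- The analogue for Tor₁: T consists of (t, s) with u t₀ + v t₁ = ∑ a_i s_i. Reduction of t modulo
-- the a_i gives the cycles, the constant terms of s give k^e, and the preimage of the boundaries is
-- the set of pairs with s in the maximal ideal.
lemma IsMinGen.nonempty_homology_equiv (h : IsMinGen a)
    {d₂ : Fiber a →ₗ[MonoidAlgebra k G] Twist G (Fiber a)}
    (hd₂ : ∀ t, d₂ (Submodule.mkQ _ t) = twistMap G (Submodule.mkQ _) (koszulDual G t))
    {d₁ : Twist G (Fiber a) →ₗ[MonoidAlgebra k G] Fiber a}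
    (hd₁ : ∀ t, d₁ (twistMap G (Submodule.mkQ _) t) = Submodule.mkQ _ (koszulMap G t)) :
    Nonempty ((LinearMap.ker d₁ ⧸ (LinearMap.range d₂).submoduleOf (LinearMap.ker d₁))
      ≃ₗ[MonoidAlgebra k G] (Fin e → TrivMod k G)) := by
  let T : Submodule (MonoidAlgebra k G) (Twist G (Pow k) × (Fin e → Pow k)) :=
    LinearMap.ker (koszulMap G ∘ₗ LinearMap.fst _ _ _ - genMap a ∘ₗ LinearMap.snd _ _ _)
  have hT : ∀ t : Twist G (Pow k) × (Fin e → Pow k), t ∈ T ↔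
      U * t.1 0 + V * t.1 1 = genMap a t.2 := by
    intro t
    rw [LinearMap.mem_ker, LinearMap.sub_apply, sub_eq_zero]
    rfl
  let f : T →ₗ[MonoidAlgebra k G] LinearMap.ker d₁ :=
    LinearMap.codRestrict _ (twistMap G (LinearMap.range (genMap a)).mkQ ∘ₗ
      LinearMap.fst _ _ _ ∘ₗ T.subtype) fun t => by
        rw [LinearMap.mem_ker]
        change d₁ (twistMap G (Submodule.mkQ _) t.1.1) = 0
        rw [hd₁, koszulMap_apply, (hT _).1 t.2]
        exact (Submodule.Quotient.mk_eq_zero _).2 ⟨_, rfl⟩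
  let p : T →ₗ[MonoidAlgebra k G] (Fin e → TrivMod k G) :=
    (LinearMap.pi fun i => constMap G ∘ₗ LinearMap.proj i) ∘ₗ LinearMap.snd _ _ _ ∘ₗ T.subtype
  have hf : Function.Surjective f := by
    rintro ⟨y, hy⟩
    obtain ⟨t, rfl⟩ := twistMap_surjective G _ (Submodule.mkQ_surjective _) y
    rw [LinearMap.mem_ker, hd₁] at hy
    obtain ⟨s, hs⟩ := (Submodule.Quotient.mk_eq_zero _).1 hy
    exact ⟨⟨(t, s), (hT _).2 hs.symm⟩, rfl⟩
  have hp : Function.Surjective p := by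
    intro c
    choose s hs using fun i => constMap_surjective (c i)
    obtain ⟨t₀, t₁, ht⟩ := mem_maxPow.1 (h.range_le ⟨s, rfl⟩)
    exact ⟨⟨((![t₀, t₁] : Fin 2 → Pow k), s), (hT _).2 ht.symm⟩, funext hs⟩
  refine nonempty_equiv_of_ker_eq
    (((LinearMap.range d₂).submoduleOf (LinearMap.ker d₁)).mkQ ∘ₗ f) ((Submodule.mkQ_surjective _).comp hf)
    p hp ?_
  ext t
  have ht := (hT _).1 t.2
  have h1 : ((LinearMap.range d₂).submoduleOf (LinearMap.ker d₁)).mkQ (f t) = 0 ↔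
      twistMap G (LinearMap.range (genMap a)).mkQ t.1.1 ∈ LinearMap.range d₂ :=
    Submodule.Quotient.mk_eq_zero _
  have h2 : p t = 0 ↔ ∀ i, t.1.2 i ∈ maxPow k :=
    ⟨fun h i => (constMap_eq_zero (G := G) (f := t.1.2 i)).1 (congrFun h i), fun h =>
      funext fun i => (constMap_eq_zero (G := G) (f := t.1.2 i)).2 (h i)⟩
  rw [LinearMap.mem_ker, LinearMap.mem_ker, h2, LinearMap.comp_apply, h1]
  constructor
  · rintro ⟨y, hy⟩
    obtain ⟨y, rfl⟩ := Submodule.mkQ_surjective _ y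
    rw [hd₂] at hy
    have h4 : ∀ i, t.1.1 i - koszulDual G y i ∈ LinearMap.range (genMap a) := fun i =>
      (Submodule.Quotient.eq _).1 (congrFun hy.symm i)
    choose s hs using h4
    have h5 : t.1.2 - (U • s 0 + V • s 1) ∈ relMod a := by
      rw [LinearMap.mem_ker, map_sub, map_add, genMap_smul, genMap_smul, hs, hs, ← ht,
        koszulDual_zero, koszulDual_one]
      ring
    intro i
    have h6 := Ideal.add_mem _ (h.relMod_mem h5 i) (mem_maxPow.2 ⟨s 0 i, s 1 i, rfl⟩)
    have h7 : (t.1.2 - (U • s 0 + V • s 1)) i + (U * s 0 i + V * s 1 i) = t.1.2 i :=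
      sub_add_cancel _ _
    rwa [h7] at h6
  · intro hs
    obtain ⟨p₀, p₁, hp⟩ := exists_pi_eq hs
    rw [hp, map_add, genMap_smul, genMap_smul] at ht
    obtain ⟨y, hy0, hy1⟩ := koszul (p := t.1.1 0 - genMap a p₀) (q := t.1.1 1 - genMap a p₁) (by
      linear_combination ht)
    refine ⟨Submodule.mkQ _ y, ?_⟩
    rw [hd₂]
    funext i
    refine ((Submodule.Quotient.eq _).2 ?_ : (Submodule.Quotient.mk (koszulDual G y i) : Fiber a) =
      Submodule.Quotient.mk (t.1.1 i))
    fin_cases i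
    · refine ⟨-p₀, ?_⟩
      change genMap a (-p₀) = V * y - t.1.1 0
      rw [← hy0, map_neg]
      ring
    · refine ⟨-p₁, ?_⟩
      change genMap a (-p₁) = -(U * y) - t.1.1 1
      rw [← hy1, map_neg]
      ring

lemma IsMinGen.nonempty_cokernel_equiv (h : IsMinGen a)
    {d₁ : Twist G (Fiber a) →ₗ[MonoidAlgebra k G] Fiber a}
    (hd₁ : ∀ t, d₁ (twistMap G (Submodule.mkQ _) t) = Submodule.mkQ _ (koszulMap G t)) :
    Nonempty ((Fiber a ⧸ LinearMap.range d₁) ≃ₗ[MonoidAlgebra k G] TrivMod k G) := by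
  refine nonempty_equiv_of_ker_eq ((LinearMap.range d₁).mkQ ∘ₗ (LinearMap.range (genMap a)).mkQ)
    ((Submodule.mkQ_surjective _).comp (Submodule.mkQ_surjective _)) (constMap G)
    constMap_surjective ?_
  ext f
  rw [LinearMap.mem_ker, LinearMap.mem_ker, LinearMap.comp_apply, Submodule.mkQ_apply,
    Submodule.Quotient.mk_eq_zero, constMap_eq_zero]
  constructor
  · rintro ⟨y, hy⟩
    obtain ⟨t, rfl⟩ := twistMap_surjective G _ (Submodule.mkQ_surjective _) y
    rw [hd₁] at hy
    have h1 := h.range_le ((Submodule.Quotient.eq _).1 hy)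
    have h2 : koszulMap G t ∈ maxPow k := mem_maxPow.2 ⟨_, _, rfl⟩
    rwa [Submodule.sub_mem_iff_right _ h2] at h1
  · intro hf
    obtain ⟨p, q, rfl⟩ := mem_maxPow.1 hf
    exact ⟨twistMap G (Submodule.mkQ _) (![p, q] : Fin 2 → Pow k), hd₁ _⟩

variable [IsAlgClosed k]

/-- Euler characteristic of the Koszul complex B → V ⊗ B → B, whose homology is U, e copies of the
trivial module, and one copy. -/
theorem IsMinGen.mult_relation (h : IsMinGen a)
    (c : isotypicComponents (MonoidAlgebra k G) (MonoidAlgebra k G)) :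
    mult k (MonoidAlgebra k G) c (Twist G (Fiber a)) +
        mult k (MonoidAlgebra k G) c (relMod a ⧸ LinearMap.range (relKoszul a)) +
        mult k (MonoidAlgebra k G) c (TrivMod k G) =
      2 * mult k (MonoidAlgebra k G) c (Fiber a) +
        e * mult k (MonoidAlgebra k G) c (TrivMod k G) := by
  have := h.finite_fiber
  obtain ⟨d₂, hd₂⟩ := exists_koszulDual_fiber a
  obtain ⟨d₁, hd₁⟩ := exists_koszulMap_fiber a
  have hpi := homRank_pi k (X := simpleRep (MonoidAlgebra k G) c) (Y := TrivMod k G) (A := MonoidAlgebra k G) e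
  rw [mult, mult, mult, mult, ← hpi]
  refine homRank_complex k d₂ d₁ ?_ (h.nonempty_socle_equiv hd₂)
    (h.nonempty_homology_equiv hd₂ hd₁) (h.nonempty_cokernel_equiv hd₁)
  rintro _ ⟨y, rfl⟩
  obtain ⟨y, rfl⟩ := Submodule.mkQ_surjective _ y
  rw [LinearMap.mem_ker, hd₂, hd₁, koszulMap_apply, koszulDual_zero, koszulDual_one]
  have : U * (V * y) + V * -(U * y) = 0 := by ring
  rw [this, map_zero]

end Complex

end Kleinian

namespace Kleinian

open IsLocalRing

/-! ### Invariants of the fundamental representation -/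

section FixedVectors

variable {k : Type u} [Field k]

/-- A nonzero fixed vector and determinant 1 force trace 2, hence (g − 1)² = 0 and g^n = 1 + n(g −
1). As n is invertible, g = 1. -/
lemma eq_one_of_pow_eq_one {g : SL(2, k)} {n : ℕ} (hg : g ^ n = 1) (hn : (n : k) ≠ 0) {x y : k}
    (hxy : x ≠ 0 ∨ y ≠ 0) (h0 : g.val 0 0 * x + g.val 0 1 * y = x)
    (h1 : g.val 1 0 * x + g.val 1 1 * y = y) : g = 1 := by
  have hdet : g.val 0 0 * g.val 1 1 - g.val 0 1 * g.val 1 0 = 1 := by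
    have := g.2
    rwa [Matrix.det_fin_two] at this
  have htr : g.val 0 0 + g.val 1 1 = 2 := by
    rcases hxy with h | h
    · refine mul_left_cancel₀ h ?_
      linear_combination (g.val 1 1 - 1) * -h0 + g.val 0 1 * h1 - (-x) * hdet
    · refine mul_left_cancel₀ h ?_
      linear_combination g.val 1 0 * h0 - (g.val 0 0 - 1) * h1 + y * hdet
  have hsq : (g.val - 1) * (g.val - 1) = 0 := by
    ext i j
    fin_cases i <;> fin_cases j <;>
      simp [Matrix.mul_apply, Fin.sum_univ_two]
    · linear_combination -hdet + g.val 0 0 * htr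
    · linear_combination g.val 0 1 * htr
    · linear_combination g.val 1 0 * htr
    · linear_combination -hdet + g.val 1 1 * htr
  have hpow : ∀ m : ℕ, g.val ^ m = 1 + (m : k) • (g.val - 1) := by
    intro m
    induction m with
    | zero => simp
    | succ m ih =>
      have h2 : g.val = 1 + (g.val - 1) := by abel
      rw [pow_succ, ih]
      conv_lhs => rw [h2]
      rw [add_sub_cancel_left, add_mul, one_mul, smul_mul_assoc, mul_add, mul_one, hsq, add_zero,
        Nat.cast_succ]
      module
  have h3 := hpow n
  have h4 : g.val ^ n = 1 := congrArg Subtype.val hg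
  rw [h4, left_eq_add, smul_eq_zero] at h3
  exact Subtype.ext (sub_eq_zero.1 (h3.resolve_left hn))

variable (G : Subgroup SL(2, k)) [Finite G] [NeZero (Nat.card G : k)] [Nontrivial G]

lemma eq_zero_of_fixed {c : Twist G (TrivMod k G)}
    (hc : ∀ g : G, MonoidAlgebra.single g (1 : k) • c = c) : c = 0 := by
  obtain ⟨g, hg⟩ := exists_ne (1 : G)
  by_contra hne
  have h : ∀ i, (g : SL(2, k)).val i 0 • c 0 + (g : SL(2, k)).val i 1 • c 1 = c i := fun i => by
    have := congrFun (hc g) i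
    rwa [single_smul_twist_two, single_smul_trivMod, single_smul_trivMod] at this
  refine hg (Subtype.ext (eq_one_of_pow_eq_one (n := Nat.card G) ?_ (NeZero.ne _)
    (x := (show k from c 0)) (y := (show k from c 1)) ?_ (h 0) (h 1)))
  · have h1 : g ^ Nat.card G = 1 := pow_card_eq_one'
    exact congrArg Subtype.val h1
  · by_contra h2
    push Not at h2
    refine hne (funext fun i => ?_)
    fin_cases i
    · exact h2.1
    · exact h2.2

lemma homRank_trivMod_twist : homRank k (MonoidAlgebra k G) (TrivMod k G)
    (Twist G (TrivMod k G)) = 0 := by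
  rw [homRank_trivMod]
  have : fixedPart k G (Twist G (TrivMod k G)) = ⊥ :=
    eq_bot_iff.2 fun c hc => (Submodule.mem_bot k).2 (eq_zero_of_fixed G hc)
  rw [this, finrank_bot]

local notation "U" => (MvPowerSeries.X 0 : Pow k)
local notation "V" => (MvPowerSeries.X 1 : Pow k)

/-- The constant terms of an invariant lift form a fixed vector of k², which is zero. So every
invariant without constant term has order at least 2. -/
lemma exists_eq_of_mem_maximalIdeal {r : invariantRing G}
    (hr : r ∈ maximalIdeal (invariantRing G)) : ∃ p ∈ maxPow k, ∃ q ∈ maxPow k,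
      (r : Pow k) = U * p + V * q := by
  obtain ⟨t, ht, h⟩ := exists_fixed_lift G r hr
  have h0 : twistMap G (constMap G) t = 0 := eq_zero_of_fixed G fun g => by rw [← map_smul, ht g]
  exact ⟨t 0, constMap_eq_zero.1 (congrFun h0 0), t 1, constMap_eq_zero.1 (congrFun h0 1), h⟩

end FixedVectors

section Section

lemma exists_section {A X Y : Type u} [Ring A] [IsSemisimpleRing A] [AddCommGroup X]
    [AddCommGroup Y] [Module A X] [Module A Y] (f : X →ₗ[A] Y) (hf : Function.Surjective f) :
    ∃ s : Y →ₗ[A] X, ∀ y, f (s y) = y := by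
  obtain ⟨q, hq⟩ := exists_isCompl (LinearMap.ker f)
  refine ⟨q.subtype ∘ₗ (Submodule.quotientEquivOfIsCompl _ q hq).toLinearMap ∘ₗ
    (f.quotKerEquivOfSurjective hf).symm.toLinearMap, fun y => ?_⟩
  obtain ⟨x, rfl⟩ := (f.quotKerEquivOfSurjective hf).surjective y
  simp only [LinearMap.comp_apply, LinearEquiv.coe_coe, LinearEquiv.symm_apply_apply]
  obtain ⟨⟨z, hz⟩, rfl⟩ := (Submodule.quotientEquivOfIsCompl _ q hq).symm.surjective x
  rw [LinearEquiv.apply_symm_apply]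
  rfl

end Section

/-! ### Invariants of the fiber and of the top of the module of relations -/

section Fiber

variable {k : Type u} [Field k] {G : Subgroup SL(2, k)} {e : ℕ} {a : Fin e → invariantRing G}

local notation "U" => (MvPowerSeries.X 0 : Pow k)
local notation "V" => (MvPowerSeries.X 1 : Pow k)

lemma IsMinGen.mkQ_one_ne_zero (h : IsMinGen a) :
    ((LinearMap.range (genMap a)).mkQ 1 : Fiber a) ≠ 0 := by
  intro h1
  have h2 := mem_maxPow_iff.1 (h.range_le ((Submodule.Quotient.mk_eq_zero _).1 h1))
  simp at h2

variable (a) in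
/-- The generators of the module of relations. -/
abbrev RelTop : Type u := relMod a ⧸ LinearMap.range (relKoszul a)

variable [Finite G] [NeZero (Nat.card G : k)]

lemma IsMinGen.exists_smul_one (h : IsMinGen a) {x : Fiber a}
    (hx : ∀ g : G, MonoidAlgebra.single g (1 : k) • x = x) :
    ∃ c : k, c • (LinearMap.range (genMap a)).mkQ 1 = x := by
  obtain ⟨f, rfl⟩ := Submodule.mkQ_surjective _ x
  have h1 := average_smul_eq hx
  rw [← map_smul, ← coe_reynolds] at h1
  refine ⟨MvPowerSeries.constantCoeff (reynolds G f : Pow k), ?_⟩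
  rw [← h1, ← LinearMap.map_smul_of_tower]
  refine ((Submodule.Quotient.eq _).2 ?_).symm
  have h2 := h.coe_mem_range (exists_sub_mem_maximalIdeal G (reynolds G f))
  rwa [← Algebra.algebraMap_eq_smul_one]

lemma IsMinGen.homRank_fiber (h : IsMinGen a) :
    homRank k (MonoidAlgebra k G) (TrivMod k G) (Fiber a) = 1 := by
  rw [homRank_trivMod]
  have hone : (LinearMap.range (genMap a)).mkQ 1 ∈ fixedPart k G (Fiber a) := fun g => by
    rw [← map_smul, single_smul_pow, map_one]
  refine (finrank_eq_one_iff_of_nonzero' (⟨_, hone⟩ : fixedPart k G (Fiber a)) ?_).2 fun x => ?_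
  · exact fun h0 => h.mkQ_one_ne_zero (congrArg Subtype.val h0)
  · obtain ⟨c, hc⟩ := h.exists_smul_one x.2
    exact ⟨c, Subtype.ext hc⟩

variable [Infinite k]

lemma IsMinGen.finite_relTop (h : IsMinGen a) : Module.Finite k (RelTop a) := by
  have := h.finite_fiber
  obtain ⟨d, hd⟩ := exists_koszulDual_fiber a
  obtain ⟨E⟩ := h.nonempty_socle_equiv hd
  have := finite_submodule k (MonoidAlgebra k G) (LinearMap.ker d)
  exact Module.Finite.equiv (E.restrictScalars k)

/-- The module is isomorphic to the socle of the fiber, a nonzero ring whose maximal ideal is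
nilpotent. -/
lemma IsMinGen.nontrivial_relTop (h : IsMinGen a) : Nontrivial (RelTop a) := by
  obtain ⟨d, hd⟩ := exists_koszulDual_fiber a
  obtain ⟨E⟩ := h.nonempty_socle_equiv hd
  obtain ⟨j, hj⟩ := h.exists_pow_le
  let I : Ideal (Pow k) :=
    { carrier := LinearMap.range (genMap a)
      add_mem' := add_mem
      zero_mem' := zero_mem _
      smul_mem' := fun c x hx => mul_mem_range a hx c }
  have hI : ∀ x, x ∈ I ↔ x ∈ LinearMap.range (genMap a) := fun x => Iff.rfl
  obtain ⟨s, hs, hs'⟩ := exists_mul_socle (I := I) (j := j) hj (y := 1) (fun h1 => by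
    have := mem_maxPow_iff.1 (h.range_le h1)
    simp at this)
  rw [mul_one] at hs hs'
  have hmem : ((LinearMap.range (genMap a)).mkQ s : Fiber a) ∈ LinearMap.ker d := by
    rw [LinearMap.mem_ker, hd, twistMap_mkQ_eq_zero]
    intro i
    fin_cases i
    · exact hs' V (mem_maxPow_iff.2 (by simp))
    · exact neg_mem (hs' U (mem_maxPow_iff.2 (by simp)))
  refine ⟨E ⟨_, hmem⟩, 0, fun h0 => hs ?_⟩
  rw [LinearEquiv.map_eq_zero_iff] at h0
  exact (Submodule.Quotient.mk_eq_zero _).1 (congrArg Subtype.val h0)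

variable [Nontrivial G]

/-- The a_i have order at least 2, so they generate no power series with a nonzero linear term. -/
lemma IsMinGen.X_zero_notMem (h : IsMinGen a) : U ∉ LinearMap.range (genMap a) := by
  rintro ⟨s, hs⟩
  choose p hp q hq hpq using fun i => exists_eq_of_mem_maximalIdeal G (h.mem i)
  rw [genMap_apply] at hs
  have h1 : U * (∑ i, p i * s i - 1) + V * ∑ i, q i * s i = 0 := by
    have : ∑ i, (a i : Pow k) * s i = U * ∑ i, p i * s i + V * ∑ i, q i * s i := by
      rw [Finset.mul_sum, Finset.mul_sum, ← Finset.sum_add_distrib]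
      refine Finset.sum_congr rfl fun i _ => ?_
      rw [hpq]
      ring
    linear_combination hs - this
  obtain ⟨y, hy, -⟩ := koszul h1
  have h2 : ∑ i, p i * s i ∈ maxPow k :=
    Ideal.sum_mem _ fun i _ => Ideal.mul_mem_right _ _ (hp i)
  have h3 := congrArg MvPowerSeries.constantCoeff hy
  rw [map_sub, mem_maxPow_iff.1 h2] at h3
  simp at h3

/-- Under the isomorphism with the socle of the fiber, an invariant becomes a constant. A nonzero
constant in the socle would put u into the ideal generated by the a_i. -/
lemma IsMinGen.eq_zero_of_fixed (h : IsMinGen a) {x : RelTop a}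
    (hx : ∀ g : G, MonoidAlgebra.single g (1 : k) • x = x) : x = 0 := by
  obtain ⟨d, hd⟩ := exists_koszulDual_fiber a
  obtain ⟨E⟩ := h.nonempty_socle_equiv hd
  obtain ⟨⟨y, hy⟩, rfl⟩ := E.surjective x
  have h1 : ∀ g : G, MonoidAlgebra.single g (1 : k) • y = y := fun g => by
    have := hx g
    rw [← map_smul] at this
    exact congrArg Subtype.val (E.injective this)
  obtain ⟨c, rfl⟩ := h.exists_smul_one h1
  rw [LinearEquiv.map_eq_zero_iff]
  refine Subtype.ext ?_
  by_contra hne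
  have hc : c ≠ 0 := fun h0 => hne (by simp [h0])
  rw [LinearMap.mem_ker, ← LinearMap.map_smul_of_tower, hd, twistMap_mkQ_eq_zero] at hy
  have h2 : -(U * c • 1) ∈ LinearMap.range (genMap a) := hy 1
  rw [neg_mem_iff, mul_smul_comm, mul_one] at h2
  have h3 := (LinearMap.range (genMap a)).smul_of_tower_mem c⁻¹ h2
  rw [smul_smul, inv_mul_cancel₀ hc, one_smul] at h3
  exact h.X_zero_notMem h3

lemma IsMinGen.homRank_relTop (h : IsMinGen a) :
    homRank k (MonoidAlgebra k G) (TrivMod k G) (RelTop a) = 0 := by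
  rw [homRank_trivMod]
  have : fixedPart k G (RelTop a) = ⊥ :=
    eq_bot_iff.2 fun c hc => (Submodule.mem_bot k).2 (h.eq_zero_of_fixed hc)
  rw [this, finrank_bot]

end Fiber

/-! ### Freeness of the module of relations -/

section Basis

instance (k : Type u) [Field k] : IsDomain (Pow k) := NoZeroDivisors.to_isDomain _

variable {k : Type u} [Field k] {G : Subgroup SL(2, k)} {e : ℕ} {a : Fin e → invariantRing G}

local notation "U" => (MvPowerSeries.X 0 : Pow k)
local notation "V" => (MvPowerSeries.X 1 : Pow k)

variable (a) in
/-- The map `s ↦ ∑ a_i s_i` as a linear map over the power series ring. -/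
noncomputable def genMapPow : (Fin e → Pow k) →ₗ[Pow k] Pow k where
  toFun := genMap a
  map_add' := map_add _
  map_smul' := genMap_smul a

lemma finrank_ker_genMapPow {i : Fin e} (hi : a i ≠ 0) :
    Module.finrank (Pow k) (LinearMap.ker (genMapPow a)) + 1 = e := by
  have h1 := Submodule.finrank_quotient_add_finrank (LinearMap.ker (genMapPow a))
  rw [LinearEquiv.finrank_eq (genMapPow a).quotKerEquivRange, Module.finrank_fin_fun] at h1
  have h2 : Module.finrank (Pow k) (LinearMap.range (genMapPow a)) ≤ 1 := by
    rw [← Module.finrank_self (Pow k)]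
    exact Submodule.finrank_le _
  have h3 : 0 < Module.finrank (Pow k) (LinearMap.range (genMapPow a)) := by
    have : Nontrivial (LinearMap.range (genMapPow a)) := by
      refine ⟨⟨_, Pi.single i 1, rfl⟩, 0, fun h => hi (Subtype.ext ?_)⟩
      have h4 : genMap a (Pi.single i 1) = 0 := congrArg Subtype.val h
      rw [genMap_apply] at h4
      simpa [Pi.single_apply] using h4
    exact Module.finrank_pos
  lia

/-- Lifts of a basis of `RelTop a` form a basis of the module of relations. -/
theorem exists_basis_relMod {d : ℕ} (hd : d + 1 = e) {i : Fin e} (hi : a i ≠ 0)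
    (b : Module.Basis (Fin d) k (RelTop a)) (s : RelTop a →ₗ[MonoidAlgebra k G] relMod a)
    (hs : ∀ x, (LinearMap.range (relKoszul a)).mkQ (s x) = x) :
    ∃ B : Module.Basis (Fin d) (Pow k) (LinearMap.ker (genMapPow a)),
      ∀ j, (B j : Fin e → Pow k) = s (b j) := by
  let w : Fin d → LinearMap.ker (genMapPow a) := fun j => ⟨s (b j), (s (b j)).2⟩
  -- Nakayama: the w_j generate the relations modulo (u, v) times the relations.
  have hspan : ⊤ ≤ Submodule.span (Pow k) (Set.range w) := by
    refine Submodule.le_of_le_smul_of_le_jacobson_bot (I := maxPow k)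
      (IsNoetherian.noetherian _) ?_ ?_
    · rw [IsLocalRing.jacobson_eq_maximalIdeal ⊥ bot_ne_top]
      intro f hf
      rw [mem_maximalIdeal, mem_nonunits_iff, MvPowerSeries.isUnit_iff_constantCoeff,
        mem_maxPow_iff.1 hf]
      exact not_isUnit_zero
    · rintro ⟨x, hx⟩ -
      have hx' : x ∈ relMod a := hx
      let y : RelTop a := (LinearMap.range (relKoszul a)).mkQ ⟨x, hx'⟩
      have h1 : (⟨x, hx'⟩ - s y : relMod a) ∈ LinearMap.range (relKoszul a) := by
        rw [← Submodule.Quotient.mk_eq_zero, ← Submodule.mkQ_apply, map_sub, hs, sub_self]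
      obtain ⟨p, hp, q, hq, hpq⟩ := (mem_range_relKoszul a).1 h1
      have h2 : (⟨s y, (s y).2⟩ : LinearMap.ker (genMapPow a)) =
          ∑ j, algebraMap k (Pow k) (b.repr y j) • w j := by
        refine Subtype.ext ?_
        have h3 : s y = ∑ j, b.repr y j • s (b j) := by
          conv_lhs => rw [← b.sum_repr y]
          rw [map_sum]
          exact Finset.sum_congr rfl fun j _ => LinearMap.map_smul_of_tower s _ _
        change ((s y : relMod a) : Fin e → Pow k) = _
        rw [h3]
        push_cast
        refine Finset.sum_congr rfl fun j _ => ?_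
        rw [algebraMap_smul]
      have h4 : (⟨x, hx⟩ : LinearMap.ker (genMapPow a)) =
          ∑ j, algebraMap k (Pow k) (b.repr y j) • w j +
            (U • ⟨p, hp⟩ + V • ⟨q, hq⟩ : LinearMap.ker (genMapPow a)) := by
        rw [← h2]
        exact Subtype.ext (eq_add_of_sub_eq' hpq)
      rw [h4]
      refine Submodule.add_mem_sup (Submodule.sum_mem _ fun j _ => Submodule.smul_mem _ _
        (Submodule.subset_span ⟨j, rfl⟩)) (Submodule.add_mem _ ?_ ?_)
      · exact Submodule.smul_mem_smul (Ideal.subset_span (by simp)) trivial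
      · exact Submodule.smul_mem_smul (Ideal.subset_span (by simp)) trivial
  -- The number of generators d equals the rank e − 1, so they are independent.
  have hli : LinearIndependent (Pow k) w := by
    refine linearIndependent_of_top_le_span_of_card_eq_finrank hspan ?_
    have := finrank_ker_genMapPow hi
    rw [Fintype.card_fin]
    lia
  refine ⟨Module.Basis.mk hli hspan, fun j => ?_⟩
  rw [Module.Basis.mk_apply]

end Basis

end Kleinian

namespace Kleinian

open IsLocalRing

/-! ### Faithfulness of the action on S -/

section Action

variable {k : Type u} [Field k]

lemma eq_zero_of_smul_X_add {c d : k}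
    (h : c • (MvPowerSeries.X 0 : Pow k) + d • MvPowerSeries.X 1 = 0) : c = 0 ∧ d = 0 := by
  have h0 := congrArg (MvPowerSeries.coeff (Finsupp.single 0 1)) h
  have h1 := congrArg (MvPowerSeries.coeff (Finsupp.single 1 1)) h
  simp [MvPowerSeries.coeff_index_single_X] at h0 h1
  exact ⟨h0, h1⟩

/-- Distinct group elements define distinct automorphisms. -/
lemma linSubst_left_injective : Function.Injective
    (fun g : SL(2, k) => ((linSubst g : Pow k →ₐ[k] Pow k) : Pow k →* Pow k)) := by
  intro g h hgh
  refine Subtype.ext (Matrix.ext fun i j => ?_)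
  have h1 : linSubst g (MvPowerSeries.X j) = linSubst h (MvPowerSeries.X j) :=
    DFunLike.congr_fun hgh (MvPowerSeries.X j)
  rw [linSubst_X_eq, linSubst_X_eq, ← sub_eq_zero, add_sub_add_comm, ← sub_smul, ← sub_smul] at h1
  obtain ⟨h2, h3⟩ := eq_zero_of_smul_X_add h1
  fin_cases i
  · exact sub_eq_zero.1 h2
  · exact sub_eq_zero.1 h3

end Action

/-! ### Equivariant linear forms on the relations -/

section Extension

variable {k : Type u} [Field k] {G : Subgroup SL(2, k)} {e : ℕ} {a : Fin e → invariantRing G}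

/-- The module of relations as a module over the power series ring. -/
abbrev RelPow (a : Fin e → invariantRing G) : Type u := LinearMap.ker (genMapPow a)

/-- The identification of the two versions of the module of relations. -/
noncomputable def toRelPow : relMod a →ₗ[k] RelPow a where
  toFun x := ⟨x.1, x.2⟩
  map_add' _ _ := rfl
  map_smul' _ _ := rfl

/-- The inverse of `toRelPow`. -/
def ofRelPow (x : RelPow a) : relMod a := ⟨x.1, x.2⟩

lemma toRelPow_ofRelPow (x : RelPow a) : toRelPow (ofRelPow x) = x := rfl

lemma ofRelPow_toRelPow (x : relMod a) : ofRelPow (toRelPow x) = x := rfl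

lemma toRelPow_single_smul_smul (g : G) (f : Pow k) (x : RelPow a) :
    toRelPow (MonoidAlgebra.single g (1 : k) • ofRelPow (f • x)) =
      linSubst (g : SL(2, k)) f • toRelPow (MonoidAlgebra.single g (1 : k) • ofRelPow x) := by
  refine Subtype.ext (funext fun i => ?_)
  change MonoidAlgebra.single g (1 : k) • (f * x.1 i) =
    linSubst (g : SL(2, k)) f * MonoidAlgebra.single g (1 : k) • x.1 i
  rw [single_smul_mul, single_smul_pow G g f]

/-- Equivariance of a linear form on the module of relations. -/
def IsEquivariant (H : RelPow a →ₗ[Pow k] Pow k) : Prop :=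
  ∀ (g : G) (x : RelPow a), H (toRelPow (MonoidAlgebra.single g (1 : k) • ofRelPow x)) =
    MonoidAlgebra.single g (1 : k) • H x

lemma exists_equivariant_extension {d : ℕ} (b : Module.Basis (Fin d) k (RelTop a))
    (s : RelTop a →ₗ[MonoidAlgebra k G] relMod a) (B : Module.Basis (Fin d) (Pow k) (RelPow a))
    (hB : ∀ j, (B j : Fin e → Pow k) = s (b j)) (h : RelTop a →ₗ[MonoidAlgebra k G] Pow k) :
    ∃ H : RelPow a →ₗ[Pow k] Pow k, (∀ x, H (toRelPow (s x)) = h x) ∧ IsEquivariant H := by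
  let H : RelPow a →ₗ[Pow k] Pow k := B.constr (Pow k) fun j => h (b j)
  have hB' : ∀ j, B j = toRelPow (s (b j)) := fun j => Subtype.ext (hB j)
  have h1 : ∀ x, H (toRelPow (s x)) = h x := by
    have h2 : H.restrictScalars k ∘ₗ toRelPow ∘ₗ s.restrictScalars k = h.restrictScalars k := by
      refine b.ext fun j => ?_
      change H (toRelPow (s (b j))) = h (b j)
      rw [← hB', Module.Basis.constr_basis]
    exact fun x => DFunLike.congr_fun h2 x
  refine ⟨H, h1, fun g x => ?_⟩
  have hx : x ∈ Submodule.span (Pow k) (Set.range B) := B.span_eq ▸ trivial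
  induction hx using Submodule.span_induction with
  | mem x hx =>
    obtain ⟨j, rfl⟩ := hx
    rw [hB', ofRelPow_toRelPow, ← map_smul, h1, h1, map_smul]
  | zero =>
    have h0 : ofRelPow (0 : RelPow a) = 0 := rfl
    rw [h0, smul_zero, map_zero, map_zero, smul_zero]
  | add x y _ _ hx hy =>
    have h0 : ofRelPow (x + y) = ofRelPow x + ofRelPow y := rfl
    rw [h0, smul_add, map_add, map_add, hx, hy, map_add, smul_add]
  | smul f x _ hx =>
    rw [toRelPow_single_smul_smul, map_smul, hx, map_smul, smul_eq_mul, smul_eq_mul,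
      single_smul_mul, single_smul_pow G g f]

variable [Finite G] [NeZero (Nat.card G : k)]

/-- A linear form on the module of relations that vanishes on the invariant relations is zero. -/
lemma eq_zero_of_fixed_eq_zero (H : RelPow a →ₗ[Pow k] Pow k)
    (hH : ∀ x : relMod a, (∀ g : G, MonoidAlgebra.single g (1 : k) • x = x) →
      H (toRelPow x) = 0) : H = 0 := by
  let := Fintype.ofFinite G
  refine LinearMap.ext fun x => ?_
  -- Averaging t • x gives an invariant relation, so ∑ g(t) H(g x) = 0 for every t. Dedekind's
  -- independence of the automorphisms g makes each H(g x) vanish, in particular for g = 1.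
  have hli : LinearIndependent (Pow k) (fun (g : G) (f : Pow k) => linSubst (g : SL(2, k)) f) :=
    (linearIndependent_monoidHom (Pow k) (Pow k)).comp
      (fun g : G => ((linSubst (g : SL(2, k)) : Pow k →ₐ[k] Pow k) : Pow k →* Pow k))
      (linSubst_left_injective.comp Subtype.val_injective)
  rw [Fintype.linearIndependent_iff] at hli
  have h1 := hli (fun g => H (toRelPow (MonoidAlgebra.single g (1 : k) • ofRelPow x))) (by
    funext t
    have h2 := hH (average G • ofRelPow (t • x)) fun g =>
      single_smul_average_smul (Y := relMod a) g _
    rw [average, smul_assoc, Finset.sum_smul, map_smul, map_sum] at h2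
    have h3 : (Nat.card G : k)⁻¹ • H (∑ g : G,
        toRelPow (MonoidAlgebra.single g (1 : k) • ofRelPow (t • x))) = 0 := by
      rw [← h2]
      exact ((H.restrictScalars k).map_smul _ _).symm
    rw [smul_eq_zero, map_sum] at h3
    have h4 := h3.resolve_left (inv_ne_zero (NeZero.ne _))
    rw [Finset.sum_apply, Pi.zero_apply, ← h4]
    refine Finset.sum_congr rfl fun g _ => ?_
    rw [toRelPow_single_smul_smul]
    exact (mul_comm _ _).trans (H.map_smul _ _).symm) 1
  have h5 : toRelPow (MonoidAlgebra.single (1 : G) (1 : k) • ofRelPow x) = x := by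
    rw [← MonoidAlgebra.one_def, one_smul, toRelPow_ofRelPow]
  rw [h5] at h1
  exact h1

end Extension

/-! ### Invariant relations as the second syzygy -/

section Invariants

variable {k : Type u} [Field k] {G : Subgroup SL(2, k)} {e : ℕ} {a : Fin e → invariantRing G}

/-- A relation with invariant coefficients. -/
noncomputable def invariantRel (x : Fin e → invariantRing G) (hx : ∑ i, a i * x i = 0) : relMod a :=
  ⟨fun i => x i, by
    rw [LinearMap.mem_ker, genMap_apply]
    have := congrArg (Subtype.val : invariantRing G → Pow k) hx
    push_cast at this
    exact this⟩

lemma single_smul_invariantRel (x : Fin e → invariantRing G) (hx : ∑ i, a i * x i = 0) (g : G) :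
    MonoidAlgebra.single g (1 : k) • invariantRel x hx = invariantRel x hx :=
  Subtype.ext (funext fun i => single_smul_coe g (x i))

lemma exists_invariantRel_eq {x : relMod a} (hx : ∀ g : G, MonoidAlgebra.single g (1 : k) • x = x) :
    ∃ (y : Fin e → invariantRing G) (hy : ∑ i, a i * y i = 0), x = invariantRel y hy := by
  have h1 : ∀ i, x.1 i ∈ invariantRing G := fun i => mem_invariantRing.2 fun g =>
    congrFun (congrArg Subtype.val (hx g)) i
  refine ⟨fun i => ⟨x.1 i, h1 i⟩, Subtype.ext ?_, rfl⟩
  have := LinearMap.mem_ker.1 x.2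
  rw [genMap_apply] at this
  push_cast
  exact this

variable (φ : (Fin e → invariantRing G) →ₗ[invariantRing G] maximalIdeal (invariantRing G))

lemma sum_eq_zero_of_mem_ker (hφ : ∀ x, (φ x : invariantRing G) = ∑ i, a i * x i) {x : Fin e → invariantRing G} (hx : x ∈ LinearMap.ker φ) :
    ∑ i, a i * x i = 0 := by
  rw [← hφ, LinearMap.mem_ker.1 hx]
  rfl

/-- The restriction of an equivariant form to the invariant relations. -/
noncomputable def restrictForm (hφ : ∀ x, (φ x : invariantRing G) = ∑ i, a i * x i) (H : RelPow a →ₗ[Pow k] Pow k) (hH : IsEquivariant H) :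
    LinearMap.ker φ →ₗ[invariantRing G] invariantRing G where
  toFun x := ⟨H (toRelPow (invariantRel x.1 (sum_eq_zero_of_mem_ker φ hφ x.2))),
    mem_invariantRing.2 fun g => by
      rw [← hH, ofRelPow_toRelPow, single_smul_invariantRel]⟩
  map_add' x y := Subtype.ext (by
    change H (toRelPow (invariantRel x.1 (sum_eq_zero_of_mem_ker φ hφ x.2) +
      invariantRel y.1 (sum_eq_zero_of_mem_ker φ hφ y.2))) = _
    rw [map_add, map_add]
    rfl)
  map_smul' r x := Subtype.ext (by
    change H ((r : Pow k) • toRelPow (invariantRel x.1 (sum_eq_zero_of_mem_ker φ hφ x.2))) = _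
    rw [map_smul]
    rfl)

end Invariants

/-! ### The bound on equivariant maps from the top of the relations to the fiber -/

section Combination

variable {R : Type u} [CommRing R] [IsLocalRing R]

/-- Among two linear forms on the kernel of a surjection from a free module onto the maximal ideal,
a nontrivial combination is given by a vector of coefficients. -/
lemma exists_combination_eq_sum (hR : IsCanonicalModule R 2 R) {e : ℕ}
    (φ : (Fin e → R) →ₗ[R] maximalIdeal R) (hφ : Function.Surjective φ)
    (h₁ h₂ : LinearMap.ker φ →ₗ[R] R) :
    ∃ r₁ r₂ : R, (r₁ ∉ maximalIdeal R ∨ r₂ ∉ maximalIdeal R) ∧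
      ∃ c : Fin e → R, ∀ x, r₁ * h₁ x + r₂ * h₂ x = ∑ i, c i * x.1 i := by
  obtain ⟨r₁, r₂, hr, β, hβ⟩ := exists_combination_extension hR (LinearMap.ker φ).subtype φ
    (Submodule.injective_subtype _) (LinearMap.exact_subtype_ker_map φ) hφ h₁ h₂
  refine ⟨r₁, r₂, hr, fun i => β (Pi.single i 1), fun x => ?_⟩
  refine (DFunLike.congr_fun hβ x).symm.trans ?_
  change β x.1 = _
  conv_lhs => rw [pi_eq_sum_univ' x.1]
  rw [map_sum]
  refine Finset.sum_congr rfl fun i _ => ?_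
  rw [map_smul, smul_eq_mul, mul_comm]

end Combination

section Bound

variable {k : Type u} [Field k]

lemma finrank_le_of_dependent {E : Type u} [AddCommGroup E] [Module k E] [Module.Finite k E] {e : ℕ}
    (ρ : Fin e → E) (h : ∀ x y : E, ∃ c d : k, (c ≠ 0 ∨ d ≠ 0) ∧
      c • x + d • y ∈ Submodule.span k (Set.range ρ)) : Module.finrank k E ≤ e + 1 := by
  set W := Submodule.span k (Set.range ρ) with hW
  have h1 : Module.finrank k W ≤ e := by
    have := finrank_range_le_card (R := k) ρ
    rwa [Fintype.card_fin] at this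
  have h2 : Module.finrank k (E ⧸ W) ≤ 1 := by
    by_cases hz : ∀ y : E ⧸ W, y = 0
    · have : Subsingleton (E ⧸ W) := ⟨fun x y => (hz x).trans (hz y).symm⟩
      rw [Module.finrank_zero_of_subsingleton]
      exact zero_le_one
    · push Not at hz
      obtain ⟨v, hv⟩ := hz
      refine finrank_le_one v fun w => ?_
      obtain ⟨x, rfl⟩ := W.mkQ_surjective v
      obtain ⟨y, rfl⟩ := W.mkQ_surjective w
      obtain ⟨c, d, hcd, hmem⟩ := h x y
      have h3 : c • W.mkQ x + d • W.mkQ y = 0 := by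
        rw [← map_smul, ← map_smul, ← map_add]
        exact (Submodule.Quotient.mk_eq_zero W).2 hmem
      have hd : d ≠ 0 := by
        rintro rfl
        rw [zero_smul, add_zero, smul_eq_zero] at h3
        exact hcd.elim (fun hc => hc (h3.resolve_right hv)) (fun h0 => h0 rfl)
      refine ⟨-(d⁻¹ * c), ?_⟩
      have h4 := congrArg (d⁻¹ • ·) h3
      simp only [smul_add, smul_smul, inv_mul_cancel₀ hd, one_smul, smul_zero] at h4
      rw [neg_smul, neg_eq_iff_add_eq_zero]
      exact h4
  have h3 := Submodule.finrank_quotient_add_finrank W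
  lia

variable {G : Subgroup SL(2, k)} {e : ℕ} {a : Fin e → invariantRing G}

lemma IsMinGen.mkQ_coe_mul (h : IsMinGen a) (r : invariantRing G) (f : Pow k) :
    (LinearMap.range (genMap a)).mkQ ((r : Pow k) * f) =
      MvPowerSeries.constantCoeff (r : Pow k) • (LinearMap.range (genMap a)).mkQ f := by
  rw [← LinearMap.map_smul_of_tower]
  refine (Submodule.Quotient.eq _).2 ?_
  have h2 := mul_mem_range a (h.coe_mem_range (exists_sub_mem_maximalIdeal G r)) f
  rw [Algebra.smul_def, mul_comm, mul_comm _ f, ← mul_sub]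
  exact h2

variable [Finite G] [NeZero (Nat.card G : k)]

/-- The identity holds on invariant relations by `exists_combination_eq_sum`. Both sides are
S-linear, so it holds on all relations by `eq_zero_of_fixed_eq_zero`. -/
lemma exists_equivariant_combination
    (hR : IsCanonicalModule (invariantRing G) 2 (invariantRing G))
    (φ : (Fin e → invariantRing G) →ₗ[invariantRing G] maximalIdeal (invariantRing G))
    (hφ : ∀ x, (φ x : invariantRing G) = ∑ i, a i * x i) (hsurj : Function.Surjective φ)
    (H₁ H₂ : RelPow a →ₗ[Pow k] Pow k) (hH₁ : IsEquivariant H₁) (hH₂ : IsEquivariant H₂) :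
    ∃ r₁ r₂ : invariantRing G,
      (r₁ ∉ maximalIdeal (invariantRing G) ∨ r₂ ∉ maximalIdeal (invariantRing G)) ∧
      ∃ c : Fin e → invariantRing G, ∀ x : RelPow a,
        (r₁ : Pow k) * H₁ x + (r₂ : Pow k) * H₂ x = ∑ i, (c i : Pow k) * x.1 i := by
  obtain ⟨r₁, r₂, hr, c, hc⟩ := exists_combination_eq_sum hR φ hsurj
    (restrictForm φ hφ H₁ hH₁) (restrictForm φ hφ H₂ hH₂)
  refine ⟨r₁, r₂, hr, c, fun x => ?_⟩
  let H : RelPow a →ₗ[Pow k] Pow k := (r₁ : Pow k) • H₁ + (r₂ : Pow k) • H₂ -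
    ∑ i, (c i : Pow k) • (LinearMap.proj i ∘ₗ (LinearMap.ker (genMapPow a)).subtype)
  have hHapp : ∀ x, H x = (r₁ : Pow k) * H₁ x + (r₂ : Pow k) * H₂ x -
      ∑ i, (c i : Pow k) * x.1 i := fun x => by
    simp only [H, LinearMap.sub_apply, LinearMap.add_apply, LinearMap.smul_apply,
      LinearMap.sum_apply, smul_eq_mul]
    rfl
  have hH0 : H = 0 := by
    refine eq_zero_of_fixed_eq_zero H fun x hx => ?_
    obtain ⟨y, hy, rfl⟩ := exists_invariantRel_eq hx
    have hyk : y ∈ LinearMap.ker φ := Subtype.ext ((hφ y).trans hy)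
    have h3 := congrArg (Subtype.val : invariantRing G → Pow k) (hc ⟨y, hyk⟩)
    push_cast at h3
    rw [hHapp, sub_eq_zero]
    exact h3
  rw [← sub_eq_zero, ← hHapp, hH0, LinearMap.zero_apply]

lemma homRank_le_of_dependent {k A X Y : Type u} [Field k] [Ring A] [Algebra k A]
    [AddCommGroup X] [AddCommGroup Y] [Module k X] [Module k Y] [Module A X] [Module A Y]
    [IsScalarTower k A X] [IsScalarTower k A Y] [Module.Finite k X] [Module.Finite k Y] {e : ℕ}
    (ρ : Fin e → (X →ₗ[A] Y)) (h : ∀ h₁ h₂ : X →ₗ[A] Y, ∃ c d : k, (c ≠ 0 ∨ d ≠ 0) ∧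
      ∃ w : Fin e → k, ∀ x, c • h₁ x + d • h₂ x = ∑ i, w i • ρ i x) :
    homRank k A X Y ≤ e + 1 := by
  refine finrank_le_of_dependent ρ fun h₁ h₂ => ?_
  obtain ⟨c, d, hcd, w, hw⟩ := h h₁ h₂
  refine ⟨c, d, hcd, ?_⟩
  have h5 : c • h₁ + d • h₂ = ∑ i, w i • ρ i := by
    refine LinearMap.ext fun x => ?_
    rw [LinearMap.sum_apply]
    exact hw x
  rw [h5]
  exact Submodule.sum_mem _ fun i _ => Submodule.smul_mem _ _ (Submodule.subset_span ⟨i, rfl⟩)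

lemma exists_combination_of_forms
    (hR : IsCanonicalModule (invariantRing G) 2 (invariantRing G))
    (φ : (Fin e → invariantRing G) →ₗ[invariantRing G] maximalIdeal (invariantRing G))
    (hφ : ∀ x, (φ x : invariantRing G) = ∑ i, a i * x i) (hsurj : Function.Surjective φ)
    {d : ℕ} (b : Module.Basis (Fin d) k (RelTop a))
    (s : RelTop a →ₗ[MonoidAlgebra k G] relMod a)
    (B : Module.Basis (Fin d) (Pow k) (RelPow a))
    (hB : ∀ j, (B j : Fin e → Pow k) = s (b j)) (h₁ h₂ : RelTop a →ₗ[MonoidAlgebra k G] Pow k) :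
    ∃ r₁ r₂ : invariantRing G,
      (r₁ ∉ maximalIdeal (invariantRing G) ∨ r₂ ∉ maximalIdeal (invariantRing G)) ∧
      ∃ c : Fin e → invariantRing G, ∀ x : RelTop a,
        (r₁ : Pow k) * h₁ x + (r₂ : Pow k) * h₂ x = ∑ i, (c i : Pow k) * (s x).1 i := by
  choose H hH using exists_equivariant_extension b s B hB
  have h1 := exists_equivariant_combination hR φ hφ hsurj (H h₁) (H h₂) (hH h₁).2 (hH h₂).2
  refine h1.imp fun r₁ h2 => h2.imp fun r₂ h3 => ⟨h3.1, h3.2.imp fun c hc x => ?_⟩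
  rw [← (hH h₁).1, ← (hH h₂).1]
  exact hc (toRelPow (s x))

variable [Infinite k]

/-- By semisimplicity a map from U to the fiber lifts to S, and from there to an equivariant form on
the relations. Any two such forms are dependent modulo the e coordinate forms; reducing the
coefficients to constants leaves at most one dimension beyond the e coordinates. -/
theorem IsMinGen.homRank_relTop_fiber_le (h : IsMinGen a)
    (hR : IsCanonicalModule (invariantRing G) 2 (invariantRing G))
    (φ : (Fin e → invariantRing G) →ₗ[invariantRing G] maximalIdeal (invariantRing G))
    (hφ : ∀ x, (φ x : invariantRing G) = ∑ i, a i * x i) (hsurj : Function.Surjective φ)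
    {d : ℕ} (b : Module.Basis (Fin d) k (RelTop a))
    (s : RelTop a →ₗ[MonoidAlgebra k G] relMod a)
    (B : Module.Basis (Fin d) (Pow k) (RelPow a))
    (hB : ∀ j, (B j : Fin e → Pow k) = s (b j)) :
    homRank k (MonoidAlgebra k G) (RelTop a) (Fiber a) ≤ e + 1 := by
  have := h.finite_fiber
  have := h.finite_relTop
  let ρ : Fin e → (RelTop a →ₗ[MonoidAlgebra k G] Fiber a) := fun i =>
    (LinearMap.range (genMap a)).mkQ ∘ₗ LinearMap.proj i ∘ₗ (relMod a).subtype ∘ₗ s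
  refine homRank_le_of_dependent ρ fun h₁ h₂ => ?_
  obtain ⟨t, ht⟩ := exists_section (LinearMap.range (genMap a)).mkQ (Submodule.mkQ_surjective _)
  obtain ⟨r₁, r₂, hr, c, hc⟩ :=
    exists_combination_of_forms hR φ hφ hsurj b s B hB (t ∘ₗ h₁) (t ∘ₗ h₂)
  refine ⟨MvPowerSeries.constantCoeff (r₁ : Pow k), MvPowerSeries.constantCoeff (r₂ : Pow k), ?_,
    fun i => MvPowerSeries.constantCoeff (c i : Pow k), fun x => ?_⟩
  · rwa [mem_maximalIdeal_iff, mem_maximalIdeal_iff] at hr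
  · have h7 := congrArg (LinearMap.range (genMap a)).mkQ (hc x)
    rw [map_add, map_sum, h.mkQ_coe_mul, h.mkQ_coe_mul, LinearMap.comp_apply,
      LinearMap.comp_apply, ht, ht] at h7
    rw [h7]
    exact Finset.sum_congr rfl fun i _ => h.mkQ_coe_mul _ _

end Bound

end Kleinian

namespace Kleinian

open IsLocalRing

/-! ### From relations to invariant pairs -/

section Pairs

variable {k : Type u} [Field k] {G : Subgroup SL(2, k)} {e : ℕ} {a : Fin e → invariantRing G}

/-- An equivariant identification of the module of relations with `S ⊗ k²` identifies the invariant
relations with the invariant pairs. -/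
lemma nonempty_ker_equiv_of_equivariant
    (φ : (Fin e → invariantRing G) →ₗ[invariantRing G] maximalIdeal (invariantRing G))
    (hφ : ∀ x, (φ x : invariantRing G) = ∑ i, a i * x i)
    (Ψ : (Fin 2 → Pow k) ≃ₗ[Pow k] RelPow a)
    (hΨ : ∀ (g : G) (t : Fin 2 → Pow k),
      toRelPow (MonoidAlgebra.single g (1 : k) • ofRelPow (Ψ t)) =
        Ψ (MonoidAlgebra.single g (1 : k) • (show Twist G (Pow k) from t))) :
    Nonempty (LinearMap.ker φ ≃ₗ[invariantRing G] pairModule G) := by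
  have hmem : ∀ x : LinearMap.ker φ,
      Ψ.symm (toRelPow (invariantRel x.1 (sum_eq_zero_of_mem_ker φ hφ x.2))) ∈ pairModule G := by
    refine fun x => mem_pairModule.2 fun g => Ψ.injective ?_
    refine (hΨ g _).symm.trans ?_
    rw [Ψ.apply_symm_apply, ofRelPow_toRelPow, single_smul_invariantRel]
  let F : LinearMap.ker φ →ₗ[invariantRing G] pairModule G :=
    { toFun := fun x => ⟨_, hmem x⟩
      map_add' := fun x y => Subtype.ext (by
        change Ψ.symm (toRelPow (invariantRel x.1 (sum_eq_zero_of_mem_ker φ hφ x.2)) +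
          toRelPow (invariantRel y.1 (sum_eq_zero_of_mem_ker φ hφ y.2))) = _
        rw [map_add]
        rfl)
      map_smul' := fun r x => Subtype.ext (by
        change Ψ.symm ((r : Pow k) •
          toRelPow (invariantRel x.1 (sum_eq_zero_of_mem_ker φ hφ x.2))) = _
        rw [Ψ.symm.map_smul]
        rfl) }
  refine ⟨LinearEquiv.ofBijective F ⟨fun x y hxy => ?_, fun t => ?_⟩⟩
  · have h1 := congrArg Subtype.val (Ψ.symm.injective (congrArg Subtype.val hxy))
    exact Subtype.ext (funext fun i => Subtype.ext (congrFun h1 i))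
  · have h1 : ∀ g : G, MonoidAlgebra.single g (1 : k) • ofRelPow (Ψ t.1) = ofRelPow (Ψ t.1) := by
      intro g
      have h2 := hΨ g t.1
      rw [mem_pairModule.1 t.2 g] at h2
      exact congrArg ofRelPow h2
    obtain ⟨y, hy, h2⟩ := exists_invariantRel_eq h1
    refine ⟨⟨y, Subtype.ext ((hφ y).trans hy)⟩, Subtype.ext ?_⟩
    change Ψ.symm (toRelPow (invariantRel y hy)) = t.1
    rw [← h2, toRelPow_ofRelPow, Ψ.symm_apply_apply]

/-- The standard basis of `k²` transported to the generators of the module of relations. -/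
noncomputable def basisOfEquiv (Θ : Twist G (TrivMod k G) ≃ₗ[MonoidAlgebra k G] RelTop a) :
    Module.Basis (Fin 2) k (RelTop a) :=
  (Pi.basisFun k (Fin 2)).map
    (show (Fin 2 → k) ≃ₗ[k] RelTop a from Θ.restrictScalars k)

lemma single_smul_basisOfEquiv (Θ : Twist G (TrivMod k G) ≃ₗ[MonoidAlgebra k G] RelTop a) (g : G)
    (j : Fin 2) : MonoidAlgebra.single g (1 : k) • basisOfEquiv Θ j =
      (g : SL(2, k)).val 0 j • basisOfEquiv Θ 0 + (g : SL(2, k)).val 1 j • basisOfEquiv Θ 1 := by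
  let L : (Fin 2 → k) ≃ₗ[k] RelTop a := Θ.restrictScalars k
  have h1 : ∀ i, basisOfEquiv Θ i = L (Pi.single i 1) := fun i => by
    rw [basisOfEquiv, Module.Basis.map_apply, Pi.basisFun_apply]
  have h2 : MonoidAlgebra.single g (1 : k) • basisOfEquiv Θ j =
      L (fun i => (g : SL(2, k)).val i j) := by
    rw [h1]
    refine (Θ.map_smul _ _).symm.trans (congrArg Θ (funext fun i => ?_))
    refine (single_smul_twist_two G g _ i).trans ?_
    refine (congrArg₂ (fun x y : k => (g : SL(2, k)).val i 0 * x + (g : SL(2, k)).val i 1 * y)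
      (single_smul_trivMod g _) (single_smul_trivMod g _)).trans ?_
    fin_cases j <;> simp
  rw [h2, h1, h1, ← map_smul, ← map_smul, ← map_add]
  refine congrArg L (funext fun i => ?_)
  fin_cases i <;> simp

/-- A basis of U on which G acts by its own matrices lifts to an S-basis of the relations with the
same matrices, so coordinates in it are equivariant. -/
lemma nonempty_ker_equiv_of_equiv
    (φ : (Fin e → invariantRing G) →ₗ[invariantRing G] maximalIdeal (invariantRing G))
    (hφ : ∀ x, (φ x : invariantRing G) = ∑ i, a i * x i)
    (Θ : Twist G (TrivMod k G) ≃ₗ[MonoidAlgebra k G] RelTop a)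
    (s : RelTop a →ₗ[MonoidAlgebra k G] relMod a)
    (B : Module.Basis (Fin 2) (Pow k) (RelPow a))
    (hB : ∀ j, (B j : Fin e → Pow k) = s (basisOfEquiv Θ j)) :
    Nonempty (LinearMap.ker φ ≃ₗ[invariantRing G] pairModule G) := by
  refine nonempty_ker_equiv_of_equivariant φ hφ B.equivFun.symm fun g t => ?_
  have hB' : ∀ j, ofRelPow (B j) = s (basisOfEquiv Θ j) := fun j => Subtype.ext (hB j)
  have h1 : ∀ j, toRelPow (MonoidAlgebra.single g (1 : k) • ofRelPow (B j)) =
      (g : SL(2, k)).val 0 j • B 0 + (g : SL(2, k)).val 1 j • B 1 := fun j => by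
    rw [hB', ← map_smul, single_smul_basisOfEquiv]
    have h2 : ∀ c d : k, s (c • basisOfEquiv Θ 0 + d • basisOfEquiv Θ 1) =
        c • ofRelPow (B 0) + d • ofRelPow (B 1) := fun c d => by
      rw [map_add, hB', hB']
      exact congrArg₂ (· + ·) ((s.restrictScalars k).map_smul c _)
        ((s.restrictScalars k).map_smul d _)
    rw [h2]
    rfl
  have h3 : ∀ t : Fin 2 → Pow k, B.equivFun.symm t = t 0 • B 0 + t 1 • B 1 := fun t => by
    rw [Module.Basis.equivFun_symm_apply, Fin.sum_univ_two]
  have hadd : ∀ x y : RelPow a, toRelPow (MonoidAlgebra.single g (1 : k) • ofRelPow (x + y)) =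
      toRelPow (MonoidAlgebra.single g (1 : k) • ofRelPow x) +
      toRelPow (MonoidAlgebra.single g (1 : k) • ofRelPow y) := fun x y => by
    rw [← map_add, ← smul_add]
    rfl
  have h4 : ∀ i, (MonoidAlgebra.single g (1 : k) • (show Twist G (Pow k) from t)) i =
      (g : SL(2, k)).val i 0 • linSubst (g : SL(2, k)) (t 0) +
        (g : SL(2, k)).val i 1 • linSubst (g : SL(2, k)) (t 1) := fun i => by
    rw [single_smul_twist_two, single_smul_pow, single_smul_pow]
  rw [h3, hadd, toRelPow_single_smul_smul, toRelPow_single_smul_smul, h1, h1]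
  refine Eq.trans ?_ (h3 _).symm
  rw [h4, h4]
  refine Subtype.ext (funext fun i => ?_)
  change linSubst (g : SL(2, k)) (t 0) * ((g : SL(2, k)).val 0 0 • (B 0).1 i +
      (g : SL(2, k)).val 1 0 • (B 1).1 i) +
    linSubst (g : SL(2, k)) (t 1) * ((g : SL(2, k)).val 0 1 • (B 0).1 i +
      (g : SL(2, k)).val 1 1 • (B 1).1 i) =
    ((g : SL(2, k)).val 0 0 • linSubst (g : SL(2, k)) (t 0) +
      (g : SL(2, k)).val 0 1 • linSubst (g : SL(2, k)) (t 1)) * (B 0).1 i +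
    ((g : SL(2, k)).val 1 0 • linSubst (g : SL(2, k)) (t 0) +
      (g : SL(2, k)).val 1 1 • linSubst (g : SL(2, k)) (t 1)) * (B 1).1 i
  simp only [MvPowerSeries.smul_eq_C_mul]
  ring

end Pairs

/-! ### Excluding two generators -/

section TwoGenerators

variable {k : Type u} [Field k]

lemma IsSys.isUnit_of_dvd {p q f : Pow k} (h : IsSys p q) (hp : p ≠ 0) (hfp : f ∣ p)
    (hfq : f ∣ q) : IsUnit f := by
  obtain ⟨p', rfl⟩ := hfp
  obtain ⟨q', rfl⟩ := hfq
  obtain ⟨c, hc⟩ := h.dvd p' ⟨q', by ring⟩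
  refine IsUnit.of_mul_eq_one c (mul_left_cancel₀ (right_ne_zero_of_mul hp) ?_)
  linear_combination -hc

variable {G : Subgroup SL(2, k)}

/-- The maximal ideal of the ring of invariants is not generated by two elements. -/
lemma IsMinGen.not_basis_unique {a : Fin 2 → invariantRing G} (h : IsMinGen a) [Finite G]
    [NeZero (Nat.card G : k)] [Infinite k] [Nontrivial G]
    (B : Module.Basis (Fin 1) (Pow k) (RelPow a)) : False := by
  obtain ⟨p, q, hpq, hp0, hp, hq⟩ := exists_invariant_isSys G
  -- The trivial relation (a_1, −a_0) is invariant, so its class in U vanishes and it lies in (u, v)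
  -- times the relations.
  have hx0 : ∑ i, a i * (![a 1, -a 0] : Fin 2 → invariantRing G) i = 0 := by
    rw [Fin.sum_univ_two]
    change a 0 * a 1 + a 1 * -a 0 = 0
    ring
  set x := invariantRel _ hx0 with hxdef
  have h1 : (LinearMap.range (relKoszul a)).mkQ x = 0 := h.eq_zero_of_fixed fun g => by
    rw [← map_smul, hxdef, single_smul_invariantRel]
  have h2 : ∀ y : RelPow a, y = B.repr y 0 • B 0 := fun y => by
    conv_lhs => rw [← B.sum_repr y]
    rw [Fin.sum_univ_one]
  -- With a single basis element, the trivial relation is a non-unit f times it. Then f divides a_0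
  -- and a_1, hence every invariant parameter, which contradicts regularity.
  obtain ⟨f, hf, hfx⟩ : ∃ f ∈ maxPow k, ∀ i, x.1 i = f * (B 0).1 i := by
    obtain ⟨u, hu, v, hv, huv⟩ := (mem_range_relKoszul a).1 ((Submodule.Quotient.mk_eq_zero _).1 h1)
    refine ⟨MvPowerSeries.X 0 * B.repr ⟨u, hu⟩ 0 + MvPowerSeries.X 1 * B.repr ⟨v, hv⟩ 0,
      mem_maxPow_iff.2 (by simp), fun i => ?_⟩
    have h5 : u i = B.repr ⟨u, hu⟩ 0 * (B 0).1 i :=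
      congrFun (congrArg Subtype.val (h2 ⟨u, hu⟩)) i
    have h6 : v i = B.repr ⟨v, hv⟩ 0 * (B 0).1 i :=
      congrFun (congrArg Subtype.val (h2 ⟨v, hv⟩)) i
    rw [huv, add_mul, mul_assoc, mul_assoc, ← h5, ← h6]
    rfl
  have hdvd : ∀ r ∈ maximalIdeal (invariantRing G), f ∣ (r : Pow k) := by
    intro r hr
    obtain ⟨y, rfl⟩ := h.exists_eq r hr
    rw [Fin.sum_univ_two]
    have h3 : (a 1 : Pow k) = f * (B 0).1 0 := hfx 0
    have h4 : -(a 0 : Pow k) = f * (B 0).1 1 := hfx 1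
    refine ⟨-(B 0).1 1 * y 0 + (B 0).1 0 * y 1, ?_⟩
    push_cast
    linear_combination (y 1 : Pow k) * h3 - (y 0 : Pow k) * h4
  have hu := (hpq.isUnit_of_dvd hp0 (hdvd p hp) (hdvd q hq)).map (MvPowerSeries.constantCoeff (R := k))
  rw [mem_maxPow_iff.1 hf] at hu
  exact not_isUnit_zero hu

end TwoGenerators

/-! ### Identification of the second syzygy -/

section Main

variable {k : Type u} [Field k] [IsAlgClosed k] {G : Subgroup SL(2, k)} [Finite G]
  [NeZero (Nat.card G : k)] [Nontrivial G] {e : ℕ} {a : Fin e → invariantRing G}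

/-- U is nonzero of dimension e − 1, so e ≥ 2; the numerical bound gives e ≤ 3, and e = 2 is
excluded. For e = 3 the isomorphism of U with k² lifts to the relations. -/
theorem IsMinGen.nonempty_ker_equiv (h : IsMinGen a)
    (hR : IsCanonicalModule (invariantRing G) 2 (invariantRing G))
    (φ : (Fin e → invariantRing G) →ₗ[invariantRing G] maximalIdeal (invariantRing G))
    (hφ : ∀ x, (φ x : invariantRing G) = ∑ i, a i * x i) (hsurj : Function.Surjective φ)
    {i : Fin e} (hi : a i ≠ 0) :
    Nonempty (LinearMap.ker φ ≃ₗ[invariantRing G] pairModule G) := by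
  have : Infinite k := IsAlgClosed.instInfinite
  have := h.finite_fiber
  have := h.finite_relTop
  have := h.nontrivial_relTop
  have hrel := h.mult_relation
  have hd := finrank_add_one_of_relation G (Fiber a) (RelTop a) e hrel
  have hpos : 0 < Module.finrank k (RelTop a) := Module.finrank_pos
  obtain ⟨s, hs⟩ := exists_section (LinearMap.range (relKoszul a)).mkQ (Submodule.mkQ_surjective _)
  obtain ⟨B, hB⟩ := exists_basis_relMod hd hi (Module.finBasis k (RelTop a)) s hs
  have hUB := h.homRank_relTop_fiber_le hR φ hφ hsurj _ s B hB
  obtain ⟨h3, hΘ⟩ := le_three_of_relation G (Fiber a) (RelTop a) e hrel h.homRank_fiber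
    h.homRank_relTop (homRank_trivMod_twist G) hUB
  by_cases he : e = 3
  · obtain ⟨Θ⟩ := hΘ he
    obtain ⟨B', hB'⟩ := exists_basis_relMod he.symm hi (basisOfEquiv Θ.symm) s hs
    exact nonempty_ker_equiv_of_equiv φ hφ Θ.symm s B' hB'
  · obtain rfl : e = 2 := by lia
    exact (h.not_basis_unique (B.reindex (finCongr (by lia)))).elim

end Main

end Kleinian

namespace Kleinian

open IsLocalRing

/-! ### Reflexivity of kernels -/

section Reflexive

variable {R : Type u} [CommRing R]

/-- The kernel of a nonzero linear form on a free module over a domain is reflexive. -/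
theorem isReflexive_ker [IsDomain R] {e : ℕ} (f : (Fin e → R) →ₗ[R] R) {i₀ : Fin e}
    (hi₀ : f (Pi.single i₀ 1) ≠ 0) : Module.IsReflexive R (LinearMap.ker f) := by
  set c := f (Pi.single i₀ 1) with hc
  have hf : ∀ z, f z = ∑ i, z i * f (Pi.single i 1) := fun z => by
    conv_lhs => rw [pi_eq_sum_univ' z]
    rw [map_sum]
    exact Finset.sum_congr rfl fun i _ => f.map_smul _ _
  let ρ : Fin e → Module.Dual R (LinearMap.ker f) := fun i =>
    LinearMap.proj i ∘ₗ (LinearMap.ker f).subtype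
  refine ⟨⟨fun x y hxy => ?_, fun x => ?_⟩⟩
  · exact Subtype.ext (funext fun i => DFunLike.congr_fun hxy (ρ i))
  -- The candidate preimage of x records its values on the coordinate forms ρ. It lies in the kernel
  -- because ∑ f(e_i) ρ_i vanishes there.
  have hy : f (fun i => x (ρ i)) = 0 := by
    have h1 : ∑ i, f (Pi.single i 1) • ρ i = 0 := by
      refine LinearMap.ext fun z => ?_
      rw [LinearMap.sum_apply]
      refine Eq.trans ?_ (LinearMap.mem_ker.1 z.2)
      rw [hf z.1]
      exact Finset.sum_congr rfl fun i _ => mul_comm _ _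
    have h2 := congrArg x h1
    rw [map_sum, map_zero] at h2
    rw [hf, ← h2]
    exact Finset.sum_congr rfl fun i _ => (mul_comm _ _).trans (x.map_smul _ _).symm
  refine ⟨⟨fun i => x (ρ i), hy⟩, LinearMap.ext fun l => mul_left_cancel₀ hi₀ ?_⟩
  -- A retraction onto the kernel up to the factor c: it makes c l a combination of coordinate forms
  -- for every form l, and c cancels in a domain.
  let q : (Fin e → R) →ₗ[R] LinearMap.ker f :=
    LinearMap.codRestrict _ (c • LinearMap.id - f.smulRight (Pi.single i₀ 1)) fun z => by
      rw [LinearMap.mem_ker]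
      simp only [LinearMap.sub_apply, LinearMap.smul_apply, LinearMap.id_apply,
        LinearMap.smulRight_apply, map_sub, map_smul, smul_eq_mul, ← hc]
      ring
  have hq : ∀ z : LinearMap.ker f, q z = c • z := fun z => Subtype.ext (by
    change c • z.1 - f z.1 • _ = c • z.1
    rw [LinearMap.mem_ker.1 z.2, zero_smul, sub_zero])
  have hl : ∀ z, l (q z) = ∑ i, z i * l (q (Pi.single i 1)) := fun z => by
    conv_lhs => rw [pi_eq_sum_univ' z]
    rw [map_sum, map_sum]
    refine Finset.sum_congr rfl fun i _ => ?_
    rw [map_smul, map_smul, smul_eq_mul]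
  have h3 : c • l = ∑ i, l (q (Pi.single i 1)) • ρ i := by
    refine LinearMap.ext fun z => ?_
    rw [LinearMap.sum_apply, LinearMap.smul_apply, ← map_smul, ← hq, hl]
    exact Finset.sum_congr rfl fun i _ => mul_comm _ _
  have h4 := congrArg x h3
  rw [map_smul, map_sum] at h4
  change c * l _ = c * x l
  rw [← smul_eq_mul c (x l), h4, ← smul_eq_mul, ← map_smul, ← hq, hl]
  exact Finset.sum_congr rfl fun i _ => (mul_comm _ _).trans (x.map_smul _ _).symm

end Reflexive

/-! ### Minimal covers and syzygies -/

section Syzygy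

variable {R : Type u} [CommRing R]

lemma mem_ideal_smul_pi_iff {I : Ideal R} {r : ℕ} {x : Fin r → R} :
    x ∈ I • (⊤ : Submodule R (Fin r → R)) ↔ ∀ i, x i ∈ I := by
  constructor
  · intro hx i
    induction hx using Submodule.smul_induction_on' with
    | smul c hc y _ => exact I.mul_mem_right _ hc
    | add y _ z _ hy hz => exact I.add_mem hy hz
  · intro hx
    rw [pi_eq_sum_univ' x]
    exact Submodule.sum_mem _ fun i _ => Submodule.smul_mem_smul (hx i) trivial

variable [IsLocalRing R]

/-- Every finite module over a local ring has a minimal cover by a free module. -/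
lemma exists_minimal_cover (M : Type u) [AddCommGroup M] [Module R M] [Module.Finite R M] :
    ∃ (r : ℕ) (f : (Fin r → R) →ₗ[R] M), Function.Surjective f ∧
      LinearMap.ker f ≤ maximalIdeal R • (⊤ : Submodule R (Fin r → R)) := by
  classical
  have hex : ∃ (r : ℕ) (f : (Fin r → R) →ₗ[R] M), Function.Surjective f :=
    Module.Finite.exists_fin' R M
  obtain ⟨f, hf⟩ := Nat.find_spec hex
  refine ⟨Nat.find hex, f, hf, fun x hx => mem_ideal_smul_pi_iff.2 ?_⟩
  -- With the rank chosen minimal, a relation with a unit coefficient at i would allow the generator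
  -- i to be dropped.
  by_contra! hi
  obtain ⟨i, hi⟩ := hi
  obtain ⟨u, hu⟩ := notMem_maximalIdeal.1 hi
  have hmin : ∀ m < Nat.find hex, ¬ ∃ f : (Fin m → R) →ₗ[R] M, Function.Surjective f :=
    fun m hm => Nat.find_min hex hm
  generalize Nat.find hex = r at *
  obtain _ | n := r
  · exact i.elim0
  refine hmin n (Nat.lt_succ_self n) ⟨f ∘ₗ Function.ExtendByZero.linearMap R i.succAbove, fun m => ?_⟩
  obtain ⟨w, rfl⟩ := hf m
  let w' := w - (w i * ↑u⁻¹) • x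
  have hw' : w' i = 0 := by
    change w i - w i * ↑u⁻¹ * x i = 0
    rw [← hu, Units.inv_mul_cancel_right, sub_self]
  refine ⟨fun j => w' (i.succAbove j), ?_⟩
  have h1 : Function.ExtendByZero.linearMap R i.succAbove (fun j => w' (i.succAbove j)) = w' := by
    funext j
    rcases Fin.eq_self_or_eq_succAbove i j with rfl | ⟨j, rfl⟩
    · rw [hw']
      refine Function.extend_apply' (f := j.succAbove) (fun l => w' (j.succAbove l)) 0 j ?_
      rintro ⟨l, hl⟩
      exact Fin.succAbove_ne _ l hl
    · exact Function.Injective.extend_apply (Fin.succAbove_right_injective (p := i))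
        (fun j => w' (i.succAbove j)) 0 j
  rw [LinearMap.comp_apply, h1, map_sub, map_smul, LinearMap.mem_ker.1 hx, smul_zero, sub_zero]

/-- The kernel of a minimal cover of the residue field is the maximal ideal. -/
lemma nonempty_ker_equiv_maximalIdeal {r : ℕ} (f : (Fin r → R) →ₗ[R] ResidueField R)
    (hf : Function.Surjective f)
    (hker : LinearMap.ker f ≤ maximalIdeal R • (⊤ : Submodule R (Fin r → R))) :
    Nonempty (LinearMap.ker f ≃ₗ[R] maximalIdeal R) := by
  classical
  have hmem : ∀ x, f x = 0 → ∀ i, x i ∈ maximalIdeal R := fun x hx =>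
    mem_ideal_smul_pi_iff.1 (hker hx)
  have hne : ∀ i, f (Pi.single i 1) ≠ 0 := fun i h0 => by
    have := hmem _ h0 i
    rw [Pi.single_eq_same] at this
    exact (Ideal.ne_top_iff_one _).1 (maximalIdeal.isMaximal R).ne_top this
  -- Two basis vectors with nonzero images in the field κ would give a kernel element with a
  -- coordinate equal to 1, so the rank is at most one.
  have huniq : ∀ i j : Fin r, i = j := fun i j => by
    by_contra hij
    obtain ⟨c, hc⟩ := residue_surjective (f (Pi.single j 1) / f (Pi.single i 1))
    have h1 := hmem (Pi.single j 1 - c • Pi.single i 1) (by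
      rw [map_sub, map_smul, Algebra.smul_def]
      change _ - residue R c * _ = 0
      rw [hc, div_mul_cancel₀ _ (hne i), sub_self]) j
    have h2 : (Pi.single j 1 - c • Pi.single i 1 : Fin r → R) j = 1 := by
      rw [Pi.sub_apply, Pi.smul_apply, Pi.single_eq_same, Pi.single_eq_of_ne (Ne.symm hij),
        smul_zero, sub_zero]
    rw [h2] at h1
    exact (Ideal.ne_top_iff_one _).1 (maximalIdeal.isMaximal R).ne_top h1
  obtain ⟨w, hw⟩ := hf 1
  have hr : 0 < r := by
    rcases Nat.eq_zero_or_pos r with rfl | h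
    · rw [Subsingleton.elim w 0, map_zero] at hw
      exact (zero_ne_one hw).elim
    · exact h
  let i : Fin r := ⟨0, hr⟩
  let p : LinearMap.ker f →ₗ[R] maximalIdeal R :=
    LinearMap.codRestrict _ (LinearMap.proj i ∘ₗ (LinearMap.ker f).subtype)
      fun x => hmem x.1 x.2 i
  refine ⟨LinearEquiv.ofBijective p ⟨fun x y hxy => ?_, fun m => ?_⟩⟩
  · refine Subtype.ext (funext fun j => ?_)
    rw [huniq j i]
    exact congrArg Subtype.val hxy
  · refine ⟨⟨Pi.single i m.1, ?_⟩, Subtype.ext (Pi.single_eq_same (M := fun _ => R) i m.1)⟩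
    have h1 : (Pi.single i m.1 : Fin r → R) = m.1 • Pi.single i 1 := by
      rw [← Pi.single_smul, smul_eq_mul, mul_one]
    rw [LinearMap.mem_ker, h1, map_smul, Algebra.smul_def]
    change residue R m.1 * _ = 0
    rw [(residue_eq_zero_iff _).2 m.2, zero_mul]

/-- A second syzygy of the residue field is the kernel of a minimal cover of the maximal ideal. -/
lemma IsSyzygy.exists_cover_maximalIdeal {N : Type u} [AddCommGroup N] [Module R N]
    (h : IsSyzygy R 2 (ResidueField R) N) :
    ∃ (e : ℕ) (φ : (Fin e → R) →ₗ[R] maximalIdeal R), Function.Surjective φ ∧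
      (∀ x, φ x = 0 → ∀ i, x i ∈ maximalIdeal R) ∧ Nonempty (N ≃ₗ[R] LinearMap.ker φ) := by
  obtain ⟨r, f, hf, hker, e, f', hf', hker', ⟨E⟩⟩ := h
  obtain ⟨p⟩ := nonempty_ker_equiv_maximalIdeal f hf hker
  refine ⟨e, p.toLinearMap ∘ₗ f', p.surjective.comp hf',
    fun x hx => mem_ideal_smul_pi_iff.1 (hker' (p.map_eq_zero_iff.1 hx)),
    ⟨E.trans (LinearEquiv.ofEq _ _ ?_)⟩⟩
  rw [LinearEquiv.ker_comp]

/-- The residue field of a noetherian local ring has a second syzygy. -/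
lemma exists_isSyzygy_two [IsNoetherianRing R] :
    ∃ N : ModuleCat.{u} R, IsSyzygy R 2 (ResidueField R) N := by
  let f : (Fin 1 → R) →ₗ[R] ResidueField R := Algebra.linearMap R (ResidueField R) ∘ₗ LinearMap.proj 0
  obtain ⟨e, f', hf', hker'⟩ := exists_minimal_cover (R := R) (LinearMap.ker f)
  refine ⟨ModuleCat.of R (LinearMap.ker f'), 1, f, ?_, ?_, e, f', hf', hker',
    ⟨LinearEquiv.refl R _⟩⟩
  · exact residue_surjective.comp fun c => ⟨fun _ => c, rfl⟩
  · refine fun x hx => mem_ideal_smul_pi_iff.2 fun i => ?_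
    rw [Fin.eq_zero i]
    exact (residue_eq_zero_iff _).1 hx

end Syzygy

end Kleinian

namespace Kleinian

open IsLocalRing

/-! ### Assembly -/

section Main

variable {k : Type u} [Field k] [IsAlgClosed k] (G : Subgroup SL(2, k)) [Finite G]
  [NeZero (Nat.card G : k)] [Nontrivial G]

/-- Linear algebra data of a second syzygy of the residue field of the ring of invariants. -/
lemma nonempty_ker_equiv_pairModule
    (hR : IsCanonicalModule (invariantRing G) 2 (invariantRing G))
    (hm : ∃ p ∈ maximalIdeal (invariantRing G), p ≠ 0) {e : ℕ}
    (φ : (Fin e → invariantRing G) →ₗ[invariantRing G] maximalIdeal (invariantRing G))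
    (hφ : Function.Surjective φ)
    (hker : ∀ x, φ x = 0 → ∀ i, x i ∈ maximalIdeal (invariantRing G)) :
    Nonempty (LinearMap.ker φ ≃ₗ[invariantRing G] pairModule G) ∧
      Module.IsReflexive (invariantRing G) (LinearMap.ker φ) := by
  let a : Fin e → invariantRing G := fun i => φ (Pi.single i 1)
  have ha : ∀ x, (φ x : invariantRing G) = ∑ i, a i * x i := fun x => by
    conv_lhs => rw [pi_eq_sum_univ' x]
    rw [map_sum, Submodule.coe_sum]
    refine Finset.sum_congr rfl fun i _ => ?_
    rw [map_smul, Submodule.coe_smul, smul_eq_mul, mul_comm]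
  have h : IsMinGen a := by
    refine ⟨fun i => (φ _).2, fun r hr => ?_, fun x hx => hker x (Subtype.ext ((ha x).trans hx))⟩
    obtain ⟨x, hx⟩ := hφ ⟨r, hr⟩
    exact ⟨x, by rw [← ha, hx]⟩
  obtain ⟨i, hi⟩ : ∃ i, a i ≠ 0 := by
    by_contra! h0
    obtain ⟨p, hp, hp0⟩ := hm
    obtain ⟨x, hx⟩ := h.exists_eq p hp
    exact hp0 (hx.trans (Finset.sum_eq_zero fun i _ => by rw [h0, zero_mul]))
  refine ⟨h.nonempty_ker_equiv hR φ ha hφ hi, ?_⟩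
  have h1 := isReflexive_ker ((maximalIdeal (invariantRing G)).subtype ∘ₗ φ) (i₀ := i) hi
  rwa [LinearMap.ker_comp_of_ker_eq_bot _ (Submodule.ker_subtype _)] at h1

theorem isFundamentalModule_and_nonempty_equiv :
    IsFundamentalModule (invariantRing G) (pairModule G) ∧
    (∀ (N : Type u) [AddCommGroup N] [Module (invariantRing G) N],
      IsSyzygy (invariantRing G) 2 (ResidueField (invariantRing G)) N →
        Nonempty (N ≃ₗ[invariantRing G] pairModule G)) ∧
    ∀ (E : Type u) [AddCommGroup E] [Module (invariantRing G) E],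
      IsFundamentalModule (invariantRing G) E →
        Nonempty (pairModule G ≃ₗ[invariantRing G] E) := by
  have : Infinite k := IsAlgClosed.instInfinite
  obtain ⟨a, b, hab, ha0, ha, hb⟩ := exists_invariant_isSys G
  obtain ⟨δ, hδ⟩ := isGorensteinSystem_of_isSys G hab ha0 ha hb
  have hR := hδ.isCanonicalModule
  have hm : ∃ p ∈ maximalIdeal (invariantRing G), p ≠ 0 :=
    ⟨a, ha, fun h => ha0 (congrArg Subtype.val h)⟩
  have hns := not_exists_section_pairProj G hab ha0 ha hb
  refine ⟨⟨finite_pairModule G, ?_, invariantRing G, inferInstance, inferInstance, pairInl G,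
    pairProj G, hR, pairInl_injective G, exact_pairInl_pairProj G, pairProj_surjective G, hns⟩,
    fun N _ _ hN => ?_, fun E _ _ hE => ?_⟩
  -- Reflexivity of the invariant pairs is transported from a second syzygy, which is the kernel of
  -- a nonzero linear form on a free module.
  · obtain ⟨N, hN⟩ := exists_isSyzygy_two (R := invariantRing G)
    obtain ⟨e, φ, hφ, hker, -⟩ := hN.exists_cover_maximalIdeal
    obtain ⟨⟨Ψ⟩, hrefl⟩ := nonempty_ker_equiv_pairModule G hR hm φ hφ hker
    exact Module.equiv Ψ
  · obtain ⟨e, φ, hφ, hker, ⟨Φ⟩⟩ := hN.exists_cover_maximalIdeal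
    obtain ⟨⟨Ψ⟩, -⟩ := nonempty_ker_equiv_pairModule G hR hm φ hφ hker
    exact ⟨Φ.trans Ψ⟩
  · exact hδ.nonempty_equiv_of_isFundamentalModule (E := pairModule G) (E' := E) (pairInl G) (pairProj G) (pairInl_injective G)
      (exact_pairInl_pairProj G) (pairProj_surjective G) hns hE

end Main

end Kleinian

theorem mainTheorem5 {k : Type u} [Field k] [IsAlgClosed k]
    (G : Subgroup (Matrix.SpecialLinearGroup (Fin 2) k)) [Finite G] [Nontrivial G]
    (hG : Kleinian.IsKleinGroup G) (hchar : ¬ ringChar k ∣ Nat.card G) :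
    (∃ E : ModuleCat.{u} (Kleinian.invariantRing G),
      Kleinian.IsFundamentalModule (Kleinian.invariantRing G) E) ∧
    (∃ N : ModuleCat.{u} (Kleinian.invariantRing G),
      Kleinian.IsSyzygy (Kleinian.invariantRing G) 2
        (IsLocalRing.ResidueField (Kleinian.invariantRing G)) N) ∧
    ∀ (N : Type u) [AddCommGroup N] [Module (Kleinian.invariantRing G) N],
      Kleinian.IsSyzygy (Kleinian.invariantRing G) 2
        (IsLocalRing.ResidueField (Kleinian.invariantRing G)) N →
      (∀ (E : Type u) [AddCommGroup E] [Module (Kleinian.invariantRing G) E],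
        Kleinian.IsFundamentalModule (Kleinian.invariantRing G) E →
        Nonempty (N ≃ₗ[Kleinian.invariantRing G] E)) ∧
      Nonempty (N ≃ₗ[Kleinian.invariantRing G]
        Kleinian.auslanderModule G (Kleinian.fundamentalRep G)) := by
  have : NeZero (Nat.card G : k) := ⟨fun h => hchar ((ringChar.spec k _).1 h)⟩
  obtain ⟨h1, h2, h3⟩ := Kleinian.isFundamentalModule_and_nonempty_equiv G
  refine ⟨⟨ModuleCat.of _ (Kleinian.pairModule G), h1⟩, Kleinian.exists_isSyzygy_two,
    fun N _ _ hN => ?_⟩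
  obtain ⟨Φ⟩ := h2 N hN
  refine ⟨fun E _ _ hE => ?_, ?_⟩
  · obtain ⟨Ψ⟩ := h3 E hE
    exact ⟨Φ.trans Ψ⟩
  · obtain ⟨Ψ⟩ := Kleinian.nonempty_auslanderModule_equiv G
    exact ⟨Φ.trans Ψ.symm⟩
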